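/- Let $\mathcal O=[0,2\pi]^2$ with periodic boundary conditions. Let $\mathbf H$ be the space of periodic fields $u\in L^2(\mathcal O;\mathbb R^2)$ with $\int_{\mathcal O}u\,dx=0$ and $\operatorname{div}u=0$, with norm $|\cdot|$ and inner product inherited from $L^2$; let $\mathbf V=D(\mathrm A^{1/2})=\mathbf H\cap \mathbf H^1$, let $\Pi:L^2(\mathcal O;\mathbb R^2)\to\mathbf H$ be the Helmholtz–Leray projection, $\mathrm A=-\Pi\Delta$ the Stokes operator with domain $D(\mathrm A)=\mathbf H\cap\mathbf H^2$, and $B(u,v)=\Pi(u\cdot\nabla v)$. Here $\mathbf H^m$ denotes the periodic Sobolev space of order $m$ of $\mathbb R^2$-valued fields. Let $\mathrm K$ be a separable real Hilbert space and let $G:\mathbf H\to\mathscr L_2(\mathrm K,\mathbf H)\cap\mathscr L_2(\mathrm K,\mathbf V)$ (Hilbert–Schmidt operators) be such that, for some constant $C>0$ and all $u,v\in\mathbf H$, $$\|G(u)-G(v)\|_{\mathscr L_2(\mathrm K,\mathbf V)}+\|G(u)-G(v)\|_{\mathscr L_2(\mathrm K,\mathbf H)}\le C|u-v|,\qquad \|G(u)\|_{\mathscr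 L_2(\mathrm K,\mathbf V)}+\|G(u)\|_{\mathscr L_2(\mathrm K,\mathbf H)}\le C(1+|u|).$$ Let $T\in(0,\infty)$, $\delta\in\{0,1\}$ and $\xi\in D(\mathrm A^{1/2})$. Then the following hold. (0) The Navier–Stokes equation $\mathbf u'+\mathrm A\mathbf u+B(\mathbf u,\mathbf u)=0$, $\mathbf u(0)=\xi$, has a unique solution $\mathbf u\in C([0,T];\mathbf V)\cap L^2(0,T;D(\mathrm A))$, and for every $h\in L^2(0,T;\mathrm K)$ the controlled equation $$\mathbf y'+\mathrm A\mathbf y+(1-\delta)B(\mathbf y,\mathbf y)+\delta B(\mathbf u,\mathbf y)+\delta B(\mathbf y,\mathbf u)=G(\delta\mathbf u+(1-\delta)\mathbf y)\,h,\qquad \mathbf y(0)=(1-\delta)\xi,$$ has a unique solution $\mathbf y\in C([0,T];\mathbf V)\cap L^2(0,T;D(\mathrm A))$; both equations are understood in $\mathbf H$, integrated in time. Hence the map $\Gamma^{0,\delta}_\xi:C([0,T];\mathrm K)\to C([0,T];\mathbf H)\cap L^2(0,T;D(\mathrm A^{1/2}))$ which sends $\int_0^\cdot h(r)\,dr$,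 $h\in L^2(0,T;\mathrm K)$, to this solution, and every other path to $0$, is well defined. For $M>0$ let $\mathcal A_M=\{h\in L^2(0,T;\mathrm K):\int_0^T\|h(r)\|_{\mathrm K}^2\,dr\le M\}$. Then, for every $M>0$: (1) the set $\{\Gamma^{0,\delta}_\xi(\int_0^\cdot h(r)\,dr):h\in\mathcal A_M\}$ is compact in $C([0,T];\mathbf H)\cap L^2(0,T;D(\mathrm A^{1/2}))$; (2) if $h_n,h\in\mathcal A_M$ and $h_n\to h$ weakly in $L^2(0,T;\mathrm K)$, then $\Gamma^{0,\delta}_\xi(\int_0^\cdot h_n(r)\,dr)\to\Gamma^{0,\delta}_\xi(\int_0^\cdot h(r)\,dr)$ in $C([0,T];\mathbf H)\cap L^2(0,T;D(\mathrm A^{1/2}))$. -/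

import Mathlib

open MeasureTheory Filter Topology Set
open scoped ENNReal NNReal ContDiff

noncomputable section

namespace TorusNSE

/-! ## Periodic vector fields on the two-dimensional torus of side `2π` -/

/-- The Euclidean plane. -/
abbrev Plane : Type := EuclideanSpace ℝ (Fin 2)

/-- The periodicity cell `[0, 2π]²`. -/
def cell : Set Plane := {x | ∀ i, x i ∈ Icc (0 : ℝ) (2 * Real.pi)}

/-- Lebesgue measure on the cell. -/
def cellMeasure : Measure Plane := (volume : Measure Plane).restrict cell

theorem isCompact_cell : IsCompact cell := by
  have h : cell = (EuclideanSpace.equiv (Fin 2) ℝ).symm ''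
      (Set.pi univ fun _ => Icc (0 : ℝ) (2 * Real.pi)) := by
    ext x
    constructor
    · intro hx
      exact ⟨EuclideanSpace.equiv (Fin 2) ℝ x, fun i _ => hx i, by simp⟩
    · rintro ⟨y, hy, rfl⟩ i
      exact hy i (mem_univ i)
  rw [h]
  exact (isCompact_univ_pi fun _ => isCompact_Icc).image
    (EuclideanSpace.equiv (Fin 2) ℝ).symm.continuous

instance : IsFiniteMeasure cellMeasure := by
  refine ⟨?_⟩
  rw [cellMeasure, Measure.restrict_apply_univ]
  exact isCompact_cell.measure_lt_top

/-- The space `𝐋²` of square integrable `ℝ²`-valued fields on the torus, a field on the torus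
being identified with its restriction to the cell. -/
abbrev L2 : Type := Lp Plane 2 cellMeasure

/-- Smooth functions on the plane that are `2π`-periodic in each coordinate direction. -/
structure IsPeriodicTest (φ : Plane → ℝ) : Prop where
  smooth : ContDiff ℝ ∞ φ
  periodic : ∀ (i : Fin 2) (x : Plane), φ (x + EuclideanSpace.single i (2 * Real.pi)) = φ x

/-- The partial derivative `∂ⱼ φ (x)` of a scalar function. -/
def partialDeriv (j : Fin 2) (φ : Plane → ℝ) (x : Plane) : ℝ :=
  fderiv ℝ φ x (EuclideanSpace.single j 1)

/-- `g` is the weak partial derivative `∂ⱼ u` on the torus. -/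
def IsWeakPartial (j : Fin 2) (u g : L2) : Prop :=
  ∀ φ : Plane → ℝ, IsPeriodicTest φ →
    ∫ x, partialDeriv j φ x • u x ∂cellMeasure = - ∫ x, φ x • g x ∂cellMeasure

/-- `u` has zero mean over the cell. -/
def IsMeanZero (u : L2) : Prop := ∫ x, u x ∂cellMeasure = 0

/-- `div u = 0` on the torus in the sense of distributions: `∫ u · ∇φ = 0` for all periodic
test functions `φ`. -/
def IsDivFree (u : L2) : Prop :=
  ∀ φ : Plane → ℝ, IsPeriodicTest φ → ∫ x, fderiv ℝ φ x (u x) ∂cellMeasure = 0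

theorem integrable_field (u : L2) : Integrable (fun x => u x) cellMeasure :=
  (Lp.memLp u).integrable (by norm_num)

/-- Integration of an `L²` field against a continuous weight. -/
theorem exists_pairing {F : Type*} [NormedAddCommGroup F] [NormedSpace ℝ F]
    (c : Plane → (Plane →L[ℝ] F)) (hc : Continuous c) :
    ∃ P : L2 →L[ℝ] F, ∀ u : L2, P u = ∫ x, c x (u x) ∂cellMeasure := by
  obtain ⟨C, hC⟩ := isCompact_cell.exists_bound_of_continuousOn hc.continuousOn
  have hae : ∀ᵐ x ∂cellMeasure, ‖c x‖ ≤ C := by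
    rw [cellMeasure]
    exact (ae_restrict_iff' isCompact_cell.measurableSet).2 (Eventually.of_forall hC)
  have hint : ∀ u : L2, Integrable (fun x => c x (u x)) cellMeasure := by
    intro u
    refine Integrable.mono' ((integrable_field u).norm.const_mul C) ?_ ?_
    · exact (ContinuousLinearMap.apply ℝ F).flip.aestronglyMeasurable_comp₂
        hc.aestronglyMeasurable (Lp.aestronglyMeasurable u)
    · filter_upwards [hae] with x hx
      exact (c x).le_of_opNorm_le hx (u x)
  let L : L2 →ₗ[ℝ] F :=
    { toFun := fun u => ∫ x, c x (u x) ∂cellMeasure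
      map_add' := by
        intro u v
        rw [← integral_add (hint u) (hint v)]
        refine integral_congr_ae ?_
        filter_upwards [Lp.coeFn_add u v] with x hx
        rw [hx, Pi.add_apply, map_add]
      map_smul' := by
        intro r u
        rw [RingHom.id_apply, ← integral_smul]
        refine integral_congr_ae ?_
        filter_upwards [Lp.coeFn_smul r u] with x hx
        rw [hx, Pi.smul_apply, map_smul] }
  have hbound : ∀ u : L2, ‖L u‖ ≤ (|C| * (cellMeasure univ ^ (1 / 2 : ℝ)).toReal) * ‖u‖ := by
    intro u
    have h1 : ‖L u‖ ≤ ∫ x, |C| * ‖u x‖ ∂cellMeasure := by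
      refine norm_integral_le_of_norm_le ((integrable_field u).norm.const_mul _) ?_
      filter_upwards [hae] with x hx
      exact (c x).le_of_opNorm_le (hx.trans (le_abs_self C)) (u x)
    have h2 : ∫ x, ‖u x‖ ∂cellMeasure ≤
        ‖u‖ * (cellMeasure univ ^ (1 / 2 : ℝ)).toReal := by
      have h3 := eLpNorm_le_eLpNorm_mul_rpow_measure_univ (p := 1) (q := 2)
        (by norm_num) (Lp.aestronglyMeasurable u)
      have h4 : (1 / (1 : ℝ≥0∞).toReal - 1 / (2 : ℝ≥0∞).toReal) = (1 / 2 : ℝ) := by norm_num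
      rw [h4] at h3
      have h5 : (eLpNorm (fun x => u x) 1 cellMeasure).toReal = ∫ x, ‖u x‖ ∂cellMeasure := by
        rw [eLpNorm_one_eq_lintegral_enorm,
          integral_norm_eq_lintegral_enorm (Lp.aestronglyMeasurable u)]
      rw [← h5, Lp.norm_def, ← ENNReal.toReal_mul]
      refine ENNReal.toReal_mono ?_ h3
      exact ENNReal.mul_ne_top (Lp.eLpNorm_ne_top u)
        (ENNReal.rpow_ne_top_of_nonneg (by norm_num) (measure_ne_top _ _))
    rw [integral_const_mul] at h1
    calc ‖L u‖ ≤ |C| * ∫ x, ‖u x‖ ∂cellMeasure := h1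
      _ ≤ |C| * (‖u‖ * (cellMeasure univ ^ (1 / 2 : ℝ)).toReal) := by gcongr
      _ = _ := by ring
  exact ⟨L.mkContinuous _ hbound, fun u => rfl⟩

theorem continuous_fderiv_test {φ : Plane → ℝ} (hφ : IsPeriodicTest φ) :
    Continuous (fderiv ℝ φ) :=
  hφ.smooth.continuous_fderiv (by simp)

theorem exists_pairing_mean :
    ∃ P : L2 →L[ℝ] Plane, ∀ u : L2, P u = ∫ x, u x ∂cellMeasure :=
  exists_pairing (fun _ => ContinuousLinearMap.id ℝ Plane) continuous_const

theorem exists_pairing_div {φ : Plane → ℝ} (hφ : IsPeriodicTest φ) :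
    ∃ P : L2 →L[ℝ] ℝ, ∀ u : L2, P u = ∫ x, fderiv ℝ φ x (u x) ∂cellMeasure :=
  exists_pairing _ (continuous_fderiv_test hφ)

theorem exists_pairing_smul {ψ : Plane → ℝ} (hψ : Continuous ψ) :
    ∃ P : L2 →L[ℝ] Plane, ∀ u : L2, P u = ∫ x, ψ x • u x ∂cellMeasure := by
  obtain ⟨P, hP⟩ := exists_pairing (fun x => ψ x • ContinuousLinearMap.id ℝ Plane)
    (hψ.smul continuous_const)
  exact ⟨P, fun u => by simpa using hP u⟩

theorem continuous_partialDeriv {φ : Plane → ℝ} (hφ : IsPeriodicTest φ) (j : Fin 2) :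
    Continuous (partialDeriv j φ) :=
  (continuous_fderiv_test hφ).clm_apply continuous_const

theorem IsWeakPartial.zero (j : Fin 2) : IsWeakPartial j 0 0 := by
  intro φ hφ
  obtain ⟨P, hP⟩ := exists_pairing_smul (continuous_partialDeriv hφ j)
  obtain ⟨Q, hQ⟩ := exists_pairing_smul hφ.smooth.continuous
  rw [← hP, ← hQ, map_zero, map_zero, neg_zero]

theorem IsWeakPartial.add {j : Fin 2} {u g v k : L2} (h₁ : IsWeakPartial j u g)
    (h₂ : IsWeakPartial j v k) : IsWeakPartial j (u + v) (g + k) := by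
  intro φ hφ
  obtain ⟨P, hP⟩ := exists_pairing_smul (continuous_partialDeriv hφ j)
  obtain ⟨Q, hQ⟩ := exists_pairing_smul hφ.smooth.continuous
  have e₁ := h₁ φ hφ
  have e₂ := h₂ φ hφ
  rw [← hP, ← hQ] at e₁ e₂ ⊢
  rw [map_add, map_add, e₁, e₂, neg_add]

theorem IsWeakPartial.smul {j : Fin 2} {u g : L2} (r : ℝ) (h : IsWeakPartial j u g) :
    IsWeakPartial j (r • u) (r • g) := by
  intro φ hφ
  obtain ⟨P, hP⟩ := exists_pairing_smul (continuous_partialDeriv hφ j)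
  obtain ⟨Q, hQ⟩ := exists_pairing_smul hφ.smooth.continuous
  have e := h φ hφ
  rw [← hP, ← hQ] at e ⊢
  rw [map_smul, map_smul, e, smul_neg]

/-! ## The spaces `𝐇`, `𝐕 = D(A^{1/2})` and `D(A)` -/

/-- The space `𝐇` of square integrable, mean zero, divergence free fields, as a subspace
of `𝐋²`. -/
def solenoidal : Submodule ℝ L2 where
  carrier := {u | IsMeanZero u ∧ IsDivFree u}
  zero_mem' := by
    obtain ⟨P, hP⟩ := exists_pairing_mean
    refine ⟨by rw [IsMeanZero, ← hP, map_zero], fun φ hφ => ?_⟩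
    obtain ⟨Q, hQ⟩ := exists_pairing_div hφ
    rw [← hQ, map_zero]
  add_mem' := by
    rintro u v ⟨hu, hu'⟩ ⟨hv, hv'⟩
    obtain ⟨P, hP⟩ := exists_pairing_mean
    refine ⟨?_, fun φ hφ => ?_⟩
    · rw [IsMeanZero, ← hP] at hu hv ⊢
      rw [map_add, hu, hv, add_zero]
    · obtain ⟨Q, hQ⟩ := exists_pairing_div hφ
      have e₁ := hu' φ hφ
      have e₂ := hv' φ hφ
      rw [← hQ] at e₁ e₂ ⊢
      rw [map_add, e₁, e₂, add_zero]
  smul_mem' := by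
    rintro r u ⟨hu, hu'⟩
    obtain ⟨P, hP⟩ := exists_pairing_mean
    refine ⟨?_, fun φ hφ => ?_⟩
    · rw [IsMeanZero, ← hP] at hu ⊢
      rw [map_smul, hu, smul_zero]
    · obtain ⟨Q, hQ⟩ := exists_pairing_div hφ
      have e := hu' φ hφ
      rw [← hQ] at e ⊢
      rw [map_smul, e, smul_zero]

theorem isClosed_solenoidal : IsClosed (solenoidal : Set L2) := by
  obtain ⟨P, hP⟩ := exists_pairing_mean
  have h₁ : IsClosed {u : L2 | IsMeanZero u} := by
    have : {u : L2 | IsMeanZero u} = {u | P u = 0} := by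
      ext u
      simp only [mem_ofPred_eq, IsMeanZero, hP]
    rw [this]
    exact isClosed_eq P.continuous continuous_const
  have h₂ : IsClosed {u : L2 | IsDivFree u} := by
    have : {u : L2 | IsDivFree u} = ⋂ (φ : Plane → ℝ) (_ : IsPeriodicTest φ),
        {u : L2 | ∫ x, fderiv ℝ φ x (u x) ∂cellMeasure = 0} := by
      ext u
      simp only [mem_ofPred_eq, IsDivFree, mem_iInter]
    rw [this]
    refine isClosed_iInter fun φ => isClosed_iInter fun hφ => ?_
    obtain ⟨Q, hQ⟩ := exists_pairing_div hφ
    simp only [← hQ]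
    exact isClosed_eq Q.continuous continuous_const
  exact h₁.inter h₂

/-- The Hilbert space `𝐇`, with the inner product of `𝐋²`. -/
def H : Type := ↥solenoidal

instance : NormedAddCommGroup H := inferInstanceAs (NormedAddCommGroup ↥solenoidal)

instance : InnerProductSpace ℝ H := inferInstanceAs (InnerProductSpace ℝ ↥solenoidal)

/-- The inclusion `𝐇 → 𝐋²`. -/
def hToL2 : H →L[ℝ] L2 := solenoidal.subtypeL

instance : CompleteSpace ↥solenoidal := isClosed_solenoidal.completeSpace_coe

instance : CompleteSpace H := inferInstanceAs (CompleteSpace ↥solenoidal)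

/-- The Helmholtz–Leray projection `Π : 𝐋² → 𝐇`, the orthogonal projection. -/
def leray : L2 →L[ℝ] H := solenoidal.orthogonalProjectionOnto

/-- The Hilbert space `𝐇 × (L²)²` of pairs formed by a field and a candidate gradient. -/
def GradPair : Type := WithLp 2 (H × PiLp 2 fun _ : Fin 2 => L2)

instance : NormedAddCommGroup GradPair :=
  inferInstanceAs (NormedAddCommGroup (WithLp 2 (H × PiLp 2 fun _ : Fin 2 => L2)))

instance : InnerProductSpace ℝ GradPair :=
  inferInstanceAs (InnerProductSpace ℝ (WithLp 2 (H × PiLp 2 fun _ : Fin 2 => L2)))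

/-- The field of a pair. -/
def GradPair.field : GradPair →L[ℝ] H := WithLp.fstL 2 ℝ H (PiLp 2 fun _ : Fin 2 => L2)

/-- The `j`-th entry of the candidate gradient of a pair. -/
def GradPair.entry (j : Fin 2) : GradPair →L[ℝ] L2 :=
  (PiLp.proj 2 (fun _ : Fin 2 => L2) j).comp (WithLp.sndL 2 ℝ H (PiLp 2 fun _ : Fin 2 => L2))

/-- The subspace underlying `𝐕 = 𝐇 ∩ 𝐇¹`: pairs of a field of `𝐇` and its weak gradient
`(∂₀ u, ∂₁ u)` in `L²`. -/
def gradGraph : Submodule ℝ GradPair where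
  carrier := {p | ∀ j, IsWeakPartial j (hToL2 (GradPair.field p)) (GradPair.entry j p)}
  zero_mem' := fun j => by
    rw [map_zero, map_zero, map_zero]
    exact IsWeakPartial.zero j
  add_mem' := fun hp hq j => by
    rw [map_add, map_add, map_add]
    exact (hp j).add (hq j)
  smul_mem' := fun r _ hp j => by
    rw [map_smul, map_smul, map_smul]
    exact (hp j).smul r

/-- The Hilbert space `𝐕 = D(A^{1/2}) = 𝐇 ∩ 𝐇¹`, with the norm `(|u|² + |∇u|²)^{1/2}` of `𝐇¹`
(which on these mean zero fields is equivalent to `|∇u| = |A^{1/2} u|`). -/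
def V : Type := ↥gradGraph

instance : NormedAddCommGroup V := inferInstanceAs (NormedAddCommGroup ↥gradGraph)

instance : InnerProductSpace ℝ V := inferInstanceAs (InnerProductSpace ℝ ↥gradGraph)

/-- The inclusion `𝐕 → 𝐇`. -/
def vToH : V →L[ℝ] H := GradPair.field.comp gradGraph.subtypeL

/-- The weak partial derivative `∂ⱼ u` of a field `u ∈ 𝐕`. -/
def grad (j : Fin 2) : V →L[ℝ] L2 := (GradPair.entry j).comp gradGraph.subtypeL

/-- The Hilbert space `𝐕 × (L²)⁴` of pairs formed by a field and a candidate family of second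
derivatives. -/
def HessPair : Type := WithLp 2 (V × PiLp 2 fun _ : Fin 2 × Fin 2 => L2)

instance : NormedAddCommGroup HessPair :=
  inferInstanceAs (NormedAddCommGroup (WithLp 2 (V × PiLp 2 fun _ : Fin 2 × Fin 2 => L2)))

instance : InnerProductSpace ℝ HessPair :=
  inferInstanceAs (InnerProductSpace ℝ (WithLp 2 (V × PiLp 2 fun _ : Fin 2 × Fin 2 => L2)))

/-- The field of a pair. -/
def HessPair.field : HessPair →L[ℝ] V :=
  WithLp.fstL 2 ℝ V (PiLp 2 fun _ : Fin 2 × Fin 2 => L2)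

/-- The entry of index `(i, j)` of the candidate family of second derivatives of a pair. -/
def HessPair.entry (i j : Fin 2) : HessPair →L[ℝ] L2 :=
  (PiLp.proj 2 (fun _ : Fin 2 × Fin 2 => L2) (i, j)).comp
    (WithLp.sndL 2 ℝ V (PiLp 2 fun _ : Fin 2 × Fin 2 => L2))

/-- The subspace underlying `D(A) = 𝐇 ∩ 𝐇²`: pairs of a field of `𝐕` and its weak second
derivatives `∂ᵢ∂ⱼ u` in `L²`. -/
def hessGraph : Submodule ℝ HessPair where
  carrier := {p | ∀ i j, IsWeakPartial i (grad j (HessPair.field p)) (HessPair.entry i j p)}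
  zero_mem' := fun i j => by
    rw [map_zero, map_zero, map_zero]
    exact IsWeakPartial.zero i
  add_mem' := fun hp hq i j => by
    rw [map_add, map_add, map_add]
    exact (hp i j).add (hq i j)
  smul_mem' := fun r _ hp i j => by
    rw [map_smul, map_smul, map_smul]
    exact (hp i j).smul r

/-- The Hilbert space `D(A) = 𝐇 ∩ 𝐇²`, with the norm of `𝐇²`. -/
def DA : Type := ↥hessGraph

instance : NormedAddCommGroup DA := inferInstanceAs (NormedAddCommGroup ↥hessGraph)

instance : InnerProductSpace ℝ DA := inferInstanceAs (InnerProductSpace ℝ ↥hessGraph)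

/-- The inclusion `D(A) → 𝐕`. -/
def daToV : DA →L[ℝ] V := HessPair.field.comp hessGraph.subtypeL

/-- The weak second derivative `∂ᵢ∂ⱼ u` of a field `u ∈ D(A)`. -/
def hess (i j : Fin 2) : DA →L[ℝ] L2 := (HessPair.entry i j).comp hessGraph.subtypeL

/-- The inclusion `D(A) → 𝐇`. -/
def daToH : DA →L[ℝ] H := vToH.comp daToV

/-- The weak Laplacian `Δu = ∂₀∂₀ u + ∂₁∂₁ u` of a field `u ∈ D(A)`. -/
def laplacian (u : DA) : L2 := ∑ j : Fin 2, hess j j u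

/-- The Stokes operator `A u = -Π Δu` on `D(A)`. -/
def stokes (u : DA) : H := - leray (laplacian u)

/-- The field `u · ∇v = ∑ⱼ uⱼ ∂ⱼ v`. -/
def advection (u v : V) (x : Plane) : Plane :=
  ∑ j : Fin 2, ((hToL2 (vToH u)) x j) • (grad j v x)

open Classical in
/-- The bilinear map `B(u, v) = Π (u · ∇v)` for `u, v ∈ D(A)`. For such fields `u · ∇v` always
belongs to `𝐋²`, because `𝐇²` embeds in `𝐋^∞`; the value `0` is a placeholder for a case that
does not occur. -/
def bilin (u v : DA) : H :=
  if h : MemLp (advection (daToV u) (daToV v)) 2 cellMeasure then leray h.toLp else 0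

/-! ## The noise coefficient -/

/-- The Hilbert–Schmidt norm of an operator, computed in the orthonormal basis `e`, as an
extended nonnegative number (finite exactly for Hilbert–Schmidt operators). -/
def hsNorm {ι K X : Type*} [NormedAddCommGroup K] [InnerProductSpace ℝ K]
    [NormedAddCommGroup X] [NormedSpace ℝ X] (e : HilbertBasis ι ℝ K) (S : K →L[ℝ] X) : ℝ≥0∞ :=
  (∑' i, ‖S (e i)‖ₑ ^ 2) ^ (1 / 2 : ℝ)

/-- `G : 𝐇 → 𝓛₂(K, 𝐇) ∩ 𝓛₂(K, 𝐕)` is Lipschitz continuous and of linear growth. (As `𝐕 ⊂ 𝐇`,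
the operators `G(u)` are operators from `K` to `𝐕`, read in `𝐇` through the inclusion.) -/
def NoiseAssumption {ι K : Type*} [NormedAddCommGroup K] [InnerProductSpace ℝ K]
    (e : HilbertBasis ι ℝ K) (G : H → (K →L[ℝ] V)) : Prop :=
  ∃ C : ℝ≥0, (∀ u v : H,
      hsNorm e (G u - G v) + hsNorm e (vToH.comp (G u - G v)) ≤ C * ‖u - v‖ₑ) ∧
    ∀ u : H, hsNorm e (G u) + hsNorm e (vToH.comp (G u)) ≤ C * (1 + ‖u‖ₑ)

/-! ## Spaces of paths -/

/-- Lebesgue measure on `[0, T]`. -/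
def timeMeasure (T : ℝ) : Measure ℝ := volume.restrict (Icc 0 T)

instance (T : ℝ) : IsFiniteMeasure (timeMeasure T) := by
  unfold timeMeasure
  infer_instance

/-- `L²(0, T; X)`. -/
abbrev L2Time (T : ℝ) (X : Type*) [NormedAddCommGroup X] : Type _ := Lp X 2 (timeMeasure T)

/-- The space `C([0, T]; X) ∩ L²(0, T; Y)`, for `Y` included in `X` through `i`: pairs of a
continuous path in `X` and a class of square integrable paths in `Y` that agree almost
everywhere on `[0, T]`, with the topology induced by the two spaces. -/
def pathSpace (T : ℝ) {X Y : Type*} [NormedAddCommGroup X] [NormedSpace ℝ X]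
    [NormedAddCommGroup Y] [NormedSpace ℝ Y] (i : Y →L[ℝ] X) :
    Submodule ℝ (C(Icc (0 : ℝ) T, X) × L2Time T Y) where
  carrier := {p | ∀ᵐ t ∂(timeMeasure T), ∀ ht : t ∈ Icc 0 T, i (p.2 t) = p.1 ⟨t, ht⟩}
  zero_mem' := by
    filter_upwards [Lp.coeFn_zero Y 2 (timeMeasure T)] with t h ht
    change i ((0 : L2Time T Y) t) = 0
    rw [h, Pi.zero_apply, map_zero]
  add_mem' := by
    intro p q hp hq
    filter_upwards [hp, hq, Lp.coeFn_add p.2 q.2] with t h₁ h₂ h ht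
    change i ((p.2 + q.2) t) = p.1 ⟨t, ht⟩ + q.1 ⟨t, ht⟩
    rw [h, Pi.add_apply, map_add, h₁ ht, h₂ ht]
  smul_mem' := by
    intro r p hp
    filter_upwards [hp, Lp.coeFn_smul r p.2] with t h₁ h ht
    change i ((r • p.2) t) = r • p.1 ⟨t, ht⟩
    rw [h, Pi.smul_apply, map_smul, h₁ ht]

/-- The space `C([0, T]; 𝐇) ∩ L²(0, T; D(A^{1/2}))`. -/
abbrev EnergyPath (T : ℝ) : Type := ↥(pathSpace T vToH)

/-- The space `C([0, T]; 𝐕) ∩ L²(0, T; D(A))` of strong solutions. -/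
abbrev StrongPath (T : ℝ) : Type := ↥(pathSpace T daToV)

/-- The value `y(t) ∈ 𝐇`, at every time `t ∈ [0, T]`, of a path of strong type. -/
def StrongPath.val {T : ℝ} (y : StrongPath T) (t : Icc (0 : ℝ) T) : H := vToH (y.1.1 t)

/-- The value `y(t) ∈ D(A)`, at almost every time `t ∈ [0, T]`, of a path of strong type. -/
def StrongPath.reg {T : ℝ} (y : StrongPath T) (t : ℝ) : DA := y.1.2 t

/-- A path in `C([0, T]; 𝐕) ∩ L²(0, T; D(A))` seen in
`C([0, T]; 𝐇) ∩ L²(0, T; D(A^{1/2}))`. -/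
def StrongPath.toEnergy {T : ℝ} (y : StrongPath T) : EnergyPath T :=
  ⟨((⟨fun t => vToH (y.1.1 t), vToH.continuous.comp y.1.1.continuous⟩ :
      C(Icc (0 : ℝ) T, H)), daToV.compLp y.1.2), by
    filter_upwards [y.2, daToV.coeFn_compLp y.1.2] with t h₁ h₂ ht
    change vToH ((daToV.compLp y.1.2) t) = vToH (y.1.1 ⟨t, ht⟩)
    rw [h₂, h₁ ht]⟩

/-! ## The Navier–Stokes equations and the controlled equation -/

/-- `u` is the strong solution on `[0, T]` of the two-dimensional Navier–Stokes equations
`u' + A u + B(u, u) = 0`, `u(0) = ξ`, the equation being understood in `𝐇` and integrated in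
time. -/
def IsNSESolution {T : ℝ} (ξ : V) (u : StrongPath T) : Prop :=
  Integrable (fun s => - stokes (u.reg s) - bilin (u.reg s) (u.reg s)) (timeMeasure T) ∧
  ∀ t : Icc (0 : ℝ) T, u.val t = vToH ξ +
    ∫ s in (0 : ℝ)..t, (- stokes (u.reg s) - bilin (u.reg s) (u.reg s))

open Classical in
/-- The solution of the Navier–Stokes equations with initial value `ξ`. -/
def nseSolution (T : ℝ) (ξ : V) : StrongPath T :=
  if h : ∃ u : StrongPath T, IsNSESolution ξ u then h.choose else 0

variable {K : Type*} [NormedAddCommGroup K] [InnerProductSpace ℝ K]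

/-- The right-hand side `G(δu + (1-δ)y)h - A y - (1-δ)B(y, y) - δB(u, y) - δB(y, u)` of the
controlled equation, at time `s`. -/
def controlledField {T : ℝ} (G : H → (K →L[ℝ] V)) (δ : ℝ) (u y : StrongPath T)
    (h : L2Time T K) (s : ℝ) : H :=
  vToH (G (δ • daToH (u.reg s) + (1 - δ) • daToH (y.reg s)) (h s))
    - stokes (y.reg s)
    - (1 - δ) • bilin (y.reg s) (y.reg s)
    - δ • bilin (u.reg s) (y.reg s)
    - δ • bilin (y.reg s) (u.reg s)

/-- `y` is a solution of the deterministic controlled equation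
`y' + A y + (1-δ)B(y, y) + δB(u, y) + δB(y, u) = G(δu + (1-δ)y)h`, `y(0) = (1-δ)ξ`, where `u` is
the solution of the Navier–Stokes equations with initial value `ξ`. -/
def IsControlledSolution {T : ℝ} (G : H → (K →L[ℝ] V)) (δ : ℝ) (ξ : V) (h : L2Time T K)
    (y : StrongPath T) : Prop :=
  Integrable (controlledField G δ (nseSolution T ξ) y h) (timeMeasure T) ∧
  ∀ t : Icc (0 : ℝ) T, y.val t = (1 - δ) • vToH ξ +
    ∫ s in (0 : ℝ)..t, controlledField G δ (nseSolution T ξ) y h s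

/-- The path `∫₀^· h(r) dr` in `C([0, T]; K)`. -/
def primitive {T : ℝ} (h : L2Time T K) : C(Icc (0 : ℝ) T, K) where
  toFun t := ∫ r in (0 : ℝ)..t, h r
  continuous_toFun := by
    have hi : IntegrableOn (fun r => h r) (Icc 0 T) volume :=
      (Lp.memLp h).integrable (by norm_num)
    have hc : ContinuousOn (fun t : ℝ => ∫ r in (0 : ℝ)..t, h r) (Icc 0 T) := by
      refine (intervalIntegral.continuousOn_primitive hi).congr fun t ht => ?_
      exact intervalIntegral.integral_of_le ht.1
    exact hc.domRestrict

open Classical in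
/-- The map `Γ : C([0, T]; K) → C([0, T]; 𝐇) ∩ L²(0, T; D(A^{1/2}))` that sends `∫₀^· h(r) dr`,
for `h ∈ L²(0, T; K)`, to the solution of the controlled equation, and every other path to `0`. -/
def Gam {T : ℝ} (G : H → (K →L[ℝ] V)) (δ : ℝ) (ξ : V) (x : C(Icc (0 : ℝ) T, K)) :
    EnergyPath T :=
  if hx : ∃ y : StrongPath T, ∃ h : L2Time T K, primitive h = x ∧ IsControlledSolution G δ ξ h y
  then hx.choose.toEnergy else 0

/-- The set `𝒜_M` of the controls `h ∈ L²(0, T; K)` with `∫₀ᵀ ‖h(r)‖² dr ≤ M`. -/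
def controls (T : ℝ) (K : Type*) [NormedAddCommGroup K] (M : ℝ) : Set (L2Time T K) :=
  {h | ∫ r, ‖h r‖ ^ 2 ∂(timeMeasure T) ≤ M}

end TorusNSE

end

/-!
The proof works with strong solutions throughout, and every estimate takes place at the level of
`𝐕`, so that the nonlinear term is a function of time with values in `𝐇`.

*Spectral picture.* The fields `waveH k`, built from the functions `cos (k · x) + sin (k · x)`, form
an orthonormal basis of `𝐇` consisting of eigenfunctions of the Stokes operator `A`, and the norms
of `𝐕` and `D(A)` are weighted `ℓ²` norms of the coefficients (`parseval_V`, `parseval_DA`).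
Summing the coefficients gives an embedding of `D(A)` in `L^∞` with an arbitrarily small constant
in front of `|A u|`, hence the bound `norm_bilin_sq_le` for `B`. On the two-dimensional torus
`⟨B(u, u), A u⟩ = 0` (`inner_bilin_stokes`); this is why solutions do not blow up.

*The linear equation.* For `y' + A y = f` the product rule for absolutely continuous functions,
applied to each coefficient and summed, gives an energy identity for `A^{1/2} y` with an arbitrary
integrating factor (`IsLinSol.energy_identity`, `IsLinSol.strong_bound`). The resulting bound makes
the graph of the solution relation closed; since it contains the explicit solutions carried by a
single eigenfunction, there is a bounded solution operator (`exists_linSol`).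

*The controlled equation.* The nonlinear term `f(y)` is locally Lipschitz with a small constant in
front of the top order term (`exists_nonlin_lipschitz`), and thanks to the orthogonality of
`B(y, y)` and `A y` the equation `y' + A y = s f(y)` has an a priori bound uniform in `s ∈ [0, 1]`
(`exists_nonlin_apriori`). Moving `s` from `0` to `1`, with a contraction in a weighted norm at each
step (`exists_continuation_step`), gives existence on the whole of `[0, T]` (`exists_isMildSol`);
uniqueness is `IsMildSol.unique`. The Navier–Stokes equation is the case `δ = 0`, `h = 0`. As a
control is determined by its primitive (`primitive_injective`), the map `Γ` is well defined
(`Gam_primitive`).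

*Weak continuity and compactness.* The distance between the solutions with controls `h_n` and `h` is
at most a constant times the norm of the solution `z_n` of the linear equation with right-hand side
`G(·) (h_n - h)` and zero initial value (`exists_stability_bound`), where `G` is evaluated along the
limit solution. The noise has values in `𝐕`, so `z_n` depends on `h_n - h` through a bounded
operator into `L²(0, T; 𝐕)` (`exists_noiseOp`). If `h_n ⇀ h`, the compactness of `𝐕 ⊂ 𝐇` and interpolation
between `𝐇` and `D(A)` give `z_n → 0` (`tendsto_linSol_of_weak`). This is the continuity of `Γ`
from the weak topology, and the compactness of the image of `𝒜_M` follows because `𝒜_M` is weakly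
sequentially compact (`exists_weak_subseq_controls`).
-/


noncomputable section

namespace TorusNSE

/-! ### Trigonometric functions on the torus -/

/-- The phase `k · x`, as a linear form of `x`. -/
def phase (k : Fin 2 → ℤ) : Plane →L[ℝ] ℝ :=
  ∑ j : Fin 2, (k j : ℝ) • (EuclideanSpace.proj j : Plane →L[ℝ] ℝ)

theorem phase_apply (k : Fin 2 → ℤ) (x : Plane) : phase k x = k 0 * x 0 + k 1 * x 1 := by
  simp [phase]

theorem phase_single (k : Fin 2 → ℤ) (j : Fin 2) (a : ℝ) :
    phase k (EuclideanSpace.single j a) = k j * a := by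
  fin_cases j <;> simp [phase]

theorem phase_neg (k : Fin 2 → ℤ) (x : Plane) : phase (-k) x = -phase k x := by
  simp [phase_apply]; ring

/-- The real trigonometric function `cos (k · x) + sin (k · x)`. These functions, for `k ∈ ℤ²`,
form a real orthogonal basis which differentiation maps to itself up to scalars. -/
def har (k : Fin 2 → ℤ) (x : Plane) : ℝ := Real.cos (phase k x) + Real.sin (phase k x)

theorem isPeriodicTest_comp_phase {f : ℝ → ℝ} (hf : ContDiff ℝ ∞ f)
    (hp : Function.Periodic f (2 * Real.pi)) (k : Fin 2 → ℤ) :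
    IsPeriodicTest fun x => f (phase k x) where
  smooth := hf.comp (phase k).contDiff
  periodic i x := by
    rw [map_add, phase_single]
    exact hp.int_mul (k i) _

theorem isPeriodicTest_cos (k : Fin 2 → ℤ) : IsPeriodicTest fun x => Real.cos (phase k x) :=
  isPeriodicTest_comp_phase Real.contDiff_cos Real.cos_periodic k

theorem isPeriodicTest_sin (k : Fin 2 → ℤ) : IsPeriodicTest fun x => Real.sin (phase k x) :=
  isPeriodicTest_comp_phase Real.contDiff_sin Real.sin_periodic k

theorem IsPeriodicTest.add {φ ψ : Plane → ℝ} (hφ : IsPeriodicTest φ) (hψ : IsPeriodicTest ψ) :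
    IsPeriodicTest fun x => φ x + ψ x where
  smooth := hφ.smooth.add hψ.smooth
  periodic i x := by rw [hφ.periodic, hψ.periodic]

theorem IsPeriodicTest.mul {φ ψ : Plane → ℝ} (hφ : IsPeriodicTest φ) (hψ : IsPeriodicTest ψ) :
    IsPeriodicTest fun x => φ x * ψ x where
  smooth := hφ.smooth.mul hψ.smooth
  periodic i x := by rw [hφ.periodic, hψ.periodic]

theorem isPeriodicTest_const (a : ℝ) : IsPeriodicTest fun _ => a where
  smooth := contDiff_const
  periodic _ _ := rfl

theorem IsPeriodicTest.const_mul {φ : Plane → ℝ} (a : ℝ) (hφ : IsPeriodicTest φ) :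
    IsPeriodicTest fun x => a * φ x := (isPeriodicTest_const a).mul hφ

theorem IsPeriodicTest.differentiable {φ : Plane → ℝ} (hφ : IsPeriodicTest φ) :
    Differentiable ℝ φ := hφ.smooth.differentiable (by simp)

theorem isPeriodicTest_har (k : Fin 2 → ℤ) : IsPeriodicTest (har k) :=
  (isPeriodicTest_cos k).add (isPeriodicTest_sin k)

theorem partialDeriv_add {φ ψ : Plane → ℝ} (hφ : IsPeriodicTest φ) (hψ : IsPeriodicTest ψ)
    (j : Fin 2) (x : Plane) :
    partialDeriv j (fun y => φ y + ψ y) x = partialDeriv j φ x + partialDeriv j ψ x := by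
  simp only [partialDeriv]
  rw [fderiv_fun_add (hφ.differentiable x) (hψ.differentiable x)]
  rfl

theorem partialDeriv_mul {φ ψ : Plane → ℝ} (hφ : IsPeriodicTest φ) (hψ : IsPeriodicTest ψ)
    (j : Fin 2) (x : Plane) :
    partialDeriv j (fun y => φ y * ψ y) x =
      partialDeriv j φ x * ψ x + φ x * partialDeriv j ψ x := by
  simp only [partialDeriv]
  rw [fderiv_fun_mul (hφ.differentiable x) (hψ.differentiable x)]
  simp only [add_apply, smul_apply, smul_eq_mul]
  ring

theorem partialDeriv_const_mul {φ : Plane → ℝ} (a : ℝ) (hφ : IsPeriodicTest φ)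
    (j : Fin 2) (x : Plane) :
    partialDeriv j (fun y => a * φ y) x = a * partialDeriv j φ x := by
  simp only [partialDeriv]
  rw [fderiv_const_mul (hφ.differentiable x)]
  rfl

theorem partialDeriv_comp_phase {f f' : ℝ → ℝ} (hf : ∀ t, HasDerivAt f (f' t) t)
    (k : Fin 2 → ℤ) (j : Fin 2) (x : Plane) :
    partialDeriv j (fun y => f (phase k y)) x = k j * f' (phase k x) := by
  have h := (hf (phase k x)).comp_hasFDerivAt x (phase k).hasFDerivAt
  have h' : fderiv ℝ (fun y => f (phase k y)) x = f' (phase k x) • phase k := h.fderiv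
  rw [partialDeriv, h']
  simp [phase_single]
  ring

theorem partialDeriv_cos (k : Fin 2 → ℤ) (j : Fin 2) (x : Plane) :
    partialDeriv j (fun y => Real.cos (phase k y)) x = -(k j * Real.sin (phase k x)) := by
  rw [partialDeriv_comp_phase Real.hasDerivAt_cos]; ring

theorem partialDeriv_sin (k : Fin 2 → ℤ) (j : Fin 2) (x : Plane) :
    partialDeriv j (fun y => Real.sin (phase k y)) x = k j * Real.cos (phase k x) :=
  partialDeriv_comp_phase Real.hasDerivAt_sin k j x

theorem partialDeriv_har (k : Fin 2 → ℤ) (j : Fin 2) (x : Plane) :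
    partialDeriv j (har k) x = k j * har (-k) x := by
  have := partialDeriv_add (isPeriodicTest_cos k) (isPeriodicTest_sin k) j x
  rw [show har k = fun y => Real.cos (phase k y) + Real.sin (phase k y) from rfl, this,
    partialDeriv_cos, partialDeriv_sin, har, phase_neg, Real.cos_neg, Real.sin_neg]
  ring

theorem fderiv_apply_eq_sum (φ : Plane → ℝ) (x v : Plane) :
    fderiv ℝ φ x v = ∑ j : Fin 2, v j * partialDeriv j φ x := by
  have hv : v = ∑ j : Fin 2, v j • EuclideanSpace.single j (1 : ℝ) := by
    ext i; fin_cases i <;> simp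
  conv_lhs => rw [hv]
  simp [partialDeriv]

/-! ### Integration over the cell -/

/-- Integrals over the cell are integrals over a square of `ℝ × ℝ`. -/
theorem integral_cell_eq {E : Type*} [NormedAddCommGroup E] [NormedSpace ℝ E] (f : Plane → E) :
    ∫ x, f x ∂cellMeasure =
      ∫ p in Icc (0 : ℝ) (2 * Real.pi) ×ˢ Icc (0 : ℝ) (2 * Real.pi), f !₂[p.1, p.2] := by
  have h4 : MeasurePreserving (fun p : ℝ × ℝ => (!₂[p.1, p.2] : Plane)) volume volume :=
    ((EuclideanSpace.volume_preserving_symm_measurableEquiv_toLp (Fin 2)).symm).comp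
      (volume_preserving_finTwoArrow ℝ).symm
  have h5 : MeasurableEmbedding (fun p : ℝ × ℝ => (!₂[p.1, p.2] : Plane)) :=
    ((MeasurableEquiv.finTwoArrow (α := ℝ)).symm.trans
      (MeasurableEquiv.toLp 2 (Fin 2 → ℝ))).measurableEmbedding
  rw [cellMeasure, ← h4.setIntegral_preimage_emb h5]
  congr 2
  ext p
  simp only [cell, Fin.forall_fin_two, mem_prod, mem_preimage, mem_ofPred_eq]
  rfl

theorem integrable_cell_of_continuous {E : Type*} [NormedAddCommGroup E] {f : Plane → E}
    (hf : Continuous f) : Integrable f cellMeasure := by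
  have : IntegrableOn f cell volume := hf.continuousOn.integrableOn_compact isCompact_cell
  exact this

/-- The integral of a partial derivative of a periodic function vanishes. -/
theorem integral_partialDeriv {φ : Plane → ℝ} (hφ : IsPeriodicTest φ) (j : Fin 2) :
    ∫ x, partialDeriv j φ x ∂cellMeasure = 0 := by
  rw [integral_cell_eq]
  have hc : Continuous fun p : ℝ × ℝ => partialDeriv j φ !₂[p.1, p.2] := by
    refine (continuous_partialDeriv hφ j).comp ?_
    refine (PiLp.continuous_toLp 2 _).comp (continuous_pi fun i => ?_)
    fin_cases i
    · exact continuous_fst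
    · exact continuous_snd
  have hi : IntegrableOn (fun p : ℝ × ℝ => partialDeriv j φ !₂[p.1, p.2])
      (Icc (0 : ℝ) (2 * Real.pi) ×ˢ Icc (0 : ℝ) (2 * Real.pi)) (volume.prod volume) :=
    hc.continuousOn.integrableOn_compact (isCompact_Icc.prod isCompact_Icc)
  have hpi : (0 : ℝ) ≤ 2 * Real.pi := by positivity
  have key : ∀ (y : Plane), ∫ s in Icc (0 : ℝ) (2 * Real.pi),
      partialDeriv j φ (y + s • EuclideanSpace.single j 1) = 0 := by
    intro y
    rw [integral_Icc_eq_integral_Ioc, ← intervalIntegral.integral_of_le hpi]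
    have h := intervalIntegral.integral_eq_sub_of_hasDerivAt (a := 0) (b := 2 * Real.pi)
      (f := fun s : ℝ => φ (y + s • EuclideanSpace.single j 1))
      (f' := fun s : ℝ => partialDeriv j φ (y + s • EuclideanSpace.single j 1))
      (fun s _ => ?_) ?_
    · have e : (2 * Real.pi) • (EuclideanSpace.single j 1 : Plane) =
          EuclideanSpace.single j (2 * Real.pi) := by
        ext i; simp
      rw [h, e, hφ.periodic, zero_smul, add_zero, sub_self]
    · have h1 : HasDerivAt (fun s : ℝ => y + s • (EuclideanSpace.single j 1 : Plane))
          (EuclideanSpace.single j 1) s := by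
        simpa using ((hasDerivAt_id s).smul_const (EuclideanSpace.single j 1 : Plane)).const_add y
      exact ((hφ.differentiable _).hasFDerivAt.comp_hasDerivAt s h1)
    · refine Continuous.intervalIntegrable ?_ _ _
      exact (continuous_partialDeriv hφ j).comp (by fun_prop)
  rw [Measure.volume_eq_prod]
  obtain rfl | rfl : j = 0 ∨ j = 1 := by omega
  · rw [← setIntegral_prod_swap,
      setIntegral_prod (fun z : ℝ × ℝ => partialDeriv 0 φ !₂[z.swap.1, z.swap.2]) hi.swap]
    refine integral_eq_zero_of_ae (Eventually.of_forall fun b => ?_)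
    refine Eq.trans ?_ (key !₂[0, b])
    refine integral_congr_ae (Eventually.of_forall fun a => ?_)
    simp only [Prod.swap]
    congr 1
    ext i; fin_cases i <;> simp
  · rw [setIntegral_prod _ hi]
    refine integral_eq_zero_of_ae (Eventually.of_forall fun a => ?_)
    refine Eq.trans ?_ (key !₂[a, 0])
    refine integral_congr_ae (Eventually.of_forall fun b => ?_)
    simp only
    congr 1
    ext i; fin_cases i <;> simp

/-- Integration by parts on the torus. -/
theorem integral_partialDeriv_mul {φ ψ : Plane → ℝ} (hφ : IsPeriodicTest φ)
    (hψ : IsPeriodicTest ψ) (j : Fin 2) :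
    ∫ x, partialDeriv j φ x * ψ x ∂cellMeasure =
      -∫ x, φ x * partialDeriv j ψ x ∂cellMeasure := by
  have h := integral_partialDeriv (hφ.mul hψ) j
  simp only [partialDeriv_mul hφ hψ] at h
  rw [integral_add] at h
  · linarith
  · exact integrable_cell_of_continuous ((continuous_partialDeriv hφ j).mul hψ.smooth.continuous)
  · exact integrable_cell_of_continuous (hφ.smooth.continuous.mul (continuous_partialDeriv hψ j))

theorem integral_cos_phase {m : Fin 2 → ℤ} (hm : m ≠ 0) :
    ∫ x, Real.cos (phase m x) ∂cellMeasure = 0 := by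
  obtain ⟨j, hj⟩ := Function.ne_iff.1 hm
  have h := integral_partialDeriv (isPeriodicTest_sin m) j
  simp only [partialDeriv_sin, integral_const_mul] at h
  exact (mul_eq_zero.1 h).resolve_left (by exact_mod_cast hj)

theorem integral_sin_phase (m : Fin 2 → ℤ) :
    ∫ x, Real.sin (phase m x) ∂cellMeasure = 0 := by
  rcases eq_or_ne m 0 with rfl | hm
  · simp [phase]
  obtain ⟨j, hj⟩ := Function.ne_iff.1 hm
  have h := integral_partialDeriv (isPeriodicTest_cos m) j
  simp only [partialDeriv_cos, ← neg_mul, integral_const_mul] at h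
  refine (mul_eq_zero.1 h).resolve_left (neg_ne_zero.2 (by exact_mod_cast hj))

theorem measureReal_cell : cellMeasure.real univ = (2 * Real.pi) ^ 2 := by
  have h := integral_cell_eq (fun _ => (1 : ℝ))
  rw [integral_const, smul_eq_mul, mul_one] at h
  have hpi : (0 : ℝ) ≤ 2 * Real.pi := by positivity
  rw [h, Measure.volume_eq_prod, integral_const, smul_eq_mul, mul_one,
    measureReal_restrict_apply_univ,
    measureReal_prod_prod, measureReal_def, Real.volume_Icc, sub_zero, ENNReal.toReal_ofReal hpi]
  ring

theorem har_mul_har (k l : Fin 2 → ℤ) (x : Plane) :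
    har k x * har l x = Real.cos (phase (k - l) x) + Real.sin (phase (k + l) x) := by
  have h1 : phase (k - l) x = phase k x - phase l x := by simp [phase_apply]; ring
  have h2 : phase (k + l) x = phase k x + phase l x := by simp [phase_apply]; ring
  rw [h1, h2, Real.cos_sub, Real.sin_add, har, har]
  ring

theorem integral_har_mul_har (k l : Fin 2 → ℤ) :
    ∫ x, har k x * har l x ∂cellMeasure = if k = l then (2 * Real.pi) ^ 2 else 0 := by
  simp only [har_mul_har]
  rw [integral_add (integrable_cell_of_continuous (isPeriodicTest_cos _).smooth.continuous)
    (integrable_cell_of_continuous (isPeriodicTest_sin _).smooth.continuous), integral_sin_phase,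
    add_zero]
  split_ifs with h
  · subst h
    simp [phase_apply, measureReal_cell]
  · exact integral_cos_phase (sub_ne_zero.2 h)

theorem abs_har_le (k : Fin 2 → ℤ) (x : Plane) : |har k x| ≤ 2 := by
  rw [har]
  refine (abs_add_le _ _).trans ?_
  linarith [Real.abs_cos_le_one (phase k x), Real.abs_sin_le_one (phase k x)]

/-! ### Completeness of the trigonometric system -/

/-- The normalized Haar measure of the unit torus `(ℝ/ℤ)²`. -/
def torusMeasure : Measure (UnitAddTorus (Fin 2)) :=
  Measure.pi fun _ => AddCircle.haarAddCircle

/-- The point of the half-open cell `(0, 2π]²` above a point of the unit torus `(ℝ/ℤ)²`. -/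
def torusLift (t : UnitAddTorus (Fin 2)) : Plane :=
  WithLp.toLp 2 fun i => 2 * Real.pi * (AddCircle.equivIoc 1 0 (t i)).1

theorem measurable_torusLift : Measurable torusLift := by
  refine (MeasurableEquiv.toLp 2 (Fin 2 → ℝ)).measurable.comp ?_
  refine measurable_pi_lambda _ fun i => Measurable.const_mul ?_ _
  exact measurable_subtype_coe.comp
    ((AddCircle.measurableEquivIoc 1 0).measurable.comp (measurable_pi_apply i))

/-- The image of the Haar probability measure of the torus under `torusLift` is the
normalized Lebesgue measure on the cell. -/
theorem map_torusLift : Measure.map torusLift torusMeasure =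
    ENNReal.ofReal |((2 * Real.pi) ^ 2)⁻¹| • cellMeasure := by
  have hpi : (0 : ℝ) < 2 * Real.pi := by positivity
  let B : Set (Fin 2 → ℝ) := {x | ∀ i, x i ∈ Ioc (0 : ℝ) (0 + 1)}
  let B' : Set (Fin 2 → ℝ) := Set.pi univ fun _ => Ioc (0 : ℝ) (2 * Real.pi)
  let B'' : Set (Fin 2 → ℝ) := Set.pi univ fun _ => Icc (0 : ℝ) (2 * Real.pi)
  let S : (Fin 2 → ℝ) → (Fin 2 → ℝ) := fun x => (2 * Real.pi) • x
  have hB : MeasurableSet B := MeasurableSet.univ_pi' fun i => measurableSet_Ioc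
  have hB' : MeasurableSet B' := MeasurableSet.univ_pi fun i => measurableSet_Ioc
  have hB'' : MeasurableSet B'' := MeasurableSet.univ_pi fun i => measurableSet_Icc
  have hS : Measurable S := measurable_const_smul _
  have hBS : S ⁻¹' B' = B := by
    ext x
    simp only [B, B', S, mem_preimage, mem_univ_pi, Pi.smul_apply, smul_eq_mul, mem_Ioc,
      mem_ofPred_eq, zero_add]
    refine forall_congr' fun i => ?_
    rw [mul_pos_iff_of_pos_left hpi, mul_le_iff_le_one_right hpi]
  have m1 : Measure.map (Subtype.val ∘ UnitAddTorus.measurableEquivPiIoc fun _ : Fin 2 => (0 : ℝ))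
      torusMeasure = volume.restrict B := by
    have h : Measure.map (UnitAddTorus.measurableEquivPiIoc fun _ : Fin 2 => (0 : ℝ))
        torusMeasure = Measure.comap Subtype.val volume :=
      (UnitAddTorus.measurePreserving_equivPiIoc _).map_eq
    rw [← Measure.map_map measurable_subtype_coe (MeasurableEquiv.measurable _), h]
    exact map_comap_subtype_coe hB volume
  have m2 : Measure.map S (volume.restrict B) =
      ENNReal.ofReal |((2 * Real.pi) ^ 2)⁻¹| • volume.restrict B'' := by
    rw [← hBS, ← Measure.restrict_map hS hB', Measure.map_addHaar_smul _ hpi.ne',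
      Measure.restrict_smul]
    simp only [Module.finrank_fintype_fun_eq_card, Fintype.card_fin]
    congr 1
    exact Measure.restrict_congr_set Measure.pi_Ioc_ae_eq_pi_Icc
  have m3 : Measure.map (MeasurableEquiv.toLp 2 (Fin 2 → ℝ)) (volume.restrict B'') =
      cellMeasure := by
    have hpre : B'' = (MeasurableEquiv.toLp 2 (Fin 2 → ℝ)) ⁻¹' cell := by
      ext x
      simp only [B'', mem_univ_pi, mem_preimage, cell]
      rfl
    have h : Measure.map (MeasurableEquiv.toLp 2 (Fin 2 → ℝ)) volume = volume :=
      (EuclideanSpace.volume_preserving_symm_measurableEquiv_toLp (Fin 2)).symm.map_eq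
    rw [hpre, ← Measure.restrict_map (MeasurableEquiv.measurable _) isCompact_cell.measurableSet, h]
    rfl
  have hcomp : torusLift = (MeasurableEquiv.toLp 2 (Fin 2 → ℝ)) ∘ S ∘
      (Subtype.val ∘ UnitAddTorus.measurableEquivPiIoc fun _ : Fin 2 => (0 : ℝ)) := rfl
  rw [hcomp, ← Measure.map_map (MeasurableEquiv.measurable _)
    (hS.comp (measurable_subtype_coe.comp (MeasurableEquiv.measurable _))),
    ← Measure.map_map hS (measurable_subtype_coe.comp (MeasurableEquiv.measurable _)), m1, m2,
    Measure.map_smul, m3]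

theorem mFourier_eq_exp_phase (n : Fin 2 → ℤ) (t : UnitAddTorus (Fin 2)) :
    UnitAddTorus.mFourier n t = Complex.exp (phase n (torusLift t) * Complex.I) := by
  have h : ∀ i, t i = (((AddCircle.equivIoc 1 0 (t i)).1 : ℝ) : AddCircle (1 : ℝ)) := fun i =>
    ((AddCircle.equivIoc 1 0).symm_apply_apply (t i)).symm
  have h2 : ∀ i, fourier (n i) (t i) = Complex.exp (2 * Real.pi * Complex.I * n i *
      (AddCircle.equivIoc 1 0 (t i)).1) := by
    intro i
    conv_lhs => rw [h i]
    rw [fourier_coe_apply]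
    simp
  simp only [UnitAddTorus.mFourier, ContinuousMap.coe_mk, h2, Fin.prod_univ_two,
    ← Complex.exp_add, phase_apply, torusLift]
  congr 1
  push_cast
  ring

theorem eq_zero_of_mFourier_integral {f : Lp ℂ 2 torusMeasure}
    (h : ∀ n, ∫ t, UnitAddTorus.mFourier (-n) t • f t ∂torusMeasure = 0) : f = 0 := by
  have key : (UnitAddTorus.mFourierBasis (d := Fin 2)).repr f = 0 :=
    lp.ext (funext fun n => (UnitAddTorus.mFourierBasis_repr f n).trans (h n))
  exact (LinearIsometryEquiv.map_eq_zero_iff _).1 key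

theorem ae_eq_zero_of_integral_har_mul {g : Plane → ℝ} (hg : StronglyMeasurable g)
    (hg2 : MemLp g 2 cellMeasure) (h : ∀ k, ∫ x, har k x * g x ∂cellMeasure = 0) :
    g =ᵐ[cellMeasure] 0 := by
  have hgi : Integrable g cellMeasure := hg2.integrable (by norm_num)
  have hint : ∀ {φ : Plane → ℝ}, IsPeriodicTest φ → (∀ x, |φ x| ≤ 2) →
      Integrable (fun x => φ x * g x) cellMeasure := fun hφ hb =>
    hgi.bdd_mul hφ.smooth.continuous.aestronglyMeasurable (Eventually.of_forall hb)
  have hcos : ∀ k, ∫ x, Real.cos (phase k x) * g x ∂cellMeasure = 0 := by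
    intro k
    have e : ∀ x, Real.cos (phase k x) * g x = (1 / 2) * (har k x * g x + har (-k) x * g x) := by
      intro x; rw [har, har, phase_neg, Real.cos_neg, Real.sin_neg]; ring
    simp only [e]
    rw [integral_const_mul, integral_add (hint (isPeriodicTest_har k) (abs_har_le k))
      (hint (isPeriodicTest_har _) (abs_har_le _)), h, h]
    simp
  have hsin : ∀ k, ∫ x, Real.sin (phase k x) * g x ∂cellMeasure = 0 := by
    intro k
    have e : ∀ x, Real.sin (phase k x) * g x = (1 / 2) * (har k x * g x - har (-k) x * g x) := by
      intro x; rw [har, har, phase_neg, Real.cos_neg, Real.sin_neg]; ring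
    simp only [e]
    rw [integral_const_mul, integral_sub (hint (isPeriodicTest_har k) (abs_har_le k))
      (hint (isPeriodicTest_har _) (abs_har_le _)), h, h]
    simp
  have hexp : ∀ k, ∫ x, Complex.exp (phase k x * Complex.I) * (g x : ℂ) ∂cellMeasure = 0 := by
    intro k
    have e : ∀ x, Complex.exp (phase k x * Complex.I) * (g x : ℂ) =
        ((Real.cos (phase k x) * g x : ℝ) : ℂ) +
          ((Real.sin (phase k x) * g x : ℝ) : ℂ) * Complex.I := by
      intro x; rw [Complex.exp_mul_I]; push_cast; ring
    simp only [e]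
    rw [integral_add, integral_mul_const, integral_complex_ofReal, integral_complex_ofReal,
      hcos, hsin]
    · simp
    · exact (hint (isPeriodicTest_cos k) fun x =>
        (Real.abs_cos_le_one _).trans one_le_two).ofReal
    · exact ((hint (isPeriodicTest_sin k) fun x =>
        (Real.abs_sin_le_one _).trans one_le_two).ofReal).mul_const _
  have hc0 : ENNReal.ofReal |((2 * Real.pi) ^ 2)⁻¹| ≠ 0 := by
    rw [Ne, ENNReal.ofReal_eq_zero, not_le]; positivity
  have hae : ∀ {p : Plane → Prop}, (∀ᵐ x ∂(Measure.map torusLift torusMeasure), p x) ↔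
      ∀ᵐ x ∂cellMeasure, p x := by
    intro p
    rw [map_torusLift, Measure.ae_ennreal_smul_measure_iff hc0]
  have hgc : StronglyMeasurable fun x => (g x : ℂ) :=
    Complex.continuous_ofReal.comp_stronglyMeasurable hg
  have hf : MemLp ((fun x => (g x : ℂ)) ∘ torusLift) 2 torusMeasure := by
    rw [← memLp_map_measure_iff hgc.aestronglyMeasurable measurable_torusLift.aemeasurable,
      map_torusLift]
    exact (hg2.ofReal (K := ℂ)).smul_measure ENNReal.ofReal_ne_top
  have h0 : hf.toLp _ = 0 := by
    refine eq_zero_of_mFourier_integral fun n => ?_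
    have e : ∫ t, UnitAddTorus.mFourier (-n) t • (hf.toLp _ : Lp ℂ 2 torusMeasure) t
        ∂torusMeasure =
        ∫ t, (fun x => Complex.exp (phase (-n) x * Complex.I) * (g x : ℂ)) (torusLift t)
          ∂torusMeasure := by
      refine integral_congr_ae ?_
      filter_upwards [hf.coeFn_toLp] with t ht
      rw [ht, mFourier_eq_exp_phase, smul_eq_mul]
      rfl
    refine e.trans ((integral_map (f := fun x => Complex.exp (phase (-n) x * Complex.I) * (g x : ℂ))
      measurable_torusLift.aemeasurable ?_).symm.trans ?_)
    · refine (Continuous.stronglyMeasurable ?_).mul hgc |>.aestronglyMeasurable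
      exact Complex.continuous_exp.comp
        ((Complex.continuous_ofReal.comp (phase (-n)).continuous).mul continuous_const)
    · rw [map_torusLift, integral_smul_measure, hexp, smul_zero]
  have h1 : ((fun x => (g x : ℂ)) ∘ torusLift) =ᵐ[torusMeasure] 0 := by
    have := hf.coeFn_toLp
    rw [h0] at this
    exact this.symm.trans (Lp.coeFn_zero _ _ _)
  have h2 : ∀ᵐ x ∂(Measure.map torusLift torusMeasure), (g x : ℂ) = 0 := by
    rw [ae_map_iff measurable_torusLift.aemeasurable]
    · exact h1
    · exact measurableSet_eq_fun hgc.measurable measurable_const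
  filter_upwards [hae.1 h2] with x hx
  exact_mod_cast hx

/-- A square integrable field whose trigonometric coefficients all vanish is zero. -/
theorem eq_zero_of_integral_har_smul {u : L2} (h : ∀ k, ∫ x, har k x • u x ∂cellMeasure = 0) :
    u = 0 := by
  have hcomp : ∀ i : Fin 2, (fun x => u x i) =ᵐ[cellMeasure] 0 := by
    intro i
    have hm := (EuclideanSpace.proj i : Plane →L[ℝ] ℝ).comp_memLp' (Lp.memLp u)
    refine ae_eq_zero_of_integral_har_mul ?_ hm fun k => ?_
    · exact (EuclideanSpace.proj i : Plane →L[ℝ] ℝ).continuous.comp_stronglyMeasurable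
        (Lp.stronglyMeasurable u)
    · have hi : Integrable (fun x => har k x • u x) cellMeasure :=
        (integrable_field u).bdd_smul 2
          (isPeriodicTest_har k).smooth.continuous.aestronglyMeasurable
          (Eventually.of_forall (abs_har_le k))
      have := (EuclideanSpace.proj i : Plane →L[ℝ] ℝ).integral_comp_comm hi
      rw [h k, map_zero] at this
      simpa using this
  rw [Lp.eq_zero_iff_ae_eq_zero]
  filter_upwards [hcomp 0, hcomp 1] with x h0 h1
  ext i
  fin_cases i
  · exact h0
  · exact h1

/-! ### Smooth fields and their weak derivatives -/

/-- The partial derivative of a periodic test function is one. -/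
theorem IsPeriodicTest.partialDeriv {φ : Plane → ℝ} (hφ : IsPeriodicTest φ) (j : Fin 2) :
    IsPeriodicTest (partialDeriv j φ) where
  smooth := (hφ.smooth.fderiv_right (m := ∞) (by simp)).clm_apply contDiff_const
  periodic i x := by
    have h : (fun y => φ (y + EuclideanSpace.single i (2 * Real.pi))) = φ :=
      funext fun y => hφ.periodic i y
    have h2 := fderiv_comp_add_right (𝕜 := ℝ) (f := φ) (x := x)
      (EuclideanSpace.single i (2 * Real.pi))
    rw [h] at h2
    rw [TorusNSE.partialDeriv, ← h2, TorusNSE.partialDeriv]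

/-- The planar field with the given components. -/
def field (φ : Fin 2 → Plane → ℝ) (x : Plane) : Plane := WithLp.toLp 2 fun i => φ i x

theorem continuous_field {φ : Fin 2 → Plane → ℝ} (hφ : ∀ i, IsPeriodicTest (φ i)) :
    Continuous (field φ) :=
  (PiLp.continuous_toLp 2 _).comp (continuous_pi fun i => (hφ i).smooth.continuous)

theorem memLp_of_continuous {X : Plane → Plane} (hX : Continuous X) : MemLp X 2 cellMeasure := by
  obtain ⟨C, hC⟩ := isCompact_cell.exists_bound_of_continuousOn hX.continuousOn
  refine MemLp.of_bound hX.aestronglyMeasurable C ?_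
  rw [cellMeasure]
  exact (ae_restrict_iff' isCompact_cell.measurableSet).2 (Eventually.of_forall hC)

/-- A smooth periodic field as an element of `L²`. -/
def ofSmooth (φ : Fin 2 → Plane → ℝ) (hφ : ∀ i, IsPeriodicTest (φ i)) : L2 :=
  (memLp_of_continuous (continuous_field hφ)).toLp _

theorem coeFn_ofSmooth {φ : Fin 2 → Plane → ℝ} (hφ : ∀ i, IsPeriodicTest (φ i)) :
    ofSmooth φ hφ =ᵐ[cellMeasure] field φ := MemLp.coeFn_toLp _

theorem integrable_smul_field {ψ : Plane → ℝ} (hψ : IsPeriodicTest ψ) (u : L2) :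
    Integrable (fun x => ψ x • u x) cellMeasure := by
  obtain ⟨C, hC⟩ := isCompact_cell.exists_bound_of_continuousOn hψ.smooth.continuous.continuousOn
  refine (integrable_field u).bdd_smul C hψ.smooth.continuous.aestronglyMeasurable ?_
  rw [cellMeasure]
  exact (ae_restrict_iff' isCompact_cell.measurableSet).2 (Eventually.of_forall hC)

theorem integral_apply {X : Plane → Plane} (hX : Integrable X cellMeasure) (i : Fin 2) :
    (∫ x, X x ∂cellMeasure) i = ∫ x, X x i ∂cellMeasure :=
  ((EuclideanSpace.proj i : Plane →L[ℝ] ℝ).integral_comp_comm hX).symm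

theorem inner_ofSmooth (u : L2) {φ : Fin 2 → Plane → ℝ} (hφ : ∀ i, IsPeriodicTest (φ i)) :
    inner ℝ u (ofSmooth φ hφ) = ∑ i, (∫ x, φ i x • u x ∂cellMeasure) i := by
  simp only [integral_apply (integrable_smul_field (hφ _) u)]
  rw [← integral_finsetSum]
  · rw [L2.inner_def]
    refine integral_congr_ae ?_
    filter_upwards [coeFn_ofSmooth hφ] with x hx
    rw [hx]
    simp [field, PiLp.inner_apply]
  · intro i _
    exact ((EuclideanSpace.proj i : Plane →L[ℝ] ℝ).integrable_comp (integrable_smul_field (hφ i) u))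

theorem inner_ofSmooth_ofSmooth {φ ψ : Fin 2 → Plane → ℝ} (hφ : ∀ i, IsPeriodicTest (φ i))
    (hψ : ∀ i, IsPeriodicTest (ψ i)) :
    inner ℝ (ofSmooth φ hφ) (ofSmooth ψ hψ) = ∑ i, ∫ x, φ i x * ψ i x ∂cellMeasure := by
  rw [inner_ofSmooth]
  refine Finset.sum_congr rfl fun i _ => ?_
  rw [integral_apply (integrable_smul_field (hψ i) _)]
  refine integral_congr_ae ?_
  filter_upwards [coeFn_ofSmooth hφ] with x hx
  rw [hx]
  simp [field, mul_comm]

theorem IsWeakPartial.inner_ofSmooth {j : Fin 2} {u g : L2} (h : IsWeakPartial j u g)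
    {φ : Fin 2 → Plane → ℝ} (hφ : ∀ i, IsPeriodicTest (φ i)) :
    inner ℝ g (ofSmooth φ hφ) =
      -inner ℝ u (ofSmooth (fun i => partialDeriv j (φ i)) fun i => (hφ i).partialDeriv j) := by
  rw [TorusNSE.inner_ofSmooth, TorusNSE.inner_ofSmooth, ← Finset.sum_neg_distrib]
  refine Finset.sum_congr rfl fun i _ => ?_
  rw [h _ (hφ i)]
  simp

theorem isWeakPartial_ofSmooth {φ : Fin 2 → Plane → ℝ} (hφ : ∀ i, IsPeriodicTest (φ i))
    (j : Fin 2) : IsWeakPartial j (ofSmooth φ hφ)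
      (ofSmooth (fun i => partialDeriv j (φ i)) fun i => (hφ i).partialDeriv j) := by
  intro ψ hψ
  ext i
  rw [PiLp.neg_apply, integral_apply (integrable_smul_field (hψ.partialDeriv j) _),
    integral_apply (integrable_smul_field hψ _)]
  have h := integral_partialDeriv_mul hψ (hφ i) j
  convert h using 1
  · refine integral_congr_ae ?_
    filter_upwards [coeFn_ofSmooth hφ] with x hx
    rw [hx]; simp [field]
  · congr 1
    refine integral_congr_ae ?_
    filter_upwards [coeFn_ofSmooth fun i => (hφ i).partialDeriv j] with x hx
    rw [hx]; simp [field]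

theorem isDivFree_iff (u : L2) : IsDivFree u ↔ ∀ (ψ : Plane → ℝ) (hψ : IsPeriodicTest ψ),
    inner ℝ u (ofSmooth (fun j => partialDeriv j ψ) fun j => hψ.partialDeriv j) = 0 := by
  refine forall₂_congr fun ψ hψ => ?_
  rw [L2.inner_def]
  suffices h : ∫ x, fderiv ℝ ψ x (u x) ∂cellMeasure = ∫ x, inner ℝ (u x)
      (ofSmooth (fun j => partialDeriv j ψ) (fun j => hψ.partialDeriv j) x) ∂cellMeasure by
    rw [h]
  refine integral_congr_ae ?_
  filter_upwards [coeFn_ofSmooth fun j => hψ.partialDeriv j] with x hx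
  rw [hx, fderiv_apply_eq_sum]
  simp [field, PiLp.inner_apply, mul_comm]

/-- The field `x ↦ (cos (k · x) + sin (k · x)) a`. -/
def harField (a : Fin 2 → ℝ) (k : Fin 2 → ℤ) : L2 :=
  ofSmooth (fun i x => a i * har k x) fun i => (isPeriodicTest_har k).const_mul (a i)

theorem inner_harField (u : L2) (a : Fin 2 → ℝ) (k : Fin 2 → ℤ) :
    inner ℝ u (harField a k) = ∑ i, a i * (∫ x, har k x • u x ∂cellMeasure) i := by
  rw [harField, inner_ofSmooth]
  refine Finset.sum_congr rfl fun i _ => ?_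
  simp only [mul_smul, integral_smul]
  simp

theorem inner_harField_harField (a b : Fin 2 → ℝ) (k l : Fin 2 → ℤ) :
    inner ℝ (harField a k) (harField b l) =
      if k = l then (∑ i, a i * b i) * (2 * Real.pi) ^ 2 else 0 := by
  rw [harField, harField, inner_ofSmooth_ofSmooth]
  have e : ∀ i x, a i * har k x * (b i * har l x) = a i * b i * (har k x * har l x) := by
    intros; ring
  simp only [e, integral_const_mul, integral_har_mul_har]
  split_ifs
  · rw [Finset.sum_mul]
  · simp

theorem partialDeriv_har_eq (a : Fin 2 → ℝ) (k : Fin 2 → ℤ) (j : Fin 2) :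
    (fun i => partialDeriv j (fun x => a i * har k x)) =
      fun i x => (k j • a) i * har (-k) x := by
  funext i x
  rw [partialDeriv_const_mul _ (isPeriodicTest_har k), partialDeriv_har]
  simp
  ring

theorem isWeakPartial_harField (a : Fin 2 → ℝ) (k : Fin 2 → ℤ) (j : Fin 2) :
    IsWeakPartial j (harField a k) (harField (k j • a) (-k)) := by
  have h := isWeakPartial_ofSmooth (fun i => (isPeriodicTest_har k).const_mul (a i)) j
  simp only [partialDeriv_har_eq] at h
  exact h

theorem IsWeakPartial.inner_harField {j : Fin 2} {u g : L2} (h : IsWeakPartial j u g)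
    (a : Fin 2 → ℝ) (k : Fin 2 → ℤ) :
    inner ℝ g (harField a k) = -inner ℝ u (harField (k j • a) (-k)) := by
  have h := h.inner_ofSmooth fun i => (isPeriodicTest_har k).const_mul (a i)
  simp only [partialDeriv_har_eq] at h
  exact h

theorem harField_smul (r : ℝ) (a : Fin 2 → ℝ) (k : Fin 2 → ℤ) :
    harField (r • a) k = r • harField a k := by
  rw [harField, harField, ofSmooth, ofSmooth, ← MemLp.toLp_const_smul]
  congr 1
  funext x
  ext i
  simp [field]
  ring

theorem harField_zsmul (r : ℤ) (a : Fin 2 → ℝ) (k : Fin 2 → ℤ) :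
    harField (r • a) k = (r : ℝ) • harField a k := by
  rw [← harField_smul, Int.cast_smul_eq_zsmul]

/-! ### The eigenfunctions of the Stokes operator -/

/-- The nonzero frequencies. -/
abbrev Freq : Type := {k : Fin 2 → ℤ // k ≠ 0}

/-- The eigenvalue `|k|²`. -/
def lam (k : Freq) : ℝ := (k.1 0 : ℝ) ^ 2 + (k.1 1 : ℝ) ^ 2

theorem one_le_lam (k : Freq) : 1 ≤ lam k := by
  obtain ⟨k, hk⟩ := k
  have h : (1 : ℤ) ≤ k 0 ^ 2 + k 1 ^ 2 := by
    by_contra! h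
    have h0 : k 0 = 0 := by nlinarith [sq_nonneg (k 0), sq_nonneg (k 1)]
    have h1 : k 1 = 0 := by nlinarith [sq_nonneg (k 0), sq_nonneg (k 1)]
    exact hk (funext fun i => by fin_cases i <;> simpa)
  unfold lam
  exact_mod_cast h

theorem lam_pos (k : Freq) : 0 < lam k := zero_lt_one.trans_le (one_le_lam k)

/-- The amplitude `k^⊥ / (2π|k|)` of the eigenfunction of frequency `k`. -/
def amp (k : Freq) : Fin 2 → ℝ :=
  (2 * Real.pi * √(lam k))⁻¹ • ![-(k.1 1 : ℝ), (k.1 0 : ℝ)]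

theorem sum_amp_sq (k : Freq) : (∑ i, amp k i * amp k i) * (2 * Real.pi) ^ 2 = 1 := by
  have h := Real.sq_sqrt (lam_pos k).le
  have h' : √(lam k) ≠ 0 := (Real.sqrt_pos.2 (lam_pos k)).ne'
  have hpi := Real.pi_ne_zero
  simp only [amp, Fin.sum_univ_two, Pi.smul_apply, Matrix.cons_val_zero, Matrix.cons_val_one,
    smul_eq_mul]
  field_simp
  rw [h, lam]
  ring

theorem sum_amp_mul_freq (k : Freq) : ∑ i, amp k i * (k.1 i : ℝ) = 0 := by
  simp only [amp, Fin.sum_univ_two, Pi.smul_apply, Matrix.cons_val_zero, Matrix.cons_val_one,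
    smul_eq_mul]
  ring

theorem har_zero : har 0 = fun _ => 1 := by
  funext x
  simp [har, phase]

theorem harField_amp_mem (k : Freq) : harField (amp k) k.1 ∈ solenoidal := by
  constructor
  · rw [IsMeanZero]
    ext i
    rw [integral_apply (integrable_field _)]
    have h := integral_har_mul_har k.1 0
    rw [if_neg k.2, har_zero] at h
    simp only [mul_one] at h
    have e : ∫ x, amp k i * har k.1 x ∂cellMeasure = 0 := by rw [integral_const_mul, h, mul_zero]
    rw [PiLp.zero_apply, ← e]
    refine integral_congr_ae ?_
    filter_upwards [coeFn_ofSmooth fun i => (isPeriodicTest_har k.1).const_mul (amp k i)] with x hx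
    rw [harField, hx, field]
  · rw [isDivFree_iff]
    intro ψ hψ
    rw [harField, inner_ofSmooth_ofSmooth]
    have e : ∀ i : Fin 2, ∫ x, amp k i * har k.1 x * partialDeriv i ψ x ∂cellMeasure =
        -(amp k i * k.1 i) * ∫ x, har (-k.1) x * ψ x ∂cellMeasure := by
      intro i
      have h := integral_partialDeriv_mul (isPeriodicTest_har k.1) hψ i
      simp only [partialDeriv_har, mul_assoc] at h ⊢
      rw [integral_const_mul] at h ⊢
      rw [neg_mul, mul_assoc, h]
      ring
    simp only [e]
    rw [← Finset.sum_mul, Finset.sum_neg_distrib, sum_amp_mul_freq]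
    simp

/-- The eigenfunction of the Stokes operator of frequency `k`, as an element of `𝐇`. -/
def waveH (k : Freq) : H := (⟨harField (amp k) k.1, harField_amp_mem k⟩ : ↥solenoidal)

theorem hToL2_waveH (k : Freq) : hToL2 (waveH k) = harField (amp k) k.1 := rfl

theorem inner_hToL2 (u v : H) : inner ℝ (hToL2 u) (hToL2 v) = inner ℝ u v := rfl

theorem orthonormal_waveH : Orthonormal ℝ waveH := by
  rw [orthonormal_iff_ite]
  intro k l
  rw [← inner_hToL2, hToL2_waveH, hToL2_waveH, inner_harField_harField]
  by_cases h : k = l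
  · subst h
    rw [if_pos rfl, if_pos rfl, sum_amp_sq]
  · rw [if_neg h, if_neg fun h' => h (Subtype.ext h')]

theorem eq_zero_of_inner_waveH {u : H} (h : ∀ k, inner ℝ u (waveH k) = 0) : u = 0 := by
  have hu : hToL2 u ∈ solenoidal := (show ↥solenoidal from u).2
  suffices h0 : hToL2 u = 0 from Subtype.ext h0
  refine eq_zero_of_integral_har_smul fun k => ?_
  rcases eq_or_ne k 0 with rfl | hk
  · simp only [har_zero, one_smul]
    exact hu.1
  set c := ∫ x, har k x • hToL2 u x ∂cellMeasure with hc
  have h1 : ∑ i, amp ⟨k, hk⟩ i * c i = 0 := by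
    rw [hc, ← inner_harField]
    exact h ⟨k, hk⟩
  have h2 : ∑ i, (k i : ℝ) * c i = 0 := by
    have := (isDivFree_iff _).1 hu.2 _ (isPeriodicTest_har (-k))
    rw [inner_ofSmooth] at this
    simp only [partialDeriv_har, neg_neg, mul_smul, integral_smul] at this
    rw [← hc] at this
    simp only [Pi.neg_apply, Int.cast_neg, neg_smul, PiLp.neg_apply, PiLp.smul_apply, smul_eq_mul,
      Finset.sum_neg_distrib, neg_eq_zero] at this
    exact this
  have hl := lam_pos ⟨k, hk⟩
  simp only [amp, Fin.sum_univ_two, Pi.smul_apply, Matrix.cons_val_zero, Matrix.cons_val_one,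
    smul_eq_mul, mul_assoc, ← mul_add] at h1 h2
  have h3 := (mul_eq_zero.1 h1).resolve_left (by positivity)
  have h4 : ∀ i, lam ⟨k, hk⟩ * c i = 0 := by
    intro i
    unfold lam
    obtain rfl | rfl : i = 0 ∨ i = 1 := by omega
    · linear_combination (k 0 : ℝ) * h2 - (k 1 : ℝ) * h3
    · linear_combination (k 1 : ℝ) * h2 + (k 0 : ℝ) * h3
  ext i
  exact (mul_eq_zero.1 (h4 i)).resolve_left hl.ne'

/-- The eigenfunctions of the Stokes operator form a Hilbert basis of `𝐇`. -/
def basisH : HilbertBasis Freq ℝ H :=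
  HilbertBasis.mkOfOrthogonalEqBot orthonormal_waveH (by
    rw [Submodule.eq_bot_iff]
    intro u hu
    refine eq_zero_of_inner_waveH fun k => ?_
    rw [real_inner_comm]
    exact (Submodule.mem_orthogonal _ _).1 hu _ (Submodule.subset_span ⟨k, rfl⟩))

theorem basisH_apply (k : Freq) : basisH k = waveH k := by
  rw [basisH, HilbertBasis.coe_mkOfOrthogonalEqBot]

/-- The eigenfunction of frequency `k`, as an element of `𝐕`. -/
def waveV (k : Freq) : V :=
  (⟨(WithLp.toLp 2 (waveH k, WithLp.toLp 2 fun j => harField (k.1 j • amp k) (-k.1)) :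
    WithLp 2 (H × PiLp 2 fun _ : Fin 2 => L2)), isWeakPartial_harField _ _⟩ :
      ↥gradGraph)

theorem vToH_waveV (k : Freq) : vToH (waveV k) = waveH k := rfl

theorem grad_waveV (k : Freq) (j : Fin 2) :
    grad j (waveV k) = harField (k.1 j • amp k) (-k.1) := rfl

/-- The eigenfunction of frequency `k`, as an element of `D(A)`. -/
def waveDA (k : Freq) : DA :=
  (⟨(WithLp.toLp 2 (waveV k, WithLp.toLp 2 fun p : Fin 2 × Fin 2 =>
      harField ((-k.1) p.1 • k.1 p.2 • amp k) (- -k.1)) :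
    WithLp 2 (V × PiLp 2 fun _ : Fin 2 × Fin 2 => L2)),
      fun i _ => isWeakPartial_harField _ _ i⟩ : ↥hessGraph)

theorem daToV_waveDA (k : Freq) : daToV (waveDA k) = waveV k := rfl

theorem daToH_waveDA (k : Freq) : daToH (waveDA k) = waveH k := rfl

theorem hess_waveDA (k : Freq) (i j : Fin 2) :
    hess i j (waveDA k) = harField ((-k.1) i • k.1 j • amp k) (- -k.1) := rfl

theorem isWeakPartial_grad (v : V) (j : Fin 2) : IsWeakPartial j (hToL2 (vToH v)) (grad j v) :=
  (show ↥gradGraph from v).2 j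

theorem isWeakPartial_hess (u : DA) (i j : Fin 2) :
    IsWeakPartial i (grad j (daToV u)) (hess i j u) :=
  (show ↥hessGraph from u).2 i j

theorem inner_V (u v : V) : inner ℝ u v =
    inner ℝ (vToH u) (vToH v) + ∑ j, inner ℝ (grad j u) (grad j v) := rfl

theorem inner_DA (u v : DA) : inner ℝ u v =
    inner ℝ (daToV u) (daToV v) + ∑ i, ∑ j, inner ℝ (hess i j u) (hess i j v) := by
  have h : inner ℝ u v = inner ℝ (daToV u) (daToV v) +
      ∑ p : Fin 2 × Fin 2, inner ℝ (hess p.1 p.2 u) (hess p.1 p.2 v) := rfl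
  rw [h, Fintype.sum_prod_type]

theorem inner_grad_waveV (v : V) (k : Freq) (j : Fin 2) :
    inner ℝ (grad j v) (grad j (waveV k)) = (k.1 j : ℝ) ^ 2 * inner ℝ (vToH v) (waveH k) := by
  rw [grad_waveV, (isWeakPartial_grad v j).inner_harField, neg_neg, harField_zsmul,
    harField_zsmul, inner_smul_right, inner_smul_right, ← hToL2_waveH, inner_hToL2]
  push_cast [Pi.neg_apply]
  ring

theorem inner_V_waveV (v : V) (k : Freq) :
    inner ℝ v (waveV k) = (1 + lam k) * inner ℝ (vToH v) (waveH k) := by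
  rw [inner_V, vToH_waveV]
  simp only [inner_grad_waveV, Fin.sum_univ_two, lam]
  ring

theorem inner_hess_harField (u : DA) (k : Freq) (i j : Fin 2) :
    inner ℝ (hess i j u) (harField (amp k) k.1) =
      -((k.1 i * k.1 j : ℝ) * inner ℝ (daToH u) (waveH k)) := by
  rw [(isWeakPartial_hess u i j).inner_harField, (isWeakPartial_grad _ j).inner_harField, neg_neg,
    neg_neg, harField_zsmul, harField_zsmul, inner_smul_right, inner_smul_right, ← hToL2_waveH,
    inner_hToL2, daToH, ContinuousLinearMap.comp_apply]
  push_cast [Pi.neg_apply]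
  ring

theorem inner_DA_waveDA (u : DA) (k : Freq) :
    inner ℝ u (waveDA k) = (1 + lam k + lam k ^ 2) * inner ℝ (daToH u) (waveH k) := by
  have h : inner ℝ (daToV u) (daToV (waveDA k)) = (1 + lam k) * inner ℝ (daToH u) (waveH k) :=
    inner_V_waveV _ _
  rw [inner_DA, h]
  simp only [hess_waveDA, harField_zsmul, inner_smul_right, neg_neg, inner_hess_harField,
    Fin.sum_univ_two, lam]
  push_cast [Pi.neg_apply]
  ring

theorem inner_leray (f : L2) (h : H) : inner ℝ (leray f) h = inner ℝ f (hToL2 h) :=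
  Submodule.inner_orthogonalProjectionOnto_eq_of_mem_right (K := solenoidal) h f

theorem norm_leray_le (f : L2) : ‖leray f‖ ≤ ‖f‖ :=
  Submodule.norm_orthogonalProjectionOnto_apply_le solenoidal f

theorem inner_stokes_waveH (u : DA) (k : Freq) :
    inner ℝ (stokes u) (waveH k) = lam k * inner ℝ (daToH u) (waveH k) := by
  rw [stokes, inner_neg_left, inner_leray, hToL2_waveH, laplacian, sum_inner]
  simp only [inner_hess_harField, Fin.sum_univ_two, lam]
  ring

/-! ### Completeness and Parseval identities for `𝐕` and `D(A)` -/

instance : CompleteSpace GradPair :=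
  inferInstanceAs (CompleteSpace (WithLp 2 (H × PiLp 2 fun _ : Fin 2 => L2)))

theorem isClosed_setOf_isWeakPartial {X : Type*} [TopologicalSpace X] (j : Fin 2) {u g : X → L2}
    (hu : Continuous u) (hg : Continuous g) : IsClosed {p | IsWeakPartial j (u p) (g p)} := by
  have h : {p | IsWeakPartial j (u p) (g p)} = ⋂ (φ : Plane → ℝ) (_ : IsPeriodicTest φ),
      {p | ∫ x, partialDeriv j φ x • u p x ∂cellMeasure =
        -∫ x, φ x • g p x ∂cellMeasure} := by
    ext p
    simp only [mem_ofPred_eq, IsWeakPartial, mem_iInter]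
  rw [h]
  refine isClosed_iInter fun φ => isClosed_iInter fun hφ => ?_
  obtain ⟨P, hP⟩ := exists_pairing_smul (continuous_partialDeriv hφ j)
  obtain ⟨Q, hQ⟩ := exists_pairing_smul hφ.smooth.continuous
  simp only [← hP, ← hQ]
  exact isClosed_eq (P.continuous.comp hu) (Q.continuous.comp hg).neg

theorem isClosed_gradGraph : IsClosed (gradGraph : Set GradPair) := by
  have h : (gradGraph : Set GradPair) = ⋂ j, {p | IsWeakPartial j (hToL2 (GradPair.field p))
      (GradPair.entry j p)} := by
    ext p
    simp only [mem_iInter]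
    rfl
  rw [h]
  exact isClosed_iInter fun j => isClosed_setOf_isWeakPartial j
    (hToL2.continuous.comp GradPair.field.continuous) (GradPair.entry j).continuous

instance : CompleteSpace V := isClosed_gradGraph.completeSpace_coe

instance : CompleteSpace HessPair :=
  inferInstanceAs (CompleteSpace (WithLp 2 (V × PiLp 2 fun _ : Fin 2 × Fin 2 => L2)))

theorem isClosed_hessGraph : IsClosed (hessGraph : Set HessPair) := by
  have h : (hessGraph : Set HessPair) = ⋂ i, ⋂ j, {p | IsWeakPartial i
      (grad j (HessPair.field p)) (HessPair.entry i j p)} := by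
    ext p
    simp only [mem_iInter]
    rfl
  rw [h]
  exact isClosed_iInter fun i => isClosed_iInter fun j => isClosed_setOf_isWeakPartial i
    ((grad j).continuous.comp HessPair.field.continuous) (HessPair.entry i j).continuous

instance : CompleteSpace DA := isClosed_hessGraph.completeSpace_coe

theorem eq_zero_of_inner_harField {g : L2} (h : ∀ a k, inner ℝ g (harField a k) = 0) : g = 0 := by
  refine eq_zero_of_integral_har_smul fun k => ?_
  ext i
  have := h (Pi.single i 1) k
  rw [inner_harField] at this
  simpa [Pi.single_apply] using this

theorem vToH_injective : Function.Injective vToH := by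
  refine (injective_iff_map_eq_zero _).2 fun v hv => ?_
  have hg : ∀ j, grad j v = 0 := fun j => eq_zero_of_inner_harField fun a k => by
    rw [(isWeakPartial_grad v j).inner_harField, hv, map_zero, inner_zero_left, neg_zero]
  have : inner ℝ v v = 0 := by
    rw [inner_V, hv]
    simp [hg]
  exact inner_self_eq_zero.1 this

theorem daToV_injective : Function.Injective daToV := by
  refine (injective_iff_map_eq_zero _).2 fun u hu => ?_
  have hg : ∀ i j, hess i j u = 0 := fun i j => eq_zero_of_inner_harField fun a k => by
    rw [(isWeakPartial_hess u i j).inner_harField, hu, map_zero, inner_zero_left, neg_zero]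
  have : inner ℝ u u = 0 := by
    rw [inner_DA, hu]
    simp [hg]
  exact inner_self_eq_zero.1 this

theorem daToH_injective : Function.Injective daToH := vToH_injective.comp daToV_injective

/-- Coefficient of a field with respect to the eigenfunction of frequency `k`. -/
def coef (k : Freq) : H →L[ℝ] ℝ := innerSL ℝ (waveH k)

theorem coef_apply (k : Freq) (u : H) : coef k u = inner ℝ u (waveH k) := by
  rw [coef, innerSL_apply_apply, real_inner_comm]

section Parseval

variable {X : Type*} [NormedAddCommGroup X] [InnerProductSpace ℝ X] [CompleteSpace X]

/-- If the eigenfunctions lift to a Hilbert space `X` over `𝐇`, in which they are orthogonal with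
squared norms `m k`, then the squared norm of `X` is the weighted sum of squared coefficients. -/
theorem parseval_of_lift (i : X →L[ℝ] H) (hi : Function.Injective i) (f : Freq → X) (m : Freq → ℝ)
    (hm : ∀ k, 0 < m k) (hif : ∀ k, i (f k) = waveH k)
    (hf : ∀ x k, inner ℝ x (f k) = m k * coef k (i x)) :
    Dense (Submodule.span ℝ (range f) : Set X) ∧
      ∀ x, HasSum (fun k => m k * coef k (i x) ^ 2) (‖x‖ ^ 2) := by
  have hperp : ∀ x : X, (∀ k, inner ℝ x (f k) = 0) → x = 0 := by
    intro x hx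
    refine hi ?_
    rw [map_zero]
    refine eq_zero_of_inner_waveH fun k => ?_
    have := hx k
    rw [hf, coef_apply] at this
    exact (mul_eq_zero.1 this).resolve_left (hm k).ne'
  have hspan : ∀ g : Freq → X, (∀ k, ∃ r : ℝ, f k = r • g k) →
      (Submodule.span ℝ (range g))ᗮ = ⊥ := by
    intro g hg
    rw [Submodule.eq_bot_iff]
    intro x hx
    refine hperp x fun k => ?_
    obtain ⟨r, hr⟩ := hg k
    rw [hr, inner_smul_right, real_inner_comm,
      (Submodule.mem_orthogonal _ _).1 hx _ (Submodule.subset_span ⟨k, rfl⟩), mul_zero]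
  refine ⟨?_, fun x => ?_⟩
  · rw [Submodule.dense_iff_topologicalClosure_eq_top,
      Submodule.topologicalClosure_eq_top_iff]
    exact hspan f fun k => ⟨1, (one_smul _ _).symm⟩
  · let g : Freq → X := fun k => (√(m k))⁻¹ • f k
    have hs : ∀ k, √(m k) ≠ 0 := fun k => (Real.sqrt_pos.2 (hm k)).ne'
    have hsq : ∀ k, √(m k) * √(m k) = m k := fun k => Real.mul_self_sqrt (hm k).le
    have ho : Orthonormal ℝ g := by
      rw [orthonormal_iff_ite]
      intro k l
      have e : inner ℝ (g k) (g l) =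
          (√(m k))⁻¹ * (√(m l))⁻¹ * (m l * inner ℝ (waveH k) (waveH l)) := by
        simp only [g]
        rw [real_inner_smul_left, real_inner_smul_right, hf, hif, coef_apply]
        ring
      rw [e, orthonormal_iff_ite.1 orthonormal_waveH]
      split_ifs with h
      · subst h
        rw [mul_one, ← mul_inv, hsq, inv_mul_cancel₀ (hm k).ne']
      · rw [mul_zero, mul_zero]
    let b := HilbertBasis.mkOfOrthogonalEqBot ho
      (hspan g fun k => ⟨√(m k), by simp only [g, smul_smul, mul_inv_cancel₀ (hs k), one_smul]⟩)
    have h := b.hasSum_inner_mul_inner x x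
    rw [real_inner_self_eq_norm_sq] at h
    have e : ∀ k, inner ℝ x (b k) * inner ℝ (b k) x = m k * coef k (i x) ^ 2 := by
      intro k
      have h1 : inner ℝ x (b k) = (√(m k))⁻¹ * (m k * coef k (i x)) := by
        rw [HilbertBasis.coe_mkOfOrthogonalEqBot]
        simp only [g]
        rw [real_inner_smul_right, hf]
      rw [real_inner_comm x (b k), h1]
      have := hs k
      calc _ = (√(m k) * √(m k))⁻¹ * m k * (m k * coef k (i x) ^ 2) := by ring
        _ = _ := by rw [hsq, inv_mul_cancel₀ (hm k).ne', one_mul]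
    simpa only [e] using h

end Parseval

theorem hasSum_coef_sq (u : H) : HasSum (fun k => coef k u ^ 2) (‖u‖ ^ 2) := by
  have h := (parseval_of_lift (ContinuousLinearMap.id ℝ H) Function.injective_id waveH 1
    (fun _ => one_pos) (fun _ => rfl) fun x k => by simp [coef_apply]).2 u
  simpa using h

/-- The eigenfunctions are complete in `𝐕`, where `‖v‖² = ∑ (1 + λ_k) v_k²`. -/
theorem parseval_V : Dense (Submodule.span ℝ (range waveV) : Set V) ∧
    ∀ v, HasSum (fun k => (1 + lam k) * coef k (vToH v) ^ 2) (‖v‖ ^ 2) :=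
  parseval_of_lift vToH vToH_injective waveV (fun k => 1 + lam k)
    (fun k => by linarith [lam_pos k]) vToH_waveV fun v k => by
      rw [inner_V_waveV, coef_apply]

/-- The eigenfunctions are complete in `D(A)`, where `‖u‖² = ∑ (1 + λ_k + λ_k²) u_k²`. -/
theorem parseval_DA : Dense (Submodule.span ℝ (range waveDA) : Set DA) ∧
    ∀ u, HasSum (fun k => (1 + lam k + lam k ^ 2) * coef k (daToH u) ^ 2) (‖u‖ ^ 2) :=
  parseval_of_lift daToH daToH_injective waveDA (fun k => 1 + lam k + lam k ^ 2)
    (fun k => by have := lam_pos k; positivity) daToH_waveDA fun v k => by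
      rw [inner_DA_waveDA, coef_apply]

/-- The squared norm `|∇v|² = |A^{1/2} v|²`. -/
def gradSq (v : V) : ℝ := ∑ j, ‖grad j v‖ ^ 2

theorem gradSq_nonneg (v : V) : 0 ≤ gradSq v := Finset.sum_nonneg fun _ _ => sq_nonneg _

theorem norm_sq_V (v : V) : ‖v‖ ^ 2 = ‖vToH v‖ ^ 2 + gradSq v := by
  rw [← real_inner_self_eq_norm_sq, inner_V, real_inner_self_eq_norm_sq]
  simp only [real_inner_self_eq_norm_sq, gradSq]

theorem hasSum_gradSq (v : V) : HasSum (fun k => lam k * coef k (vToH v) ^ 2) (gradSq v) := by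
  have h := (parseval_V.2 v).sub (hasSum_coef_sq (vToH v))
  rw [norm_sq_V, add_sub_cancel_left] at h
  refine h.congr_fun fun k => ?_
  ring

theorem norm_vToH_sq_le (v : V) : ‖vToH v‖ ^ 2 ≤ gradSq v :=
  hasSum_le (fun k => le_mul_of_one_le_left (sq_nonneg _) (one_le_lam k))
    (hasSum_coef_sq _) (hasSum_gradSq v)

theorem norm_sq_V_le (v : V) : ‖v‖ ^ 2 ≤ 2 * gradSq v := by
  linarith [norm_sq_V v, norm_vToH_sq_le v]

theorem gradSq_le_norm_sq (v : V) : gradSq v ≤ ‖v‖ ^ 2 := by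
  linarith [norm_sq_V v, sq_nonneg ‖vToH v‖]

theorem gradSq_add_le (v w : V) : gradSq (v + w) ≤ 2 * gradSq v + 2 * gradSq w := by
  simp only [gradSq, Finset.mul_sum, ← Finset.sum_add_distrib, map_add]
  refine Finset.sum_le_sum fun j _ => ?_
  have := norm_add_le (grad j v) (grad j w)
  nlinarith [norm_nonneg (grad j v + grad j w), sq_nonneg (‖grad j v‖ - ‖grad j w‖)]

theorem continuous_gradSq : Continuous gradSq :=
  continuous_finsetSum _ fun j _ => (grad j).continuous.norm.pow 2

/-- The Stokes operator as a bounded operator from `D(A)` to `𝐇`. -/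
def stokesL : DA →L[ℝ] H := -(leray.comp (∑ j : Fin 2, hess j j))

theorem stokesL_apply (u : DA) : stokesL u = stokes u := by
  simp [stokesL, stokes, laplacian]

theorem coef_stokes (u : DA) (k : Freq) : coef k (stokes u) = lam k * coef k (daToH u) := by
  rw [coef_apply, inner_stokes_waveH, coef_apply]

theorem hasSum_stokes (u : DA) :
    HasSum (fun k => lam k ^ 2 * coef k (daToH u) ^ 2) (‖stokes u‖ ^ 2) := by
  refine (hasSum_coef_sq (stokes u)).congr_fun fun k => ?_
  rw [coef_stokes]
  ring

theorem norm_sq_DA (u : DA) : ‖u‖ ^ 2 = ‖daToV u‖ ^ 2 + ‖stokes u‖ ^ 2 := by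
  refine (parseval_DA.2 u).unique (((parseval_V.2 (daToV u)).add (hasSum_stokes u)).congr_fun
    fun k => ?_)
  rw [daToH, ContinuousLinearMap.comp_apply]
  ring

theorem gradSq_le_stokes (u : DA) : gradSq (daToV u) ≤ ‖stokes u‖ ^ 2 :=
  hasSum_le (fun k => mul_le_mul_of_nonneg_right (by nlinarith [one_le_lam k]) (sq_nonneg _))
    (hasSum_gradSq (daToV u)) (hasSum_stokes u)

theorem norm_sq_DA_le (u : DA) : ‖u‖ ^ 2 ≤ 3 * ‖stokes u‖ ^ 2 := by
  linarith [norm_sq_DA u, norm_sq_V_le (daToV u), gradSq_le_stokes u]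

theorem norm_stokes_le (u : DA) : ‖stokes u‖ ≤ ‖u‖ := by
  refine abs_le_of_sq_le_sq' ?_ (norm_nonneg _) |>.2
  linarith [norm_sq_DA u, sq_nonneg ‖daToV u‖]

/-! ### The embedding of `D(A)` in `L^∞` and bounds on the convection term -/

theorem summable_agmon : Summable fun k : Freq => (lam k * √(lam k))⁻¹ := by
  have h := (EisensteinSeries.summable_one_div_norm_rpow (k := 3) (by norm_num)).comp_injective
    (Subtype.val_injective (p := fun k : Fin 2 → ℤ => k ≠ 0))
  refine h.of_nonneg_of_le (fun k => by have := lam_pos k; positivity) fun k => ?_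
  have hk : 0 < ‖k.1‖ := norm_pos_iff.2 k.2
  have h1 : ‖k.1‖ ≤ √(lam k) := by
    refine (pi_norm_le_iff_of_nonneg (Real.sqrt_nonneg _)).2 fun i => ?_
    rw [Int.norm_eq_abs]
    refine Real.abs_le_sqrt ?_
    unfold lam
    fin_cases i
    · exact le_add_of_nonneg_right (sq_nonneg _)
    · exact le_add_of_nonneg_left (sq_nonneg _)
  have h2 : ‖k.1‖ ^ 3 ≤ lam k * √(lam k) := by
    calc ‖k.1‖ ^ 3 ≤ √(lam k) ^ 3 := by gcongr
      _ = lam k * √(lam k) := by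
        rw [pow_succ, Real.sq_sqrt (lam_pos k).le]
  simp only [Function.comp_apply]
  rw [Real.rpow_neg hk.le, show (3 : ℝ) = ((3 : ℕ) : ℝ) by norm_num, Real.rpow_natCast]
  exact inv_anti₀ (by positivity) h2

/-- The constant `∑ |k|⁻³` over nonzero frequencies. -/
def agmonConst : ℝ := ∑' k : Freq, (lam k * √(lam k))⁻¹

theorem agmonConst_nonneg : 0 ≤ agmonConst :=
  tsum_nonneg fun k => by have := lam_pos k; positivity

/-- An inequality of Agmon type: the coefficients of `u ∈ D(A)` are absolutely summable. It
follows from the Cauchy–Schwarz inequality and `2|k|³ ≤ ε|k|⁴ + ε⁻¹|k|²`. -/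
theorem sum_abs_coef_sq_le (u : DA) (s : Finset Freq) {ε : ℝ} (hε : 0 < ε) :
    (∑ k ∈ s, |coef k (daToH u)|) ^ 2 ≤
      agmonConst * (ε * ‖stokes u‖ ^ 2 + ε⁻¹ * gradSq (daToV u)) := by
  have h1 : ∑ k ∈ s, |coef k (daToH u)| = ∑ k ∈ s, √((lam k * √(lam k))⁻¹) *
      (√(lam k * √(lam k)) * |coef k (daToH u)|) := by
    refine Finset.sum_congr rfl fun k _ => ?_
    have : 0 < √(lam k * √(lam k)) := by have := lam_pos k; positivity
    rw [Real.sqrt_inv, inv_mul_cancel_left₀ this.ne']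
  rw [h1]
  refine (Finset.sum_mul_sq_le_sq_mul_sq _ _ _).trans ?_
  refine mul_le_mul ?_ ?_ (Finset.sum_nonneg fun _ _ => sq_nonneg _) agmonConst_nonneg
  · refine le_trans (le_of_eq ?_) (summable_agmon.sum_le_tsum s fun k _ => by
      have := lam_pos k; positivity)
    refine Finset.sum_congr rfl fun k _ => Real.sq_sqrt ?_
    have := lam_pos k
    positivity
  · have h2 := ((hasSum_stokes u).mul_left ε).add ((hasSum_gradSq (daToV u)).mul_left ε⁻¹)
    refine le_trans (Finset.sum_le_sum fun k _ => ?_) (sum_le_hasSum s (fun k _ => ?_) h2)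
    · have hl := lam_pos k
      rw [mul_pow, Real.sq_sqrt (by positivity), sq_abs]
      have e : vToH (daToV u) = daToH u := rfl
      rw [e, ← mul_assoc, ← mul_assoc, ← add_mul]
      refine mul_le_mul_of_nonneg_right ?_ (sq_nonneg _)
      have hs := Real.sq_sqrt hl.le
      set r := √(lam k)
      have hr : 0 ≤ r := Real.sqrt_nonneg _
      rw [← hs]
      have h3 : r ^ 2 * r ≤ r ^ 2 * (ε * r ^ 2 + ε⁻¹) := by
        refine mul_le_mul_of_nonneg_left ?_ (sq_nonneg _)
        have h4 : ε⁻¹ * ε = 1 := inv_mul_cancel₀ hε.ne'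
        have h5 : 0 < ε⁻¹ := inv_pos.2 hε
        have h6 : ε * r ^ 2 + ε⁻¹ - r = ε⁻¹ * ((ε * r - 1 / 2) ^ 2 + 3 / 4) := by
          linear_combination (-ε * r ^ 2 + r) * h4
        nlinarith [mul_nonneg h5.le (add_nonneg (sq_nonneg (ε * r - 1 / 2))
          (by norm_num : (0 : ℝ) ≤ 3 / 4))]
      linarith [h3]
    · have hl := lam_pos k
      positivity

theorem isClosed_setOf_ae_norm_le (M : ℝ) :
    IsClosed {f : L2 | ∀ᵐ x ∂cellMeasure, ‖f x‖ ≤ M} := by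
  refine IsSeqClosed.isClosed fun f g hf hfg => ?_
  obtain ⟨ns, -, hns⟩ := (tendstoInMeasure_of_tendsto_Lp hfg).exists_seq_tendsto_ae
  have hf' : ∀ᵐ x ∂cellMeasure, ∀ n, ‖f n x‖ ≤ M := ae_all_iff.2 hf
  filter_upwards [hns, hf'] with x hx hM
  exact le_of_tendsto hx.norm (Eventually.of_forall fun n => hM _)

theorem norm_field_har_le (k : Freq) (x : Plane) :
    ‖field (fun i x => amp k i * har k.1 x) x‖ ≤ 1 := by
  have h1 := sum_amp_sq k
  have h2 : har k.1 x ^ 2 ≤ 2 ^ 2 := sq_le_sq' (abs_le.1 (abs_har_le k.1 x)).1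
    (abs_le.1 (abs_har_le k.1 x)).2
  have h3 := Real.pi_gt_three
  rw [EuclideanSpace.norm_eq, Real.sqrt_le_iff]
  refine ⟨zero_le_one, ?_⟩
  simp only [field, Fin.sum_univ_two, Real.norm_eq_abs, sq_abs] at h1 ⊢
  have h4 : 0 ≤ amp k 0 * amp k 0 + amp k 1 * amp k 1 :=
    add_nonneg (mul_self_nonneg _) (mul_self_nonneg _)
  nlinarith [mul_le_mul_of_nonneg_left h2 h4,
    mul_nonneg h4 (by nlinarith : 0 ≤ (2 * Real.pi) ^ 2 - 4)]

/-- Fields in `D(A)` are bounded. -/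
theorem exists_sup_bound (u : DA) : ∃ M : ℝ, 0 ≤ M ∧
    (∀ ε > 0, M ^ 2 ≤ agmonConst * (ε * ‖stokes u‖ ^ 2 + ε⁻¹ * gradSq (daToV u))) ∧
    ∀ᵐ x ∂cellMeasure, ‖hToL2 (daToH u) x‖ ≤ M := by
  have hs : Summable fun k => |coef k (daToH u)| :=
    summable_of_sum_le (fun k => abs_nonneg _) fun s =>
      Real.le_sqrt_of_sq_le (sum_abs_coef_sq_le u s one_pos)
  refine ⟨∑' k, |coef k (daToH u)|, tsum_nonneg fun k => abs_nonneg _, fun ε hε => ?_, ?_⟩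
  · exact le_of_tendsto (hs.hasSum.pow 2) (Eventually.of_forall fun s => sum_abs_coef_sq_le u s hε)
  · have h := (basisH.hasSum_repr (daToH u)).mapL hToL2
    refine (isClosed_setOf_ae_norm_le _).mem_of_tendsto h (Eventually.of_forall fun s => ?_)
    have hk : ∀ k : Freq, ∀ᵐ x ∂cellMeasure,
        ‖hToL2 (basisH.repr (daToH u) k • basisH k) x‖ ≤ |coef k (daToH u)| := by
      intro k
      rw [HilbertBasis.repr_apply_apply, basisH_apply, map_smul, hToL2_waveH,
        real_inner_comm, ← coef_apply]
      filter_upwards [Lp.coeFn_smul (coef k (daToH u)) (harField (amp k) k.1),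
        coeFn_ofSmooth fun i => (isPeriodicTest_har k.1).const_mul (amp k i)] with x h1 h2
      rw [h1, Pi.smul_apply, harField, h2, norm_smul, Real.norm_eq_abs]
      exact mul_le_of_le_one_right (abs_nonneg _) (norm_field_har_le k x)
    have hsum : ∀ t : Finset Freq, ∀ᵐ x ∂cellMeasure,
        ‖(∑ k ∈ t, hToL2 (basisH.repr (daToH u) k • basisH k)) x‖ ≤
          ∑ k ∈ t, |coef k (daToH u)| := by
      classical
      intro t
      induction t using Finset.induction_on with
      | empty =>
        filter_upwards [Lp.coeFn_zero Plane 2 cellMeasure] with x hx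
        rw [Finset.sum_empty, Finset.sum_empty, hx, Pi.zero_apply, norm_zero]
      | insert k t hkt ih =>
        rw [Finset.sum_insert hkt, Finset.sum_insert hkt]
        filter_upwards [ih, hk k, Lp.coeFn_add (hToL2 (basisH.repr (daToH u) k • basisH k))
          (∑ k ∈ t, hToL2 (basisH.repr (daToH u) k • basisH k))] with x h1 h2 h3
        rw [h3, Pi.add_apply]
        exact (norm_add_le _ _).trans (add_le_add h2 h1)
    filter_upwards [hsum s] with x hx
    exact hx.trans (hs.sum_le_tsum s fun k _ => abs_nonneg _)

theorem norm_advection_le (u v : V) (x : Plane) :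
    ‖advection u v x‖ ≤ ‖hToL2 (vToH u) x‖ * (‖grad 0 v x‖ + ‖grad 1 v x‖) := by
  rw [advection, Fin.sum_univ_two, mul_add]
  refine (norm_add_le _ _).trans (add_le_add ?_ ?_) <;>
  · rw [norm_smul]
    exact mul_le_mul_of_nonneg_right (PiLp.norm_apply_le _ _) (norm_nonneg _)

theorem aestronglyMeasurable_advection (u v : V) :
    AEStronglyMeasurable (advection u v) cellMeasure := by
  refine Finset.aestronglyMeasurable_fun_sum _ fun j _ => ?_
  have h : AEStronglyMeasurable (fun x => hToL2 (vToH u) x j) cellMeasure :=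
    (EuclideanSpace.proj j : Plane →L[ℝ] ℝ).continuous.comp_aestronglyMeasurable
      (Lp.aestronglyMeasurable _)
  exact h.smul (Lp.aestronglyMeasurable _)

theorem memLp_advection_bound {u v : V} {M : ℝ} (hM : 0 ≤ M)
    (h : ∀ᵐ x ∂cellMeasure, ‖hToL2 (vToH u) x‖ ≤ M) :
    ∃ h : MemLp (advection u v) 2 cellMeasure, ‖h.toLp‖ ^ 2 ≤ 2 * M ^ 2 * gradSq v := by
  have hg : ∀ j, MemLp (fun x => ‖grad j v x‖) 2 cellMeasure := fun j => (Lp.memLp _).norm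
  have hG : MemLp (fun x => M * (‖grad 0 v x‖ + ‖grad 1 v x‖)) 2 cellMeasure :=
    ((hg 0).add (hg 1)).const_mul M
  have hle : ∀ᵐ x ∂cellMeasure,
      ‖advection u v x‖ ≤ ‖M * (‖grad 0 v x‖ + ‖grad 1 v x‖)‖ := by
    filter_upwards [h] with x hx
    rw [Real.norm_of_nonneg (by positivity)]
    exact (norm_advection_le u v x).trans (mul_le_mul_of_nonneg_right hx (by positivity))
  have hmem := hG.of_le (aestronglyMeasurable_advection u v) hle
  refine ⟨hmem, ?_⟩
  have h1 : ‖hmem.toLp‖ ≤ ‖M • ((hg 0).toLp + (hg 1).toLp)‖ := by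
    refine Lp.norm_le_norm_of_ae_le ?_
    filter_upwards [hle, hmem.coeFn_toLp, (hg 0).coeFn_toLp, (hg 1).coeFn_toLp,
      Lp.coeFn_smul M ((hg 0).toLp + (hg 1).toLp), Lp.coeFn_add (hg 0).toLp (hg 1).toLp]
      with x h1 h2 h3 h4 h5 h6
    rw [h2, h5, Pi.smul_apply, h6, Pi.add_apply, h3, h4]
    exact h1
  have h2 : ∀ j, ‖(hg j).toLp‖ = ‖grad j v‖ := by
    intro j
    rw [Lp.norm_toLp, eLpNorm_norm, Lp.norm_def]
  have h3 : ‖hmem.toLp‖ ≤ M * (‖grad 0 v‖ + ‖grad 1 v‖) := by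
    refine h1.trans ?_
    rw [norm_smul, Real.norm_of_nonneg hM, ← h2 0, ← h2 1]
    exact mul_le_mul_of_nonneg_left (norm_add_le _ _) hM
  calc ‖hmem.toLp‖ ^ 2 ≤ (M * (‖grad 0 v‖ + ‖grad 1 v‖)) ^ 2 := by gcongr
    _ ≤ 2 * M ^ 2 * gradSq v := by
      simp only [gradSq, Fin.sum_univ_two]
      nlinarith [mul_nonneg (sq_nonneg M) (sq_nonneg (‖grad 0 v‖ - ‖grad 1 v‖))]

theorem memLp_advection (u : DA) (v : V) : MemLp (advection (daToV u) v) 2 cellMeasure := by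
  obtain ⟨M, hM, -, h⟩ := exists_sup_bound u
  exact (memLp_advection_bound hM h).1

theorem bilin_eq (u v : DA) : bilin u v = leray (memLp_advection u (daToV v)).toLp := by
  rw [bilin, dif_pos (memLp_advection u (daToV v))]

/-- The fundamental bound on the convection term. -/
theorem norm_bilin_sq_le (u v : DA) {ε : ℝ} (hε : 0 < ε) :
    ‖bilin u v‖ ^ 2 ≤ 2 * agmonConst * (ε * ‖stokes u‖ ^ 2 + ε⁻¹ * gradSq (daToV u)) *
      gradSq (daToV v) := by
  obtain ⟨M, hM, hM', h⟩ := exists_sup_bound u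
  obtain ⟨h1, h2⟩ := memLp_advection_bound (u := daToV u) (v := daToV v) hM h
  rw [bilin_eq]
  calc ‖leray (memLp_advection u (daToV v)).toLp‖ ^ 2 ≤ ‖h1.toLp‖ ^ 2 := by
        gcongr; exact norm_leray_le _
    _ ≤ 2 * M ^ 2 * gradSq (daToV v) := h2
    _ ≤ _ := by
      rw [mul_assoc 2 agmonConst]
      gcongr
      · exact gradSq_nonneg _
      · exact hM' ε hε

theorem bilin_add_left (u u' v : DA) : bilin (u + u') v = bilin u v + bilin u' v := by
  rw [bilin_eq, bilin_eq, bilin_eq, ← map_add, ← MemLp.toLp_add]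
  congr 1
  refine MemLp.toLp_congr _ _ ?_
  filter_upwards [Lp.coeFn_add (hToL2 (daToH u)) (hToL2 (daToH u'))] with x hx
  have e : hToL2 (vToH (daToV (u + u'))) = hToL2 (daToH u) + hToL2 (daToH u') := by
    simp only [map_add, daToH, ContinuousLinearMap.comp_apply]
  simp only [advection, Pi.add_apply, e, hx, PiLp.add_apply, add_smul, Finset.sum_add_distrib]
  rfl

theorem bilin_smul_left (r : ℝ) (u v : DA) : bilin (r • u) v = r • bilin u v := by
  rw [bilin_eq, bilin_eq, ← map_smul, ← MemLp.toLp_const_smul]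
  congr 1
  refine MemLp.toLp_congr _ _ ?_
  filter_upwards [Lp.coeFn_smul r (hToL2 (daToH u))] with x hx
  have e : hToL2 (vToH (daToV (r • u))) = r • hToL2 (daToH u) := by
    simp only [map_smul, daToH, ContinuousLinearMap.comp_apply]
  simp only [advection, Pi.smul_apply, e, hx, PiLp.smul_apply, Finset.smul_sum, smul_smul,
    smul_eq_mul]
  rfl

theorem bilin_add_right (u v v' : DA) : bilin u (v + v') = bilin u v + bilin u v' := by
  rw [bilin_eq, bilin_eq, bilin_eq, ← map_add, ← MemLp.toLp_add]
  congr 1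
  refine MemLp.toLp_congr _ _ ?_
  filter_upwards [Lp.coeFn_add (grad 0 (daToV v)) (grad 0 (daToV v')),
    Lp.coeFn_add (grad 1 (daToV v)) (grad 1 (daToV v'))] with x h0 h1
  simp only [advection, Pi.add_apply, map_add, Fin.sum_univ_two, h0, h1, smul_add]
  abel

theorem bilin_smul_right (r : ℝ) (u v : DA) : bilin u (r • v) = r • bilin u v := by
  rw [bilin_eq, bilin_eq, ← map_smul, ← MemLp.toLp_const_smul]
  congr 1
  refine MemLp.toLp_congr _ _ ?_
  filter_upwards [Lp.coeFn_smul r (grad 0 (daToV v)),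
    Lp.coeFn_smul r (grad 1 (daToV v))] with x h0 h1
  simp only [advection, Pi.smul_apply, map_smul, Fin.sum_univ_two, h0, h1, smul_add,
    smul_comm r]

/-- The convection term as a bounded bilinear map on `D(A)`. -/
def bilinL : DA →L[ℝ] DA →L[ℝ] H :=
  LinearMap.mkContinuous₂
    (LinearMap.mk₂ ℝ bilin bilin_add_left bilin_smul_left bilin_add_right bilin_smul_right)
    (√(4 * agmonConst)) fun u v => by
      have hC := agmonConst_nonneg
      refine abs_le_of_sq_le_sq' ?_ (by positivity) |>.2
      rw [mul_pow, mul_pow, Real.sq_sqrt (by positivity), LinearMap.mk₂_apply]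
      have h := norm_bilin_sq_le u v one_pos
      rw [inv_one, one_mul, one_mul] at h
      have h1 : ‖stokes u‖ ^ 2 + gradSq (daToV u) ≤ 2 * ‖u‖ ^ 2 := by
        linarith [norm_sq_DA u, gradSq_le_norm_sq (daToV u), sq_nonneg ‖daToV u‖,
          sq_nonneg ‖stokes u‖]
      have h2 : gradSq (daToV v) ≤ ‖v‖ ^ 2 := by
        linarith [norm_sq_DA v, gradSq_le_norm_sq (daToV v), sq_nonneg ‖stokes v‖]
      calc _ ≤ _ := h
        _ ≤ 2 * agmonConst * (2 * ‖u‖ ^ 2) * ‖v‖ ^ 2 := by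
          gcongr
          exact gradSq_nonneg _
        _ = _ := by ring

theorem bilinL_apply (u v : DA) : bilinL u v = bilin u v := rfl

/-! ### The orthogonality of `B(u, u)` and `A u` -/

theorem IsPeriodicTest.hasDerivAt_line {φ : Plane → ℝ} (hφ : IsPeriodicTest φ) (j : Fin 2)
    (x : Plane) :
    HasDerivAt (fun s : ℝ => φ (x + s • EuclideanSpace.single j 1))
      (TorusNSE.partialDeriv j φ x) 0 := by
  have h1 : HasDerivAt (fun s : ℝ => x + s • (EuclideanSpace.single j 1 : Plane))
      (EuclideanSpace.single j 1) 0 := by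
    simpa using ((hasDerivAt_id (0 : ℝ)).smul_const
      (EuclideanSpace.single j 1 : Plane)).const_add x
  have h2 := (hφ.differentiable (x + (0 : ℝ) • (EuclideanSpace.single j 1 : Plane))).hasFDerivAt
  have h3 := h2.comp_hasDerivAt (0 : ℝ) h1
  rw [zero_smul, add_zero] at h3
  exact h3

theorem partialDeriv_comm {φ : Plane → ℝ} (hφ : IsPeriodicTest φ) (i j : Fin 2) (x : Plane) :
    partialDeriv i (partialDeriv j φ) x = partialDeriv j (partialDeriv i φ) x := by
  have hd : DifferentiableAt ℝ (fderiv ℝ φ) x :=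
    (hφ.smooth.fderiv_right (m := ∞) (by simp)).differentiable (by simp) x
  have e : ∀ i j : Fin 2, partialDeriv i (partialDeriv j φ) x =
      fderiv ℝ (fderiv ℝ φ) x (EuclideanSpace.single i 1) (EuclideanSpace.single j 1) := by
    intro i j
    have h := hd.hasFDerivAt.clm_apply
      (hasFDerivAt_const (EuclideanSpace.single j (1 : ℝ) : Plane) x)
    have h' : fderiv ℝ (partialDeriv j φ) x = _ := h.fderiv
    rw [partialDeriv, h']
    simp
  rw [e, e]
  have hs : IsSymmSndFDerivAt ℝ φ x :=
    (hφ.smooth.contDiffAt).isSymmSndFDerivAt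
      (by simpa using (ENat.LEInfty.out : (2 : WithTop ℕ∞) ≤ (∞ : ℕ∞ω)))
  exact hs _ _

/-- The pointwise identity behind the orthogonality of `B(u, u)` and `A u`. With the vorticity
`ω = ∂₀b - ∂₁a` of the solenoidal field `(a, b)`, one has `Δa = -∂₁ω`, `Δb = ∂₀ω` and
`u · ∇u = ∇|u|²/2 + ω(-b, a)`, so that the integrand is a divergence. -/
theorem integral_convection_mul_laplacian {a b : Plane → ℝ} (ha : IsPeriodicTest a)
    (hb : IsPeriodicTest b) (hdiv : ∀ x, partialDeriv 0 a x + partialDeriv 1 b x = 0) :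
    ∫ x, ((a x * partialDeriv 0 a x + b x * partialDeriv 1 a x) *
        (partialDeriv 0 (partialDeriv 0 a) x + partialDeriv 1 (partialDeriv 1 a) x) +
      (a x * partialDeriv 0 b x + b x * partialDeriv 1 b x) *
        (partialDeriv 0 (partialDeriv 0 b) x + partialDeriv 1 (partialDeriv 1 b) x))
      ∂cellMeasure = 0 := by
  have ha0 := ha.partialDeriv 0
  have ha1 := ha.partialDeriv 1
  have hb0 := hb.partialDeriv 0
  have hb1 := hb.partialDeriv 1
  have hω : IsPeriodicTest fun x => partialDeriv 0 b x + (-1) * partialDeriv 1 a x :=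
    hb0.add (ha1.const_mul (-1))
  have hq1 : IsPeriodicTest fun x => a x * partialDeriv 1 a x + b x * partialDeriv 1 b x :=
    (ha.mul ha1).add (hb.mul hb1)
  have hq0 : IsPeriodicTest fun x => a x * partialDeriv 0 a x + b x * partialDeriv 0 b x :=
    (ha.mul ha0).add (hb.mul hb0)
  have hP := ((ha.mul (hω.mul hω)).const_mul (1 / 2)).add (hω.mul hq1)
  have hQ := ((hb.mul (hω.mul hω)).const_mul (1 / 2)).add ((hω.mul hq0).const_mul (-1))
  have key := integral_add (integrable_cell_of_continuous (continuous_partialDeriv hP 0))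
    (integrable_cell_of_continuous (continuous_partialDeriv hQ 1))
  rw [integral_partialDeriv hP, integral_partialDeriv hQ, add_zero] at key
  rw [← key]
  refine integral_congr_ae (Eventually.of_forall fun x => ?_)
  have line := fun (φ : Plane → ℝ) (hφ : IsPeriodicTest φ) (j : Fin 2) => hφ.hasDerivAt_line j x
  have lω := fun j => (line _ hb0 j).add ((line _ ha1 j).const_mul (-1))
  have lP := ((((line _ ha 0).mul ((lω 0).mul (lω 0))).const_mul (1 / 2)).add
    ((lω 0).mul (((line _ ha 0).mul (line _ ha1 0)).add ((line _ hb 0).mul (line _ hb1 0)))))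
  have lQ := ((((line _ hb 1).mul ((lω 1).mul (lω 1))).const_mul (1 / 2)).add
    (((lω 1).mul (((line _ ha 1).mul (line _ ha0 1)).add
      ((line _ hb 1).mul (line _ hb0 1)))).const_mul (-1)))
  have eP := (line _ hP 0).unique lP
  have eQ := (line _ hQ 1).unique lQ
  have hd1 : partialDeriv 1 b = fun x => (-1) * partialDeriv 0 a x := by
    funext y
    linarith [hdiv y]
  have d0 : partialDeriv 0 (partialDeriv 1 b) x = - partialDeriv 0 (partialDeriv 0 a) x := by
    rw [hd1, partialDeriv_const_mul _ ha0]; ring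
  have d1 : partialDeriv 1 (partialDeriv 1 b) x = - partialDeriv 1 (partialDeriv 0 a) x := by
    rw [hd1, partialDeriv_const_mul _ ha0]; ring
  have c1 := partialDeriv_comm ha 1 0 x
  have c2 := partialDeriv_comm hb 1 0 x
  simp only
  rw [eP, eQ]
  simp only [Pi.mul_apply, Pi.add_apply, zero_smul, add_zero]
  have hdx := hdiv x
  rw [d1, c2, d0, c1]
  rw [show partialDeriv 1 b x = - partialDeriv 0 a x by linarith]
  ring

/-- `φ` is a smooth solenoidal periodic representative of `u`, its classical derivatives represent
the weak derivatives of `u`, and `Δu` is again in `𝐇`. -/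
def IsSmoothField (u : DA) (φ : Fin 2 → Plane → ℝ) : Prop :=
  (∀ i, IsPeriodicTest (φ i)) ∧ (∀ x, partialDeriv 0 (φ 0) x + partialDeriv 1 (φ 1) x = 0) ∧
  laplacian u ∈ solenoidal ∧
  hToL2 (daToH u) =ᵐ[cellMeasure] field φ ∧
  (∀ j, grad j (daToV u) =ᵐ[cellMeasure] field fun i => partialDeriv j (φ i)) ∧
  ∀ j k, hess j k u =ᵐ[cellMeasure] field fun i => partialDeriv j (partialDeriv k (φ i))

theorem field_add (φ ψ : Fin 2 → Plane → ℝ) (x : Plane) :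
    field φ x + field ψ x = field (fun i x => φ i x + ψ i x) x := rfl

theorem field_smul (r : ℝ) (φ : Fin 2 → Plane → ℝ) (x : Plane) :
    r • field φ x = field (fun i x => r * φ i x) x := rfl

theorem laplacian_add (u v : DA) : laplacian (u + v) = laplacian u + laplacian v := by
  simp [laplacian, Finset.sum_add_distrib]

theorem laplacian_smul (r : ℝ) (u : DA) : laplacian (r • u) = r • laplacian u := by
  simp [laplacian]

theorem IsSmoothField.add {u v : DA} {φ ψ : Fin 2 → Plane → ℝ} (hu : IsSmoothField u φ)
    (hv : IsSmoothField v ψ) : IsSmoothField (u + v) fun i x => φ i x + ψ i x := by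
  obtain ⟨u1, u2, u3, u4, u5, u6⟩ := hu
  obtain ⟨v1, v2, v3, v4, v5, v6⟩ := hv
  have e1 : ∀ j i, partialDeriv j (fun x => φ i x + ψ i x) =
      fun x => partialDeriv j (φ i) x + partialDeriv j (ψ i) x := fun j i =>
    funext fun x => partialDeriv_add (u1 i) (v1 i) j x
  have e2 : ∀ k j i, partialDeriv k (partialDeriv j (fun x => φ i x + ψ i x)) =
      fun x => partialDeriv k (partialDeriv j (φ i)) x +
        partialDeriv k (partialDeriv j (ψ i)) x := fun k j i => by
    rw [e1]
    exact funext fun x => partialDeriv_add ((u1 i).partialDeriv j) ((v1 i).partialDeriv j) k x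
  refine ⟨fun i => (u1 i).add (v1 i), fun x => ?_, ?_, ?_, fun j => ?_, fun j k => ?_⟩
  · simp only [e1]
    linarith [u2 x, v2 x]
  · rw [laplacian_add]
    exact add_mem u3 v3
  · rw [map_add, map_add]
    filter_upwards [u4, v4, Lp.coeFn_add (hToL2 (daToH u)) (hToL2 (daToH v))] with x h1 h2 h3
    rw [h3, Pi.add_apply, h1, h2, field_add]
  · rw [map_add, map_add]
    simp only [e1]
    filter_upwards [u5 j, v5 j, Lp.coeFn_add (grad j (daToV u)) (grad j (daToV v))] with x h1 h2 h3
    rw [h3, Pi.add_apply, h1, h2, field_add]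
  · rw [map_add]
    simp only [e2]
    filter_upwards [u6 j k, v6 j k, Lp.coeFn_add (hess j k u) (hess j k v)] with x h1 h2 h3
    rw [h3, Pi.add_apply, h1, h2, field_add]

theorem IsSmoothField.smul {u : DA} {φ : Fin 2 → Plane → ℝ} (r : ℝ) (hu : IsSmoothField u φ) :
    IsSmoothField (r • u) fun i x => r * φ i x := by
  obtain ⟨u1, u2, u3, u4, u5, u6⟩ := hu
  have e1 : ∀ j i, partialDeriv j (fun x => r * φ i x) =
      fun x => r * partialDeriv j (φ i) x := fun j i =>
    funext fun x => partialDeriv_const_mul r (u1 i) j x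
  have e2 : ∀ k j i, partialDeriv k (partialDeriv j (fun x => r * φ i x)) =
      fun x => r * partialDeriv k (partialDeriv j (φ i)) x := fun k j i => by
    rw [e1]
    exact funext fun x => partialDeriv_const_mul r ((u1 i).partialDeriv j) k x
  refine ⟨fun i => (u1 i).const_mul r, fun x => ?_, ?_, ?_, fun j => ?_, fun j k => ?_⟩
  · simp only [e1]
    linear_combination r * u2 x
  · rw [laplacian_smul]
    exact Submodule.smul_mem _ r u3
  · rw [map_smul, map_smul]
    filter_upwards [u4, Lp.coeFn_smul r (hToL2 (daToH u))] with x h1 h3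
    rw [h3, Pi.smul_apply, h1, field_smul]
  · rw [map_smul, map_smul]
    simp only [e1]
    filter_upwards [u5 j, Lp.coeFn_smul r (grad j (daToV u))] with x h1 h3
    rw [h3, Pi.smul_apply, h1, field_smul]
  · rw [map_smul]
    simp only [e2]
    filter_upwards [u6 j k, Lp.coeFn_smul r (hess j k u)] with x h1 h3
    rw [h3, Pi.smul_apply, h1, field_smul]

theorem isSmoothField_waveDA (k : Freq) :
    IsSmoothField (waveDA k) fun i x => amp k i * har k.1 x := by
  have e1 : ∀ j i, partialDeriv j (fun x => amp k i * har k.1 x) =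
      fun x => (k.1 j • amp k) i * har (-k.1) x := fun j i =>
    congrFun (partialDeriv_har_eq (amp k) k.1 j) i
  have e2 : ∀ j l i, partialDeriv j (partialDeriv l fun x => amp k i * har k.1 x) =
      fun x => ((-k.1) j • k.1 l • amp k) i * har (- -k.1) x := fun j l i => by
    rw [e1]
    exact congrFun (partialDeriv_har_eq (k.1 l • amp k) (-k.1) j) i
  refine ⟨fun i => (isPeriodicTest_har k.1).const_mul _, fun x => ?_, ?_, ?_, fun j => ?_,
    fun j l => ?_⟩
  · have := sum_amp_mul_freq k
    simp only [Fin.sum_univ_two] at this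
    simp only [e1, Pi.smul_apply, zsmul_eq_mul]
    linear_combination har (-k.1) x * this
  · have e : laplacian (waveDA k) = (-lam k) • hToL2 (waveH k) := by
      simp only [laplacian, hess_waveDA, harField_zsmul, neg_neg, Fin.sum_univ_two, hToL2_waveH,
        smul_smul, ← add_smul, lam]
      congr 1
      push_cast [Pi.neg_apply]
      ring
    rw [e]
    exact Submodule.smul_mem _ _ (harField_amp_mem k)
  · rw [daToH_waveDA, hToL2_waveH]
    exact coeFn_ofSmooth _
  · rw [daToV_waveDA, grad_waveV]
    simp only [e1]
    exact coeFn_ofSmooth _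
  · rw [hess_waveDA]
    simp only [e2]
    exact coeFn_ofSmooth _

theorem inner_bilin_stokes_of_isSmoothField {u : DA} {φ : Fin 2 → Plane → ℝ}
    (h : IsSmoothField u φ) : inner ℝ (bilin u u) (stokes u) = 0 := by
  obtain ⟨u1, u2, u3, u4, u5, u6⟩ := h
  have hl : hToL2 (leray (laplacian u)) = laplacian u := by
    have : leray (laplacian u) = (⟨laplacian u, u3⟩ : ↥solenoidal) :=
      Submodule.orthogonalProjectionOnto_mem_subspace_eq_self (K := solenoidal)
        ⟨laplacian u, u3⟩
    rw [this]
    rfl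
  rw [bilin_eq, stokes, inner_neg_right, inner_leray, hl, neg_eq_zero, L2.inner_def]
  have hlap : laplacian u = hess 0 0 u + hess 1 1 u := by simp [laplacian]
  rw [hlap]
  refine Eq.trans (integral_congr_ae ?_)
    (integral_convection_mul_laplacian (u1 0) (u1 1) u2)
  filter_upwards [(memLp_advection u (daToV u)).coeFn_toLp, u4, u5 0, u5 1, u6 0 0, u6 1 1,
    Lp.coeFn_add (hess 0 0 u) (hess 1 1 u)] with x h1 h2 h3 h4 h5 h6 h7
  have h2' : hToL2 (vToH (daToV u)) x = field φ x := h2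
  rw [h1, h7, Pi.add_apply, h5, h6, advection, Fin.sum_univ_two, h2', h3, h4]
  simp [field, PiLp.inner_apply]
  ring

/-- In dimension two with periodic boundary conditions, `⟨B(u, u), A u⟩ = 0`. The
expression is continuous on `D(A)`, so it suffices to treat finite sums of eigenfunctions, for
which this is `integral_convection_mul_laplacian`. -/
theorem inner_bilin_stokes (u : DA) : inner ℝ (bilin u u) (stokes u) = 0 := by
  have hcl : IsClosed {u : DA | inner ℝ (bilin u u) (stokes u) = 0} := by
    simp only [← bilinL_apply, ← stokesL_apply]
    refine isClosed_eq (Continuous.inner ?_ stokesL.continuous) continuous_const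
    exact bilinL.continuous.clm_apply continuous_id
  refine hcl.closure_subset_iff.2 ?_ (parseval_DA.1 u)
  intro v hv
  have : ∃ φ, IsSmoothField v φ := by
    induction hv using Submodule.span_induction with
    | mem v hv =>
      obtain ⟨k, rfl⟩ := hv
      exact ⟨_, isSmoothField_waveDA k⟩
    | zero =>
      have h := (isSmoothField_waveDA ⟨fun _ => 1, fun h => one_ne_zero (congrFun h 0)⟩).smul 0
      rw [zero_smul] at h
      exact ⟨_, h⟩
    | add v w _ _ hv hw =>
      obtain ⟨φ, hφ⟩ := hv
      obtain ⟨ψ, hψ⟩ := hw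
      exact ⟨_, hφ.add hψ⟩
    | smul r v _ hv =>
      obtain ⟨φ, hφ⟩ := hv
      exact ⟨_, hφ.smul r⟩
  obtain ⟨φ, hφ⟩ := this
  exact inner_bilin_stokes_of_isSmoothField hφ

/-! ### Absolutely continuous functions of time -/

theorem _root_.AbsolutelyContinuousOnInterval.lipschitz_comp {f g : ℝ → ℝ} {a b : ℝ} {L : ℝ≥0}
    (hf : AbsolutelyContinuousOnInterval f a b) (hg : LipschitzOnWith L g (f '' uIcc a b)) :
    AbsolutelyContinuousOnInterval (fun x => g (f x)) a b := by
  rw [absolutelyContinuousOnInterval_iff] at hf ⊢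
  intro ε hε
  obtain ⟨η, hη, h⟩ := hf (ε / (L + 1)) (by positivity)
  refine ⟨η, hη, fun E hE hs => ?_⟩
  have h1 := h E hE hs
  have hmem : ∀ i ∈ Finset.range E.1, (E.2 i).1 ∈ uIcc a b ∧ (E.2 i).2 ∈ uIcc a b := hE.1
  calc ∑ i ∈ Finset.range E.1, dist (g (f (E.2 i).1)) (g (f (E.2 i).2))
      ≤ ∑ i ∈ Finset.range E.1, L * dist (f (E.2 i).1) (f (E.2 i).2) :=
        Finset.sum_le_sum fun i hi => hg.dist_le_mul _ (mem_image_of_mem f (hmem i hi).1) _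
          (mem_image_of_mem f (hmem i hi).2)
    _ = L * ∑ i ∈ Finset.range E.1, dist (f (E.2 i).1) (f (E.2 i).2) := by rw [Finset.mul_sum]
    _ ≤ L * (ε / (L + 1)) := by gcongr
    _ < ε := by
      rw [mul_div_assoc', div_lt_iff₀ (by positivity)]
      nlinarith

theorem lipschitzOnWith_exp_neg (B : ℝ) :
    LipschitzOnWith (Real.toNNReal (Real.exp B)) (fun x => Real.exp (-x)) (Ici (-B)) := by
  have hd : ∀ x ∈ Ici (-B), HasDerivWithinAt (fun x => Real.exp (-x)) (Real.exp (-x) * (-1))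
      (Ici (-B)) x := fun x _ => ((hasDerivAt_neg x).exp).hasDerivWithinAt
  refine (convex_Ici (-B)).lipschitzOnWith_of_nnnorm_hasDerivWithin_le hd fun x hx => ?_
  rw [← NNReal.coe_le_coe, coe_nnnorm, Real.coe_toNNReal _ (Real.exp_pos _).le, mul_neg, mul_one,
    norm_neg, Real.norm_eq_abs, Real.abs_exp]
  exact Real.exp_le_exp.2 (neg_le.1 hx)

theorem _root_.AbsolutelyContinuousOnInterval.exp_neg {f : ℝ → ℝ} {a b : ℝ}
    (hf : AbsolutelyContinuousOnInterval f a b) :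
    AbsolutelyContinuousOnInterval (fun x => Real.exp (-f x)) a b := by
  obtain ⟨B, hB⟩ := hf.exists_bound
  refine hf.lipschitz_comp (g := fun x => Real.exp (-x))
    ((lipschitzOnWith_exp_neg B).mono ?_)
  rintro _ ⟨s, hs, rfl⟩
  have h1 := hB s hs
  rw [Real.norm_eq_abs] at h1
  exact (abs_le.1 h1).1

/-- Integrated form of the product rule for `e^{-Φ} c²`, where `Φ' = ψ` and `c' = p`. -/
theorem integral_exp_weight_sq {p ψ : ℝ → ℝ} {t : ℝ} (c₀ : ℝ)
    (hp : IntervalIntegrable p volume 0 t) (hψ : IntervalIntegrable ψ volume 0 t) :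
    ∫ s in (0 : ℝ)..t, Real.exp (-∫ r in (0 : ℝ)..s, ψ r) *
      (2 * (c₀ + ∫ r in (0 : ℝ)..s, p r) * p s - ψ s * (c₀ + ∫ r in (0 : ℝ)..s, p r) ^ 2) =
    Real.exp (-∫ r in (0 : ℝ)..t, ψ r) * (c₀ + ∫ r in (0 : ℝ)..t, p r) ^ 2 - c₀ ^ 2 := by
  have h0 : (0 : ℝ) ∈ uIcc 0 t := left_mem_uIcc
  have aΦ := hψ.absolutelyContinuousOnInterval_intervalIntegral h0
  have aE := aΦ.exp_neg
  have aP := hp.absolutelyContinuousOnInterval_intervalIntegral h0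
  have ac : AbsolutelyContinuousOnInterval (fun s => c₀ + ∫ r in (0 : ℝ)..s, p r) 0 t := by
    refine aP.lipschitz_comp (g := fun x => c₀ + x) (L := 1) ?_
    exact (LipschitzWith.of_dist_le_mul fun x y => by simp).lipschitzOnWith
  have aF := aE.mul (ac.mul ac)
  have key := aF.integral_deriv_eq_sub
  simp only [Pi.mul_apply, intervalIntegral.integral_same, neg_zero, Real.exp_zero, one_mul,
    add_zero] at key
  rw [sq, sq, ← key]
  refine intervalIntegral.integral_congr_ae ?_
  filter_upwards [hψ.ae_hasDerivAt_integral, hp.ae_hasDerivAt_integral] with s h1 h2 hs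
  have hs' := uIoc_subset_uIcc hs
  have d1 := ((h1 hs' 0 h0).neg.exp)
  have d2 := (h2 hs' 0 h0).const_add c₀
  have d := d1.mul (d2.mul d2)
  refine Eq.trans ?_ d.deriv.symm
  simp only [Pi.neg_apply, Pi.mul_apply]
  ring

/-! ### Integration on `[0, T]` -/

section Time

variable {T : ℝ} {E : Type*} [NormedAddCommGroup E]

theorem intervalIntegrable_of_time {f : ℝ → E} (hf : Integrable f (timeMeasure T)) {t : ℝ}
    (ht : t ∈ Icc 0 T) : IntervalIntegrable f volume 0 t := by
  rw [intervalIntegrable_iff_integrableOn_Ioc_of_le ht.1]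
  exact IntegrableOn.mono_set hf ((Ioc_subset_Icc_self).trans (Icc_subset_Icc_right ht.2))

theorem ae_Ioc_of_time {p : ℝ → Prop} (h : ∀ᵐ s ∂(timeMeasure T), p s) {t : ℝ}
    (ht : t ∈ Icc 0 T) : ∀ᵐ s ∂(volume.restrict (Ioc 0 t)), p s :=
  ae_mono (Measure.restrict_mono ((Ioc_subset_Icc_self).trans (Icc_subset_Icc_right ht.2)) le_rfl) h

theorem ae_mem_time : ∀ᵐ s ∂(timeMeasure T), s ∈ Icc 0 T :=
  ae_restrict_mem measurableSet_Icc

variable [NormedSpace ℝ E]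

theorem integral_congr_time {f g : ℝ → E} (h : ∀ᵐ s ∂(timeMeasure T), f s = g s) {t : ℝ}
    (ht : t ∈ Icc 0 T) : ∫ s in (0 : ℝ)..t, f s = ∫ s in (0 : ℝ)..t, g s := by
  rw [intervalIntegral.integral_of_le ht.1, intervalIntegral.integral_of_le ht.1]
  exact integral_congr_ae (ae_Ioc_of_time h ht)

theorem integral_time_eq (hT : 0 ≤ T) (f : ℝ → E) :
    ∫ s, f s ∂(timeMeasure T) = ∫ s in (0 : ℝ)..T, f s := by
  rw [timeMeasure, integral_Icc_eq_integral_Ioc, intervalIntegral.integral_of_le hT]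

theorem integral_mono_time {f g : ℝ → ℝ} (hf : Integrable f (timeMeasure T))
    (hg : Integrable g (timeMeasure T)) (h : ∀ᵐ s ∂(timeMeasure T), f s ≤ g s) {t : ℝ}
    (ht : t ∈ Icc 0 T) : ∫ s in (0 : ℝ)..t, f s ≤ ∫ s in (0 : ℝ)..t, g s := by
  rw [intervalIntegral.integral_of_le ht.1, intervalIntegral.integral_of_le ht.1]
  exact integral_mono_ae (intervalIntegrable_of_time hf ht).1
    (intervalIntegrable_of_time hg ht).1 (ae_Ioc_of_time h ht)

theorem integral_le_integral_time {f : ℝ → ℝ} (hf : Integrable f (timeMeasure T))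
    (h : ∀ᵐ s ∂(timeMeasure T), 0 ≤ f s) {t : ℝ} (ht : t ∈ Icc 0 T) :
    ∫ s in (0 : ℝ)..t, f s ≤ ∫ s, f s ∂(timeMeasure T) := by
  rw [intervalIntegral.integral_of_le ht.1]
  exact setIntegral_mono_set hf h
    ((Ioc_subset_Icc_self.trans (Icc_subset_Icc_right ht.2)).eventuallyLE)

theorem integral_nonneg_time {f : ℝ → ℝ} (h : ∀ᵐ s ∂(timeMeasure T), 0 ≤ f s) {t : ℝ}
    (ht : t ∈ Icc 0 T) : 0 ≤ ∫ s in (0 : ℝ)..t, f s := by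
  rw [intervalIntegral.integral_of_le ht.1]
  exact integral_nonneg_of_ae (ae_Ioc_of_time h ht)

theorem integrable_norm_sq {X : Type*} [NormedAddCommGroup X] (f : L2Time T X) :
    Integrable (fun s => ‖f s‖ ^ 2) (timeMeasure T) :=
  (Lp.memLp f).norm.integrable_sq

theorem integral_norm_sq {X : Type*} [NormedAddCommGroup X] [InnerProductSpace ℝ X]
    (f : L2Time T X) : ∫ s, ‖f s‖ ^ 2 ∂(timeMeasure T) = ‖f‖ ^ 2 := by
  rw [← real_inner_self_eq_norm_sq, L2.inner_def]
  simp only [real_inner_self_eq_norm_sq]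

theorem measureReal_time (hT : 0 ≤ T) : (timeMeasure T).real univ = T := by
  rw [timeMeasure, measureReal_restrict_apply_univ, measureReal_def, Real.volume_Icc, sub_zero,
    ENNReal.toReal_ofReal hT]

end Time

/-! ### The linear Stokes evolution and its energy identity -/

/-- `y` solves `y' + A y = f`, `y(0) = ξ`. -/
def IsLinSol {T : ℝ} (ξ : V) (f : L2Time T H) (y : StrongPath T) : Prop :=
  ∀ t : Icc (0 : ℝ) T, y.val t = vToH ξ + ∫ s in (0 : ℝ)..t, (f s - stokes (y.reg s))

section Energy

variable {T : ℝ}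

theorem StrongPath.ae_eq (y : StrongPath T) : ∀ᵐ t ∂(timeMeasure T), ∀ ht : t ∈ Icc 0 T,
    daToV (y.reg t) = y.1.1 ⟨t, ht⟩ := y.2

theorem StrongPath.norm_path_le (y : StrongPath T) : ‖y.1.1‖ ≤ ‖y‖ := norm_fst_le y.1

theorem StrongPath.norm_reg_le (y : StrongPath T) : ‖y.1.2‖ ≤ ‖y‖ := norm_snd_le y.1

theorem StrongPath.norm_apply_le (y : StrongPath T) (t : Icc (0 : ℝ) T) : ‖y.1.1 t‖ ≤ ‖y‖ :=
  (y.1.1.norm_coe_le_norm t).trans y.norm_path_le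

theorem StrongPath.gradSq_le (y : StrongPath T) (t : Icc (0 : ℝ) T) :
    gradSq (y.1.1 t) ≤ ‖y‖ ^ 2 :=
  (gradSq_le_norm_sq _).trans (by gcongr; exact y.norm_apply_le t)

theorem StrongPath.ae_gradSq_le (y : StrongPath T) : ∀ᵐ t ∂(timeMeasure T),
    gradSq (daToV (y.reg t)) ≤ ‖y‖ ^ 2 := by
  filter_upwards [y.ae_eq, ae_mem_time] with t h ht
  rw [h ht]
  exact y.gradSq_le _

theorem StrongPath.aestronglyMeasurable_reg (y : StrongPath T) :
    AEStronglyMeasurable y.reg (timeMeasure T) := Lp.aestronglyMeasurable y.1.2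

theorem StrongPath.memLp_reg (y : StrongPath T) : MemLp y.reg 2 (timeMeasure T) :=
  Lp.memLp y.1.2

theorem StrongPath.memLp_stokes (y : StrongPath T) :
    MemLp (fun s => stokes (y.reg s)) 2 (timeMeasure T) := by
  simp only [← stokesL_apply]
  exact stokesL.comp_memLp' y.memLp_reg

theorem StrongPath.integrable_stokes_sq (y : StrongPath T) :
    Integrable (fun s => ‖stokes (y.reg s)‖ ^ 2) (timeMeasure T) :=
  y.memLp_stokes.norm.integrable_sq

theorem StrongPath.integral_stokes_sq_le (y : StrongPath T) :
    ∫ s, ‖stokes (y.reg s)‖ ^ 2 ∂(timeMeasure T) ≤ ‖y‖ ^ 2 := by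
  calc ∫ s, ‖stokes (y.reg s)‖ ^ 2 ∂(timeMeasure T)
      ≤ ∫ s, ‖y.1.2 s‖ ^ 2 ∂(timeMeasure T) := by
        refine integral_mono y.integrable_stokes_sq (integrable_norm_sq y.1.2) fun s => ?_
        have := norm_stokes_le (y.reg s)
        simp only
        gcongr
        exact this
    _ = ‖y.1.2‖ ^ 2 := integral_norm_sq _
    _ ≤ ‖y‖ ^ 2 := by gcongr; exact y.norm_reg_le

theorem StrongPath.aestronglyMeasurable_gradSq (y : StrongPath T) :
    AEStronglyMeasurable (fun s => gradSq (daToV (y.reg s))) (timeMeasure T) :=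
  (continuous_gradSq.comp daToV.continuous).comp_aestronglyMeasurable y.aestronglyMeasurable_reg

theorem StrongPath.integrable_mul_gradSq (y : StrongPath T) {ψ : ℝ → ℝ}
    (hψ : Integrable ψ (timeMeasure T)) :
    Integrable (fun s => ψ s * gradSq (daToV (y.reg s))) (timeMeasure T) := by
  refine hψ.mul_bdd (c := ‖y‖ ^ 2) y.aestronglyMeasurable_gradSq ?_
  filter_upwards [y.ae_gradSq_le] with s hs
  rwa [Real.norm_of_nonneg (gradSq_nonneg _)]

theorem integrable_lin_rhs (f : L2Time T H) (y : StrongPath T) :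
    Integrable (fun s => f s - stokes (y.reg s)) (timeMeasure T) :=
  ((Lp.memLp f).sub y.memLp_stokes).integrable (by norm_num)

theorem integrable_inner_stokes (f : L2Time T H) (y : StrongPath T) :
    Integrable (fun s => inner ℝ (f s) (stokes (y.reg s))) (timeMeasure T) :=
  by
  refine Integrable.mono' ((integrable_norm_sq f).add y.integrable_stokes_sq)
    ((Lp.aestronglyMeasurable f).inner y.memLp_stokes.1) (Eventually.of_forall fun s => ?_)
  simp only [Pi.add_apply]
  nlinarith [norm_inner_le_norm (𝕜 := ℝ) (f s) (stokes (y.reg s)), norm_nonneg (f s),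
    norm_nonneg (stokes (y.reg s)), sq_nonneg (‖f s‖ - ‖stokes (y.reg s)‖)]

theorem exp_neg_primitive_le_one {ψ : ℝ → ℝ} (hψ0 : ∀ᵐ s ∂(timeMeasure T), 0 ≤ ψ s) {t : ℝ}
    (ht : t ∈ Icc 0 T) : Real.exp (-∫ r in (0 : ℝ)..t, ψ r) ≤ 1 := by
  rw [Real.exp_le_one_iff, neg_nonpos]
  exact integral_nonneg_time hψ0 ht

theorem exp_neg_integral_le {ψ : ℝ → ℝ} (hψ : Integrable ψ (timeMeasure T))
    (hψ0 : ∀ᵐ s ∂(timeMeasure T), 0 ≤ ψ s) {t : ℝ} (ht : t ∈ Icc 0 T) :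
    Real.exp (-∫ r, ψ r ∂(timeMeasure T)) ≤ Real.exp (-∫ r in (0 : ℝ)..t, ψ r) := by
  rw [Real.exp_le_exp, neg_le_neg_iff]
  exact integral_le_integral_time hψ hψ0 ht

theorem aestronglyMeasurable_weight {ψ : ℝ → ℝ} (hψ : Integrable ψ (timeMeasure T)) :
    AEStronglyMeasurable (fun s => Real.exp (-∫ r in (0 : ℝ)..s, ψ r)) (timeMeasure T) := by
  have hc : ContinuousOn (fun t : ℝ => ∫ r in (0 : ℝ)..t, ψ r) (Icc 0 T) := by
    refine (intervalIntegral.continuousOn_primitive hψ).congr fun t ht => ?_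
    exact intervalIntegral.integral_of_le ht.1
  exact (Real.continuous_exp.comp_continuousOn hc.neg).aestronglyMeasurable measurableSet_Icc

theorem integrable_weight_mul {ψ : ℝ → ℝ} (hψ : Integrable ψ (timeMeasure T))
    (hψ0 : ∀ᵐ s ∂(timeMeasure T), 0 ≤ ψ s) {g : ℝ → ℝ} (hg : Integrable g (timeMeasure T)) :
    Integrable (fun s => Real.exp (-∫ r in (0 : ℝ)..s, ψ r) * g s) (timeMeasure T) := by
  refine hg.bdd_mul (c := 1) (aestronglyMeasurable_weight hψ) ?_
  filter_upwards [ae_mem_time] with s hs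
  rw [Real.norm_of_nonneg (Real.exp_pos _).le]
  exact exp_neg_primitive_le_one hψ0 hs

theorem coef_hasSum_inner (u v : H) : HasSum (fun k => coef k u * coef k v) (inner ℝ u v) := by
  refine (basisH.hasSum_inner_mul_inner u v).congr_fun fun k => ?_
  rw [basisH_apply, coef_apply, coef_apply, real_inner_comm v]

/-- The weighted energy identity for the eigencomponent of frequency `k`. -/
theorem IsLinSol.coef_identity {ξ : V} {f : L2Time T H} {y : StrongPath T} (h : IsLinSol ξ f y)
    {ψ : ℝ → ℝ} (hψ : Integrable ψ (timeMeasure T)) (t : Icc (0 : ℝ) T) (k : Freq) :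
    ∫ s in (0 : ℝ)..t, Real.exp (-∫ r in (0 : ℝ)..s, ψ r) *
      (ψ s * (lam k * coef k (daToH (y.reg s)) ^ 2) +
        2 * (lam k ^ 2 * coef k (daToH (y.reg s)) ^ 2) -
        2 * (coef k (f s) * coef k (stokes (y.reg s)))) =
    lam k * coef k (vToH ξ) ^ 2 -
      Real.exp (-∫ r in (0 : ℝ)..t, ψ r) * (lam k * coef k (vToH (y.1.1 t)) ^ 2) := by
  have hint := integrable_lin_rhs f y
  have hp : Integrable (fun s => coef k (f s - stokes (y.reg s))) (timeMeasure T) :=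
    (coef k).integrable_comp hint
  have hc : ∀ s : Icc (0 : ℝ) T, coef k (vToH (y.1.1 s)) =
      coef k (vToH ξ) + ∫ r in (0 : ℝ)..s, coef k (f r - stokes (y.reg r)) := by
    intro s
    have h1 : vToH (y.1.1 s) = vToH ξ + ∫ r in (0 : ℝ)..s, (f r - stokes (y.reg r)) := h s
    rw [h1, map_add, (coef k).intervalIntegral_comp_comm (intervalIntegrable_of_time hint s.2)]
  have key := integral_exp_weight_sq (coef k (vToH ξ)) (intervalIntegrable_of_time hp t.2)
    (intervalIntegrable_of_time hψ t.2)
  rw [← hc t] at key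
  have e : ∫ s in (0 : ℝ)..t, Real.exp (-∫ r in (0 : ℝ)..s, ψ r) *
      (ψ s * (lam k * coef k (daToH (y.reg s)) ^ 2) +
        2 * (lam k ^ 2 * coef k (daToH (y.reg s)) ^ 2) -
        2 * (coef k (f s) * coef k (stokes (y.reg s)))) =
      ∫ s in (0 : ℝ)..t, (-lam k) * (Real.exp (-∫ r in (0 : ℝ)..s, ψ r) *
      (2 * (coef k (vToH ξ) + ∫ r in (0 : ℝ)..s, coef k (f r - stokes (y.reg r))) *
        coef k (f s - stokes (y.reg s)) -
        ψ s * (coef k (vToH ξ) + ∫ r in (0 : ℝ)..s, coef k (f r - stokes (y.reg r))) ^ 2)) := by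
    refine integral_congr_time ?_ t.2
    filter_upwards [y.ae_eq, ae_mem_time] with s h1 hs
    have h2 : coef k (daToH (y.reg s)) = coef k (vToH (y.1.1 ⟨s, hs⟩)) := by
      rw [← h1 hs]; rfl
    have h3 := hc ⟨s, hs⟩
    simp only at h3
    rw [← h3, ← h2, map_sub, coef_stokes]
    ring
  rw [e, intervalIntegral.integral_const_mul, key]
  ring

/-- The energy identity for `A^{1/2} y` with an integrating factor `e^{-Φ}`, `Φ' = ψ`. -/
theorem IsLinSol.energy_identity {ξ : V} {f : L2Time T H} {y : StrongPath T}
    (h : IsLinSol ξ f y) {ψ : ℝ → ℝ} (hψ : Integrable ψ (timeMeasure T))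
    (hψ0 : ∀ᵐ s ∂(timeMeasure T), 0 ≤ ψ s) (t : Icc (0 : ℝ) T) :
    Real.exp (-∫ r in (0 : ℝ)..t, ψ r) * gradSq (y.1.1 t) +
      ∫ s in (0 : ℝ)..t, Real.exp (-∫ r in (0 : ℝ)..s, ψ r) *
        (ψ s * gradSq (daToV (y.reg s)) + 2 * ‖stokes (y.reg s)‖ ^ 2 -
          2 * inner ℝ (f s) (stokes (y.reg s))) = gradSq ξ := by
  let I : Freq → ℝ → ℝ := fun k s => Real.exp (-∫ r in (0 : ℝ)..s, ψ r) *
      (ψ s * (lam k * coef k (daToH (y.reg s)) ^ 2) +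
        2 * (lam k ^ 2 * coef k (daToH (y.reg s)) ^ 2) -
        2 * (coef k (f s) * coef k (stokes (y.reg s))))
  let b : Freq → ℝ → ℝ := fun k s => ψ s * (lam k * coef k (daToH (y.reg s)) ^ 2) +
        3 * (lam k ^ 2 * coef k (daToH (y.reg s)) ^ 2) + coef k (f s) ^ 2
  have hb : ∀ s, HasSum (fun k => b k s) (ψ s * gradSq (daToV (y.reg s)) +
      3 * ‖stokes (y.reg s)‖ ^ 2 + ‖f s‖ ^ 2) := fun s =>
    (((hasSum_gradSq (daToV (y.reg s))).mul_left (ψ s)).add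
      ((hasSum_stokes (y.reg s)).mul_left 3)).add (hasSum_coef_sq (f s))
  have hI : ∀ s, HasSum (fun k => I k s) (Real.exp (-∫ r in (0 : ℝ)..s, ψ r) *
        (ψ s * gradSq (daToV (y.reg s)) + 2 * ‖stokes (y.reg s)‖ ^ 2 -
          2 * inner ℝ (f s) (stokes (y.reg s)))) := fun s =>
    ((((hasSum_gradSq (daToV (y.reg s))).mul_left (ψ s)).add
      ((hasSum_stokes (y.reg s)).mul_left 2)).sub
        ((coef_hasSum_inner (f s) (stokes (y.reg s))).mul_left 2)).mul_left _
  have hmeas : ∀ k, AEStronglyMeasurable (I k) (timeMeasure T) := by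
    intro k
    have m1 : AEStronglyMeasurable (fun s => coef k (daToH (y.reg s))) (timeMeasure T) :=
      ((coef k).continuous.comp daToH.continuous).comp_aestronglyMeasurable
        y.aestronglyMeasurable_reg
    have m2 : AEStronglyMeasurable (fun s => coef k (f s)) (timeMeasure T) :=
      (coef k).continuous.comp_aestronglyMeasurable (Lp.aestronglyMeasurable f)
    have m3 : AEStronglyMeasurable (fun s => coef k (stokes (y.reg s))) (timeMeasure T) :=
      (coef k).continuous.comp_aestronglyMeasurable y.memLp_stokes.1
    exact (aestronglyMeasurable_weight hψ).mul (((hψ.1.mul ((m1.pow 2).const_mul _)).add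
      (((m1.pow 2).const_mul _).const_mul _)).sub ((m2.mul m3).const_mul _))
  have hbound : ∀ k, ∀ᵐ s ∂(timeMeasure T), ‖I k s‖ ≤ b k s := by
    intro k
    filter_upwards [hψ0, ae_mem_time] with s h1 hs
    have hl := lam_pos k
    simp only [I, b]
    rw [norm_mul, Real.norm_of_nonneg (Real.exp_pos _).le]
    refine (mul_le_of_le_one_left (norm_nonneg _) (exp_neg_primitive_le_one hψ0 hs)).trans ?_
    rw [coef_stokes, Real.norm_eq_abs]
    have h2 : 0 ≤ ψ s * (lam k * coef k (daToH (y.reg s)) ^ 2) := by positivity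
    set c := coef k (daToH (y.reg s))
    set g := coef k (f s)
    rw [abs_le]
    constructor
    · nlinarith [sq_nonneg (g - lam k * c), sq_nonneg (g + lam k * c), sq_nonneg (lam k * c)]
    · nlinarith [sq_nonneg (g - lam k * c), sq_nonneg (g + lam k * c), sq_nonneg (lam k * c)]
  have hint : Integrable (fun s => ∑' k, b k s) (timeMeasure T) := by
    simp only [(hb _).tsum_eq]
    exact ((y.integrable_mul_gradSq hψ).add (y.integrable_stokes_sq.const_mul 3)).add
      (integrable_norm_sq f)
  have hsub := (Ioc_subset_Icc_self (a := (0 : ℝ)) (b := t)).trans (Icc_subset_Icc_right t.2.2)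
  have hle : volume.restrict (Ioc (0 : ℝ) t) ≤ timeMeasure T := Measure.restrict_mono hsub le_rfl
  have key : HasSum (fun k => ∫ s in (0 : ℝ)..t, I k s) (∫ s in (0 : ℝ)..t,
      Real.exp (-∫ r in (0 : ℝ)..s, ψ r) *
        (ψ s * gradSq (daToV (y.reg s)) + 2 * ‖stokes (y.reg s)‖ ^ 2 -
          2 * inner ℝ (f s) (stokes (y.reg s)))) := by
    simp only [intervalIntegral.integral_of_le t.2.1]
    exact hasSum_integral_of_dominated_convergence b (fun k => (hmeas k).mono_measure hle)
      (fun k => ae_mono hle (hbound k)) (Eventually.of_forall fun s => (hb s).summable)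
      (hint.mono_measure hle) (Eventually.of_forall hI)
  have key2 := (hasSum_gradSq ξ).sub ((hasSum_gradSq (y.1.1 t)).mul_left
    (Real.exp (-∫ r in (0 : ℝ)..t, ψ r)))
  have e := key.unique (key2.congr_fun fun k => h.coef_identity hψ t k)
  rw [e]
  ring

/-- Weighted energy inequality. -/
theorem IsLinSol.weighted_bound {ξ : V} {f : L2Time T H} {y : StrongPath T}
    (h : IsLinSol ξ f y) {ψ β γ : ℝ → ℝ} (hψ : Integrable ψ (timeMeasure T))
    (hψ0 : ∀ᵐ s ∂(timeMeasure T), 0 ≤ ψ s) (hβ : Integrable β (timeMeasure T))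
    (hγ : Integrable γ (timeMeasure T))
    (hle : ∀ᵐ s ∂(timeMeasure T), γ s + 2 * inner ℝ (f s) (stokes (y.reg s)) ≤
      2 * ‖stokes (y.reg s)‖ ^ 2 + ψ s * gradSq (daToV (y.reg s)) + β s) (t : Icc (0 : ℝ) T) :
    Real.exp (-∫ r in (0 : ℝ)..t, ψ r) * gradSq (y.1.1 t) +
      ∫ s in (0 : ℝ)..t, Real.exp (-∫ r in (0 : ℝ)..s, ψ r) * γ s ≤
    gradSq ξ + ∫ s in (0 : ℝ)..t, Real.exp (-∫ r in (0 : ℝ)..s, ψ r) * β s := by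
  have hE := h.energy_identity hψ hψ0 t
  have hi : Integrable (fun s => ψ s * gradSq (daToV (y.reg s)) + 2 * ‖stokes (y.reg s)‖ ^ 2 -
      2 * inner ℝ (f s) (stokes (y.reg s))) (timeMeasure T) :=
    ((y.integrable_mul_gradSq hψ).add (y.integrable_stokes_sq.const_mul 2)).sub
      ((integrable_inner_stokes f y).const_mul 2)
  have h1 := integral_mono_time (integrable_weight_mul hψ hψ0 (hγ.sub hβ))
    (integrable_weight_mul hψ hψ0 hi) (by
      filter_upwards [hle] with s hs
      refine mul_le_mul_of_nonneg_left ?_ (Real.exp_pos _).le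
      simp only [Pi.sub_apply]
      linarith) t.2
  have h2 : ∫ s in (0 : ℝ)..t, Real.exp (-∫ r in (0 : ℝ)..s, ψ r) * (γ - β) s =
      (∫ s in (0 : ℝ)..t, Real.exp (-∫ r in (0 : ℝ)..s, ψ r) * γ s) -
      ∫ s in (0 : ℝ)..t, Real.exp (-∫ r in (0 : ℝ)..s, ψ r) * β s := by
    rw [← intervalIntegral.integral_sub
      (intervalIntegrable_of_time (integrable_weight_mul hψ hψ0 hγ) t.2)
      (intervalIntegrable_of_time (integrable_weight_mul hψ hψ0 hβ) t.2)]
    simp only [Pi.sub_apply, mul_sub]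
  linarith

theorem StrongPath.norm_sq_le (y : StrongPath T) {B : ℝ} (hB : 0 ≤ B)
    (h1 : ∀ t, gradSq (y.1.1 t) ≤ B)
    (h2 : ∫ s, ‖stokes (y.reg s)‖ ^ 2 ∂(timeMeasure T) ≤ B) : ‖y‖ ^ 2 ≤ 3 * B := by
  have e1 : ‖y.1.1‖ ≤ √(3 * B) := by
    refine (ContinuousMap.norm_le _ (Real.sqrt_nonneg _)).2 fun t => Real.le_sqrt_of_sq_le ?_
    linarith [norm_sq_V_le (y.1.1 t), h1 t]
  have e2 : ‖y.1.2‖ ≤ √(3 * B) := by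
    refine Real.le_sqrt_of_sq_le ?_
    rw [← integral_norm_sq]
    calc ∫ s, ‖y.1.2 s‖ ^ 2 ∂(timeMeasure T) ≤ ∫ s, 3 * ‖stokes (y.reg s)‖ ^ 2 ∂(timeMeasure T) :=
          integral_mono (integrable_norm_sq _) (y.integrable_stokes_sq.const_mul 3) fun s =>
            norm_sq_DA_le (y.reg s)
      _ = 3 * ∫ s, ‖stokes (y.reg s)‖ ^ 2 ∂(timeMeasure T) := integral_const_mul _ _
      _ ≤ 3 * B := by linarith
  have e3 : ‖y‖ ≤ √(3 * B) := max_le e1 e2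
  calc ‖y‖ ^ 2 ≤ √(3 * B) ^ 2 := by gcongr
    _ = 3 * B := Real.sq_sqrt (by positivity)

/-- The bound in `C([0, T]; 𝐕) ∩ L²(0, T; D(A))` that follows from a differential inequality of
Gronwall type. -/
theorem IsLinSol.strong_bound (hT : 0 ≤ T) {ξ : V} {f : L2Time T H} {y : StrongPath T}
    (h : IsLinSol ξ f y) {ψ β : ℝ → ℝ} (hψ : Integrable ψ (timeMeasure T))
    (hψ0 : ∀ᵐ s ∂(timeMeasure T), 0 ≤ ψ s) (hβ : Integrable β (timeMeasure T))
    (hβ0 : ∀ᵐ s ∂(timeMeasure T), 0 ≤ β s)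
    (hle : ∀ᵐ s ∂(timeMeasure T), 2 * inner ℝ (f s) (stokes (y.reg s)) ≤
      ‖stokes (y.reg s)‖ ^ 2 + ψ s * gradSq (daToV (y.reg s)) + β s) :
    ‖y‖ ^ 2 ≤ 3 * (Real.exp (∫ s, ψ s ∂(timeMeasure T)) *
      (gradSq ξ + ∫ s, β s ∂(timeMeasure T))) := by
  have hA := y.integrable_stokes_sq
  have key : ∀ t : Icc (0 : ℝ) T, gradSq (y.1.1 t) +
      ∫ s in (0 : ℝ)..t, ‖stokes (y.reg s)‖ ^ 2 ≤ Real.exp (∫ s, ψ s ∂(timeMeasure T)) *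
      (gradSq ξ + ∫ s, β s ∂(timeMeasure T)) := by
    intro t
    have h1 := h.weighted_bound hψ hψ0 hβ hA (by
      filter_upwards [hle] with s hs
      linarith) t
    have h2 : ∫ s in (0 : ℝ)..t, Real.exp (-∫ r in (0 : ℝ)..s, ψ r) * β s ≤
        ∫ s, β s ∂(timeMeasure T) := by
      refine (integral_mono_time (integrable_weight_mul hψ hψ0 hβ) hβ ?_ t.2).trans
        (integral_le_integral_time hβ hβ0 t.2)
      filter_upwards [hβ0, ae_mem_time] with s h1 hs
      exact mul_le_of_le_one_left h1 (exp_neg_primitive_le_one hψ0 hs)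
    have h3 : Real.exp (-∫ r, ψ r ∂(timeMeasure T)) *
        (gradSq (y.1.1 t) + ∫ s in (0 : ℝ)..t, ‖stokes (y.reg s)‖ ^ 2) ≤
        Real.exp (-∫ r in (0 : ℝ)..t, ψ r) * gradSq (y.1.1 t) +
        ∫ s in (0 : ℝ)..t, Real.exp (-∫ r in (0 : ℝ)..s, ψ r) * ‖stokes (y.reg s)‖ ^ 2 := by
      rw [mul_add, ← intervalIntegral.integral_const_mul]
      refine add_le_add (mul_le_mul_of_nonneg_right (exp_neg_integral_le hψ hψ0 t.2)
        (gradSq_nonneg _)) (integral_mono_time (hA.const_mul _)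
          (integrable_weight_mul hψ hψ0 hA) ?_ t.2)
      filter_upwards [ae_mem_time] with s hs
      exact mul_le_mul_of_nonneg_right (exp_neg_integral_le hψ hψ0 hs) (sq_nonneg _)
    have h4 : Real.exp (-∫ r, ψ r ∂(timeMeasure T)) *
        (gradSq (y.1.1 t) + ∫ s in (0 : ℝ)..t, ‖stokes (y.reg s)‖ ^ 2) ≤
        gradSq ξ + ∫ s, β s ∂(timeMeasure T) := by linarith
    rw [Real.exp_neg, inv_mul_le_iff₀ (Real.exp_pos _)] at h4
    exact h4
  have hnn : ∀ t : Icc (0 : ℝ) T, 0 ≤ ∫ s in (0 : ℝ)..t, ‖stokes (y.reg s)‖ ^ 2 := fun t =>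
    integral_nonneg_time (Eventually.of_forall fun s => sq_nonneg _) t.2
  refine y.norm_sq_le ?_ (fun t => ?_) ?_
  · have := integral_nonneg_of_ae hβ0
    have := gradSq_nonneg ξ
    positivity
  · linarith [key t, hnn t]
  · have := key ⟨T, hT, le_rfl⟩
    rw [integral_time_eq hT]
    linarith [gradSq_nonneg (y.1.1 ⟨T, hT, le_rfl⟩)]

end Energy

/-! ### Completeness of the path spaces -/

theorem isClosed_pathSpace {T : ℝ} {X Y : Type*} [NormedAddCommGroup X] [NormedSpace ℝ X]
    [NormedAddCommGroup Y] [NormedSpace ℝ Y] (i : Y →L[ℝ] X) :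
    IsClosed (pathSpace T i : Set (C(Icc (0 : ℝ) T, X) × L2Time T Y)) := by
  refine isClosed_of_closure_subset fun p hp => ?_
  obtain ⟨q, hq, hlim⟩ := mem_closure_iff_seq_limit.1 hp
  have h1 : Tendsto (fun n => (q n).1) atTop (𝓝 p.1) := (continuous_fst.tendsto p).comp hlim
  have h2 : Tendsto (fun n => (q n).2) atTop (𝓝 p.2) := (continuous_snd.tendsto p).comp hlim
  have h3 := tendstoInMeasure_of_tendsto_Lp h2
  obtain ⟨ns, hns, h4⟩ := h3.exists_seq_tendsto_ae
  have h5 : ∀ᵐ t ∂(timeMeasure T), ∀ n, ∀ ht : t ∈ Icc 0 T, i ((q n).2 t) = (q n).1 ⟨t, ht⟩ :=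
    ae_all_iff.2 hq
  change ∀ᵐ t ∂(timeMeasure T), ∀ ht : t ∈ Icc 0 T, i (p.2 t) = p.1 ⟨t, ht⟩
  filter_upwards [h4, h5] with t ht4 ht5 ht
  have e1 : Tendsto (fun n => i ((q (ns n)).2 t)) atTop (𝓝 (i (p.2 t))) :=
    (i.continuous.tendsto _).comp ht4
  have e2 : Tendsto (fun n => (q (ns n)).1 ⟨t, ht⟩) atTop (𝓝 (p.1 ⟨t, ht⟩)) :=
    (((ContinuousMap.evalCLM ℝ (⟨t, ht⟩ : Icc (0 : ℝ) T)).continuous.tendsto p.1).comp h1).comp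
      hns.tendsto_atTop
  refine tendsto_nhds_unique e1 (e2.congr fun n => ?_)
  exact (ht5 _ ht).symm

instance {T : ℝ} : CompleteSpace (StrongPath T) := (isClosed_pathSpace daToV).completeSpace_coe

/-! ### Closed graphs -/

section Graph

variable {X Y : Type*} [NormedAddCommGroup X] [NormedSpace ℝ X]
  [NormedAddCommGroup Y] [NormedSpace ℝ Y]

/-- The data for which a well-posed linear problem, with closed graph `D`, is solvable form a
closed subspace. -/
theorem exists_closed_domain [CompleteSpace X] [CompleteSpace Y]
    (D : Submodule ℝ (X × Y)) (hD : IsClosed (D : Set (X × Y))) (c : ℝ≥0)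
    (hc : ∀ p ∈ D, ‖p.2‖ ≤ c * ‖p.1‖) :
    ∃ P : Submodule ℝ X, IsClosed (P : Set X) ∧ ∀ x, x ∈ P ↔ ∃ y, (x, y) ∈ D := by
  have : CompleteSpace D := hD.completeSpace_coe
  let π : D →L[ℝ] X := (ContinuousLinearMap.fst ℝ X Y).comp D.subtypeL
  have hanti : AntilipschitzWith (max 1 c) π := by
    refine π.antilipschitz_of_bound fun p => ?_
    have h1 : ‖p‖ = max ‖p.1.1‖ ‖p.1.2‖ := rfl
    rw [h1, NNReal.coe_max, NNReal.coe_one]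
    refine max_le ?_ ((hc p.1 p.2).trans (by gcongr; exacts [le_max_right _ _, le_rfl]))
    exact le_mul_of_one_le_left (norm_nonneg _) (le_max_left _ _)
  refine ⟨LinearMap.range π.toLinearMap, hanti.isClosed_range π.uniformContinuous, fun x => ?_⟩
  constructor
  · rintro ⟨p, rfl⟩
    exact ⟨p.1.2, p.2⟩
  · rintro ⟨y, hy⟩
    exact ⟨⟨(x, y), hy⟩, rfl⟩

/-- A subspace of `X × Y` that is bounded over `X` and projects onto `X` is the graph of a bounded
operator. -/
theorem exists_solution_operator (D : Submodule ℝ (X × Y)) (c : ℝ≥0)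
    (hc : ∀ p ∈ D, ‖p.2‖ ≤ c * ‖p.1‖) (hsurj : ∀ x, ∃ y, (x, y) ∈ D) :
    ∃ Λ : X →L[ℝ] Y, ∀ x y, (x, y) ∈ D ↔ y = Λ x := by
  have huniq : ∀ {x y z}, (x, y) ∈ D → (x, z) ∈ D → y = z := by
    intro x y z hy hz
    have h1 := hc _ (D.sub_mem hy hz)
    simp only [Prod.mk_sub_mk, sub_self, norm_zero, mul_zero] at h1
    exact sub_eq_zero.1 (norm_le_zero_iff.1 h1)
  choose L hL using hsurj
  let Λ : X →ₗ[ℝ] Y :=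
    { toFun := L
      map_add' := fun x z => huniq (hL _) (D.add_mem (hL x) (hL z))
      map_smul' := fun r x => huniq (hL _) (D.smul_mem r (hL x)) }
  refine ⟨Λ.mkContinuous c fun x => hc _ (hL x), fun x y => ⟨fun h => huniq h (hL x), ?_⟩⟩
  rintro rfl
  exact hL x

end Graph

/-! ### The Stokes evolution as a bounded operator -/

section Linear

variable {T : ℝ}

theorem integral_norm_le_norm {X : Type*} [NormedAddCommGroup X] (f : L2Time T X) :
    ∫ s, ‖f s‖ ∂(timeMeasure T) ≤ ((timeMeasure T) univ ^ (1 / 2 : ℝ)).toReal * ‖f‖ := by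
  have h3 := eLpNorm_le_eLpNorm_mul_rpow_measure_univ (p := 1) (q := 2)
    (by norm_num) (Lp.aestronglyMeasurable f)
  have h4 : (1 / (1 : ℝ≥0∞).toReal - 1 / (2 : ℝ≥0∞).toReal) = (1 / 2 : ℝ) := by norm_num
  rw [h4] at h3
  have h5 : (eLpNorm (fun x => f x) 1 (timeMeasure T)).toReal = ∫ s, ‖f s‖ ∂(timeMeasure T) := by
    rw [eLpNorm_one_eq_lintegral_enorm,
      integral_norm_eq_lintegral_enorm (Lp.aestronglyMeasurable f)]
  rw [← h5, Lp.norm_def, mul_comm, ← ENNReal.toReal_mul]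
  refine ENNReal.toReal_mono ?_ h3
  exact ENNReal.mul_ne_top (Lp.eLpNorm_ne_top f)
    (ENNReal.rpow_ne_top_of_nonneg (by norm_num) (measure_ne_top _ _))

theorem integrable_L2Time {X : Type*} [NormedAddCommGroup X] (f : L2Time T X) :
    Integrable (fun s => f s) (timeMeasure T) := (Lp.memLp f).integrable (by norm_num)

/-- Integration over `[0, t]`, as a bounded operator on `L²(0, T; X)`. -/
def timeIntegral {X : Type*} [NormedAddCommGroup X] [NormedSpace ℝ X] (t : Icc (0 : ℝ) T) :
    L2Time T X →L[ℝ] X :=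
  LinearMap.mkContinuous
    { toFun := fun f => ∫ s in (0 : ℝ)..t, f s
      map_add' := fun f g => by
        rw [← intervalIntegral.integral_add (intervalIntegrable_of_time (integrable_L2Time f) t.2)
          (intervalIntegrable_of_time (integrable_L2Time g) t.2)]
        exact integral_congr_time (Lp.coeFn_add f g) t.2
      map_smul' := fun r f => by
        rw [RingHom.id_apply, ← intervalIntegral.integral_smul]
        exact integral_congr_time (Lp.coeFn_smul r f) t.2 }
    (((timeMeasure T) univ ^ (1 / 2 : ℝ)).toReal) fun f => by
      refine le_trans ?_ (integral_norm_le_norm f)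
      refine (intervalIntegral.norm_integral_le_integral_norm t.2.1).trans ?_
      exact integral_le_integral_time (integrable_L2Time f).norm
        (Eventually.of_forall fun s => norm_nonneg _) t.2

/-- The defect of a triple `(ξ, f, y)` at time `t` in the integrated equation
`y(t) = ξ + ∫₀ᵗ (f - A y)`. -/
def linDefect (t : Icc (0 : ℝ) T) : (V × L2Time T H) × StrongPath T →L[ℝ] H :=
  let S := (pathSpace T daToV).subtypeL.comp
    (ContinuousLinearMap.snd ℝ (V × L2Time T H) (StrongPath T))
  let F := ContinuousLinearMap.fst ℝ (V × L2Time T H) (StrongPath T)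
  vToH.comp ((ContinuousMap.evalCLM ℝ t).comp ((ContinuousLinearMap.fst ℝ _ _).comp S)) -
    vToH.comp ((ContinuousLinearMap.fst ℝ V (L2Time T H)).comp F) -
    (timeIntegral t).comp ((ContinuousLinearMap.snd ℝ V (L2Time T H)).comp F) +
    (timeIntegral t).comp ((stokesL.compLpL 2 (timeMeasure T)).comp
      ((ContinuousLinearMap.snd ℝ _ _).comp S))

theorem isLinSol_iff {ξ : V} {f : L2Time T H} {y : StrongPath T} :
    IsLinSol ξ f y ↔ ∀ t : Icc (0 : ℝ) T, linDefect t ((ξ, f), y) = 0 := by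
  refine forall_congr' fun t => ?_
  have e : linDefect t ((ξ, f), y) = vToH (y.1.1 t) - vToH ξ - (∫ s in (0 : ℝ)..t, f s) +
      ∫ s in (0 : ℝ)..t, (stokesL.compLp y.1.2) s := rfl
  have e2 : ∫ s in (0 : ℝ)..t, (stokesL.compLp y.1.2) s =
      ∫ s in (0 : ℝ)..t, stokes (y.reg s) := integral_congr_time (stokesL.coeFn_compLp y.1.2) t.2
  rw [e, e2, intervalIntegral.integral_sub
    (intervalIntegrable_of_time (integrable_L2Time f) t.2)
    (intervalIntegrable_of_time (y.memLp_stokes.integrable (by norm_num)) t.2)]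
  change vToH (y.1.1 t) = _ ↔ _
  rw [← sub_eq_zero]
  refine Eq.congr ?_ rfl
  abel

/-- The closed subspace of the triples `(ξ, f, y)` such that `y' + A y = f`, `y(0) = ξ`. -/
def linGraph (T : ℝ) : Submodule ℝ ((V × L2Time T H) × StrongPath T) :=
  ⨅ t, LinearMap.ker (linDefect t).toLinearMap

theorem mem_linGraph {ξ : V} {f : L2Time T H} {y : StrongPath T} :
    ((ξ, f), y) ∈ linGraph T ↔ IsLinSol ξ f y := by
  rw [isLinSol_iff, linGraph, Submodule.mem_iInf]
  rfl

theorem isClosed_linGraph : IsClosed (linGraph T : Set ((V × L2Time T H) × StrongPath T)) := by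
  rw [linGraph, Submodule.coe_iInf]
  exact isClosed_iInter fun t => (linDefect t).isClosed_ker

theorem IsLinSol.norm_sq_le (hT : 0 ≤ T) {ξ : V} {f : L2Time T H} {y : StrongPath T}
    (h : IsLinSol ξ f y) : ‖y‖ ^ 2 ≤ 3 * (gradSq ξ + ‖f‖ ^ 2) := by
  have h1 := h.strong_bound hT (ψ := fun _ => 0) (β := fun s => ‖f s‖ ^ 2)
    (integrable_zero _ _ _) (Eventually.of_forall fun _ => le_rfl) (integrable_norm_sq f)
    (Eventually.of_forall fun _ => sq_nonneg _) (Eventually.of_forall fun s => by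
      have := real_inner_le_norm (f s) (stokes (y.reg s))
      simp only [zero_mul, add_zero]
      nlinarith [sq_nonneg (‖f s‖ - ‖stokes (y.reg s)‖)])
  simpa [integral_norm_sq] using h1

theorem linGraph_bound (hT : 0 ≤ T) (p : (V × L2Time T H) × StrongPath T) (hp : p ∈ linGraph T) :
    ‖p.2‖ ≤ (3 : ℝ≥0) * ‖p.1‖ := by
  obtain ⟨⟨ξ, f⟩, y⟩ := p
  have h1 := (mem_linGraph.1 hp).norm_sq_le hT
  change ‖y‖ ≤ 3 * max ‖ξ‖ ‖f‖
  have h2 := gradSq_le_norm_sq ξ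
  have a1 := le_max_left ‖ξ‖ ‖f‖
  have a2 := le_max_right ‖ξ‖ ‖f‖
  have hm : 0 ≤ max ‖ξ‖ ‖f‖ := (norm_nonneg ξ).trans a1
  have b1 : ‖ξ‖ ^ 2 ≤ max ‖ξ‖ ‖f‖ ^ 2 := by gcongr
  have b2 : ‖f‖ ^ 2 ≤ max ‖ξ‖ ‖f‖ ^ 2 := by gcongr
  refine abs_le_of_sq_le_sq' ?_ (by positivity) |>.2
  nlinarith

theorem stokes_waveDA (k : Freq) : stokes (waveDA k) = lam k • waveH k := by
  refine basisH.repr.injective (lp.ext (funext fun l => ?_))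
  have h := coef_stokes (waveDA k) l
  rw [HilbertBasis.repr_apply_apply, HilbertBasis.repr_apply_apply, basisH_apply, inner_smul_right]
  have h2 : daToH (waveDA k) = waveH k := by
    change vToH (daToV (waveDA k)) = _
    rw [daToV_waveDA, vToH_waveV]
  rw [coef_apply, coef_apply, h2, real_inner_comm, real_inner_comm (waveH l)] at h
  rw [h]
  by_cases hkl : l = k
  · rw [hkl]
  · rw [orthonormal_waveH.2 hkl, mul_zero, mul_zero]

/-- The solution of `c' = φ - l c`, `c(0) = a`, given by the variation of constants formula. -/
theorem exists_scalar_solution (l a : ℝ) {φ : ℝ → ℝ} (hφ : Integrable φ (timeMeasure T)) :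
    ∃ c : ℝ → ℝ, ContinuousOn c (Icc 0 T) ∧
      ∀ t ∈ Icc 0 T, c t = a + ∫ s in (0 : ℝ)..t, (φ s - l * c s) := by
  let p : ℝ → ℝ := fun s => Real.exp (l * s) * φ s
  let c : ℝ → ℝ := fun t => Real.exp (-∫ r in (0 : ℝ)..t, l) * (a + ∫ s in (0 : ℝ)..t, p s)
  have hp : Integrable p (timeMeasure T) := by
    obtain ⟨B, hB⟩ := isCompact_Icc.exists_bound_of_continuousOn
      (f := fun s => Real.exp (l * s)) (s := Icc 0 T) (by fun_prop)
    refine hφ.bdd_mul (c := B) (by fun_prop) ?_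
    filter_upwards [ae_mem_time] with s hs using hB s hs
  refine ⟨c, ?_, fun t ht => ?_⟩
  · have hc : ContinuousOn (fun t : ℝ => ∫ r in (0 : ℝ)..t, p r) (Icc 0 T) := by
      refine (intervalIntegral.continuousOn_primitive hp).congr fun t ht => ?_
      exact intervalIntegral.integral_of_le ht.1
    simp only [c, intervalIntegral.integral_const]
    exact (by fun_prop : Continuous fun t : ℝ => Real.exp (-((t - 0) • l))).continuousOn.mul
      (continuousOn_const.add hc)
  · have h0 : (0 : ℝ) ∈ uIcc 0 t := left_mem_uIcc
    have hl : IntervalIntegrable (fun _ : ℝ => l) volume 0 t := intervalIntegrable_const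
    have hpt := intervalIntegrable_of_time hp ht
    have aE := (hl.absolutelyContinuousOnInterval_intervalIntegral h0).exp_neg
    have aP := hpt.absolutelyContinuousOnInterval_intervalIntegral h0
    have ac : AbsolutelyContinuousOnInterval (fun s => a + ∫ r in (0 : ℝ)..s, p r) 0 t := by
      refine aP.lipschitz_comp (g := fun x => a + x) (L := 1) ?_
      exact (LipschitzWith.of_dist_le_mul fun x y => by simp).lipschitzOnWith
    have key := (aE.mul ac).integral_deriv_eq_sub
    simp only [Pi.mul_apply, intervalIntegral.integral_same, neg_zero, Real.exp_zero, one_mul,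
      add_zero] at key
    have e : ∫ s in (0 : ℝ)..t, (φ s - l * c s) = c t - a := by
      rw [← key]
      refine intervalIntegral.integral_congr_ae ?_
      filter_upwards [hl.ae_hasDerivAt_integral, hpt.ae_hasDerivAt_integral] with s h1 h2 hs
      have hs' := uIoc_subset_uIcc hs
      have d := ((h1 hs' 0 h0).neg.exp).mul ((h2 hs' 0 h0).const_add a)
      refine Eq.trans ?_ d.deriv.symm
      simp only [Pi.neg_apply, c, p, intervalIntegral.integral_const, sub_zero, smul_eq_mul]
      have : Real.exp (-(s * l)) * (Real.exp (l * s) * φ s) = φ s := by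
        rw [← mul_assoc, ← Real.exp_add, mul_comm s l, neg_add_cancel, Real.exp_zero, one_mul]
      rw [this]
      ring
    rw [e]
    ring

/-- The path `t ↦ φ(t) x` of `L²(0, T; X)`. -/
def timeTensor {X : Type*} [NormedAddCommGroup X] [NormedSpace ℝ X] (φ : L2Time T ℝ) (x : X) :
    L2Time T X := (ContinuousLinearMap.toSpanSingleton ℝ x).compLp φ

theorem timeTensor_ae {X : Type*} [NormedAddCommGroup X] [NormedSpace ℝ X] (φ : L2Time T ℝ)
    (x : X) : ∀ᵐ s ∂(timeMeasure T), timeTensor φ x s = φ s • x :=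
  (ContinuousLinearMap.toSpanSingleton ℝ x).coeFn_compLp φ

/-- For data carried by one eigenfunction the equation is a scalar linear equation. -/
theorem exists_isLinSol_wave (k : Freq) (a : ℝ) (φ : L2Time T ℝ) :
    ∃ y : StrongPath T, IsLinSol (a • waveV k) (timeTensor φ (waveH k)) y := by
  obtain ⟨c, hc, hc'⟩ := exists_scalar_solution (lam k) a (integrable_L2Time φ)
  have hmem : MemLp c 2 (timeMeasure T) := by
    obtain ⟨B, hB⟩ := isCompact_Icc.exists_bound_of_continuousOn hc
    refine MemLp.of_bound (hc.aestronglyMeasurable measurableSet_Icc) B ?_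
    filter_upwards [ae_mem_time] with s hs using hB s hs
  let y : StrongPath T := ⟨((⟨fun t : Icc (0 : ℝ) T => c t • waveV k,
      (continuousOn_iff_continuous_domRestrict.1 hc).smul continuous_const⟩ : C(Icc (0 : ℝ) T, V)),
    timeTensor hmem.toLp (waveDA k)), by
      filter_upwards [timeTensor_ae hmem.toLp (waveDA k), hmem.coeFn_toLp] with t h1 h2 ht
      change daToV (timeTensor hmem.toLp (waveDA k) t) = c t • waveV k
      rw [h1, h2, map_smul, daToV_waveDA]⟩
  refine ⟨y, fun t => ?_⟩
  have e : ∫ s in (0 : ℝ)..t, (timeTensor φ (waveH k) s - stokes (y.reg s)) =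
      ∫ s in (0 : ℝ)..t, (φ s - lam k * c s) • waveH k := by
    refine integral_congr_time ?_ t.2
    filter_upwards [timeTensor_ae hmem.toLp (waveDA k), hmem.coeFn_toLp,
      timeTensor_ae φ (waveH k)] with s h1 h2 h3
    have h4 : y.reg s = c s • waveDA k := by
      change timeTensor hmem.toLp (waveDA k) s = _
      rw [h1, h2]
    rw [h3, h4, ← stokesL_apply, map_smul, stokesL_apply, stokes_waveDA, smul_smul, ← sub_smul,
      mul_comm]
  rw [e, intervalIntegral.integral_smul_const, map_smul, vToH_waveV, ← add_smul, ← hc' t t.2]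
  change vToH (c t • waveV k) = _
  rw [map_smul, vToH_waveV]

/-- The tensors `φ ⊗ waveH k`, `φ ∈ L²(0, T)`, are total in `L²(0, T; 𝐇)`. -/
theorem eq_zero_of_inner_timeTensor {g : L2Time T H}
    (h : ∀ (k : Freq) (φ : L2Time T ℝ), inner ℝ (timeTensor φ (waveH k)) g = 0) : g = 0 := by
  have h1 : ∀ k : Freq, (coef k).compLp g = 0 := by
    intro k
    rw [← inner_self_eq_zero (𝕜 := ℝ), ← h k ((coef k).compLp g), L2.inner_def, L2.inner_def]
    refine integral_congr_ae ?_
    filter_upwards [timeTensor_ae ((coef k).compLp g) (waveH k), (coef k).coeFn_compLp g]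
      with s h2 h3
    rw [h2, inner_smul_left, real_inner_comm (g s), ← coef_apply, h3]
    simp [sq]
  have h2 : ∀ᵐ s ∂(timeMeasure T), ∀ k : Freq, coef k (g s) = 0 := by
    refine ae_all_iff.2 fun k => ?_
    filter_upwards [(coef k).coeFn_compLp g, Lp.coeFn_zero ℝ 2 (timeMeasure T)] with s h3 h4
    rw [← h3, h1 k, h4, Pi.zero_apply]
  refine (Lp.eq_zero_iff_ae_eq_zero).2 ?_
  filter_upwards [h2] with s hs
  refine eq_zero_of_inner_waveH fun k => ?_
  rw [← coef_apply]
  exact hs k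

/-- Solvability of `y' + A y = f`, `y(0) = ξ`. By the energy bound the data `(ξ, f)` for which a
solution exists form a closed subspace, and the data carried by a single eigenfunction, which span
a dense subspace, belong to it. -/
theorem exists_isLinSol (hT : 0 ≤ T) (ξ : V) (f : L2Time T H) :
    ∃ y : StrongPath T, IsLinSol ξ f y := by
  obtain ⟨P, hcl, hP⟩ := exists_closed_domain (X := V × L2Time T H)
    (Y := StrongPath T) (linGraph T) isClosed_linGraph 3 (linGraph_bound hT)
  have hmem : ∀ (k : Freq) (a : ℝ) (φ : L2Time T ℝ),
      (a • waveV k, timeTensor φ (waveH k)) ∈ P := by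
    intro k a φ
    obtain ⟨y, hy⟩ := exists_isLinSol_wave k a φ
    exact (hP _).2 ⟨y, mem_linGraph.2 hy⟩
  have h1 : (ξ, (0 : L2Time T H)) ∈ P := by
    have hd : IsClosed {ξ : V | (ξ, (0 : L2Time T H)) ∈ P} :=
      hcl.preimage (by fun_prop : Continuous fun ξ : V => (ξ, (0 : L2Time T H)))
    have hsub : ((Submodule.span ℝ (range waveV) : Submodule ℝ V) : Set V) ⊆
        {ξ : V | (ξ, (0 : L2Time T H)) ∈ P} := by
      intro ξ hξ
      induction hξ using Submodule.span_induction with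
      | mem x hx =>
        obtain ⟨k, rfl⟩ := hx
        have h0 : timeTensor (0 : L2Time T ℝ) (waveH k) = 0 :=
          ((ContinuousLinearMap.toSpanSingleton ℝ (waveH k)).compLpL 2 (timeMeasure T)).map_zero
        have := hmem k 1 0
        rwa [one_smul, h0] at this
      | zero => exact P.zero_mem
      | add x y _ _ hx hy =>
        have := P.add_mem hx hy
        rwa [Prod.mk_add_mk, add_zero] at this
      | smul a x _ hx =>
        have := P.smul_mem a hx
        rwa [Prod.smul_mk, smul_zero] at this
    exact hd.closure_subset_iff.2 hsub (parseval_V.1 ξ)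
  have h2 : ((0 : V), f) ∈ P := by
    let D : Submodule ℝ (L2Time T H) :=
      { carrier := {f | ((0 : V), f) ∈ P}
        zero_mem' := P.zero_mem
        add_mem' := fun hx hy => by
          have := P.add_mem hx hy
          rwa [Prod.mk_add_mk, add_zero] at this
        smul_mem' := fun a x hx => by
          have := P.smul_mem a hx
          rwa [Prod.smul_mk, smul_zero] at this }
    have hd : IsClosed (D : Set (L2Time T H)) :=
      hcl.preimage (by fun_prop : Continuous fun f : L2Time T H => ((0 : V), f))
    have : CompleteSpace D := hd.completeSpace_coe
    have hD : D = ⊤ := by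
      rw [← Submodule.orthogonal_eq_bot_iff, Submodule.eq_bot_iff]
      intro g hg
      refine eq_zero_of_inner_timeTensor fun k φ => ?_
      refine (Submodule.mem_orthogonal D g).1 hg _ ?_
      have := hmem k 0 φ
      rw [zero_smul] at this
      exact this
    have : f ∈ D := by rw [hD]; trivial
    exact this
  have h3 := P.add_mem h1 h2
  rw [Prod.mk_add_mk, add_zero, zero_add] at h3
  obtain ⟨y, hy⟩ := (hP _).1 h3
  exact ⟨y, mem_linGraph.1 hy⟩

/-- The equation `y' + A y = f`, `y(0) = ξ` has a bounded solution operator `(ξ, f) ↦ y`. -/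
theorem exists_linSol (hT : 0 ≤ T) : ∃ Λ : V × L2Time T H →L[ℝ] StrongPath T,
    ∀ (ξ : V) (f : L2Time T H) (y : StrongPath T), IsLinSol ξ f y ↔ y = Λ (ξ, f) := by
  obtain ⟨Λ, hΛ⟩ := exists_solution_operator (X := V × L2Time T H)
      (Y := StrongPath T) (linGraph T) 3 (linGraph_bound hT) fun x => by
    obtain ⟨y, hy⟩ := exists_isLinSol hT x.1 x.2
    exact ⟨y, mem_linGraph.2 hy⟩
  exact ⟨Λ, fun ξ f y => mem_linGraph.symm.trans (hΛ (ξ, f) y)⟩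

end Linear

/-! ### Hilbert–Schmidt and operator norms -/

section Noise

variable {ι K X : Type*} [NormedAddCommGroup K] [InnerProductSpace ℝ K]
  [NormedAddCommGroup X] [NormedSpace ℝ X]

/-- The Hilbert–Schmidt norm dominates the operator norm. -/
theorem norm_le_of_hsNorm_le (e : HilbertBasis ι ℝ K) (S : K →L[ℝ] X) {c : ℝ} (hc : 0 ≤ c)
    (h : hsNorm e S ≤ ENNReal.ofReal c) : ‖S‖ ≤ c := by
  have h1 : ∑' i, ‖S (e i)‖ₑ ^ 2 ≤ ENNReal.ofReal (c ^ 2) := by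
    have := ENNReal.rpow_le_rpow h (by norm_num : (0 : ℝ) ≤ 2)
    rw [hsNorm, ← ENNReal.rpow_mul] at this
    norm_num at this
    rwa [← ENNReal.ofReal_pow hc] at this
  have h2 : ∀ s : Finset ι, ∑ i ∈ s, ‖S (e i)‖ ^ 2 ≤ c ^ 2 := by
    intro s
    have h3 := (ENNReal.sum_le_tsum s).trans h1
    rw [← ENNReal.ofReal_le_ofReal_iff (by positivity),
      ENNReal.ofReal_sum_of_nonneg fun i _ => by positivity]
    refine le_trans (le_of_eq (Finset.sum_congr rfl fun i _ => ?_)) h3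
    rw [ENNReal.ofReal_pow (norm_nonneg _), ofReal_norm]
  refine S.opNorm_le_bound hc fun x => ?_
  have h3 := (e.hasSum_repr x).mapL S
  refine le_of_tendsto h3.norm (Eventually.of_forall fun s => ?_)
  calc ‖∑ i ∈ s, S (e.repr x i • e i)‖ ≤ ∑ i ∈ s, ‖e.repr x i‖ * ‖S (e i)‖ := by
        refine (norm_sum_le _ _).trans (Finset.sum_le_sum fun i _ => ?_)
        rw [map_smul, norm_smul]
    _ ≤ c * ‖x‖ := by
        refine abs_le_of_sq_le_sq' ?_ (by positivity) |>.2
        refine (Finset.sum_mul_sq_le_sq_mul_sq _ _ _).trans ?_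
        rw [mul_pow, mul_comm (c ^ 2)]
        refine mul_le_mul ?_ (h2 s) (Finset.sum_nonneg fun i _ => by positivity) (by positivity)
        have := e.orthonormal.sum_inner_products_le x (s := s)
        simpa only [HilbertBasis.repr_apply_apply] using this

/-- The Lipschitz and growth bounds of the noise coefficient, in the operator norm of
`𝓛(K, 𝐕)`. -/
structure NoiseBound (G : H → (K →L[ℝ] V)) (C : ℝ) : Prop where
  nonneg : 0 ≤ C
  lipschitz : ∀ u v, ‖G u - G v‖ ≤ C * ‖u - v‖
  growth : ∀ u, ‖G u‖ ≤ C * (1 + ‖u‖)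

theorem NoiseAssumption.exists_noiseBound {e : HilbertBasis ι ℝ K} {G : H → (K →L[ℝ] V)}
    (h : NoiseAssumption e G) : ∃ C, NoiseBound G C := by
  obtain ⟨C, h1, h2⟩ := h
  refine ⟨C, C.2, fun u v => ?_, fun u => ?_⟩
  · refine norm_le_of_hsNorm_le e _ (by positivity) ((le_self_add.trans (h1 u v)).trans_eq ?_)
    rw [ENNReal.ofReal_mul C.coe_nonneg, ofReal_norm, ENNReal.ofReal_coe_nnreal]
  · refine norm_le_of_hsNorm_le e _ (by positivity) ((le_self_add.trans (h2 u)).trans_eq ?_)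
    rw [ENNReal.ofReal_mul C.coe_nonneg, ENNReal.ofReal_add zero_le_one (norm_nonneg _),
      ofReal_norm,
      ENNReal.ofReal_coe_nnreal, ENNReal.ofReal_one]

theorem NoiseBound.continuous {G : H → (K →L[ℝ] V)} {C : ℝ} (h : NoiseBound G C) :
    Continuous G :=
  (LipschitzWith.of_dist_le_mul (K := ⟨C, h.nonneg⟩) fun u v => by
    rw [dist_eq_norm, dist_eq_norm]; exact h.lipschitz u v).continuous

end Noise

/-! ### The nonlinear term -/

section Nonlinear

variable {K : Type*} [NormedAddCommGroup K] [InnerProductSpace ℝ K]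

/-- The term `G(δa + (1-δ)y)κ - (1-δ)B(y, y) - δB(a, y) - δB(y, a)` of the controlled
equation. -/
def nonlin (G : H → (K →L[ℝ] V)) (δ : ℝ) (a : DA) (κ : K) (y : DA) : H :=
  vToH (G (δ • daToH a + (1 - δ) • daToH y) κ) - (1 - δ) • bilin y y - δ • bilin a y -
    δ • bilin y a

theorem daToH_norm_sq_le (u : DA) : ‖daToH u‖ ^ 2 ≤ gradSq (daToV u) := norm_vToH_sq_le (daToV u)

theorem norm_vToH_le (v : V) : ‖vToH v‖ ≤ ‖v‖ := by
  refine abs_le_of_sq_le_sq' ((norm_vToH_sq_le v).trans (gradSq_le_norm_sq v)) (norm_nonneg v) |>.2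

theorem norm_bilin_sq_le_left (u v : DA) :
    ‖bilin u v‖ ^ 2 ≤ 4 * agmonConst * ‖stokes u‖ ^ 2 * gradSq (daToV v) := by
  have h := norm_bilin_sq_le u v one_pos
  have h1 := gradSq_le_stokes u
  have h2 := gradSq_nonneg (daToV v)
  have h3 := agmonConst_nonneg
  have h4 : (1 * ‖stokes u‖ ^ 2 + (1 : ℝ)⁻¹ * gradSq (daToV u)) ≤ 2 * ‖stokes u‖ ^ 2 := by
    rw [inv_one]; linarith
  calc _ ≤ _ := h
    _ ≤ 2 * agmonConst * (2 * ‖stokes u‖ ^ 2) * gradSq (daToV v) := by gcongr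
    _ = _ := by ring

theorem sq_norm_sum_five_le {X : Type*} [SeminormedAddCommGroup X] (a b c d e : X) :
    ‖a + b + c + d + e‖ ^ 2 ≤ 5 * (‖a‖ ^ 2 + ‖b‖ ^ 2 + ‖c‖ ^ 2 + ‖d‖ ^ 2 + ‖e‖ ^ 2) := by
  have h : ‖a + b + c + d + e‖ ≤ ‖a‖ + ‖b‖ + ‖c‖ + ‖d‖ + ‖e‖ := by
    refine (norm_add_le _ _).trans (add_le_add ?_ le_rfl)
    exact norm_add₄_le
  have h2 : ‖a + b + c + d + e‖ ^ 2 ≤ (‖a‖ + ‖b‖ + ‖c‖ + ‖d‖ + ‖e‖) ^ 2 := by gcongr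
  linarith [sq_nonneg (‖a‖ - ‖b‖), sq_nonneg (‖a‖ - ‖c‖), sq_nonneg (‖a‖ - ‖d‖),
    sq_nonneg (‖a‖ - ‖e‖), sq_nonneg (‖b‖ - ‖c‖), sq_nonneg (‖b‖ - ‖d‖), sq_nonneg (‖b‖ - ‖e‖),
    sq_nonneg (‖c‖ - ‖d‖), sq_nonneg (‖c‖ - ‖e‖), sq_nonneg (‖d‖ - ‖e‖)]

theorem norm_smul_sq_le {X : Type*} [NormedAddCommGroup X] [NormedSpace ℝ X] {r : ℝ}
    (hr : r ∈ Icc (0 : ℝ) 1) (x : X) : ‖r • x‖ ^ 2 ≤ ‖x‖ ^ 2 := by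
  rw [norm_smul, Real.norm_of_nonneg hr.1]
  exact pow_le_pow_left₀ (mul_nonneg hr.1 (norm_nonneg x))
    (mul_le_of_le_one_left (norm_nonneg x) hr.2) 2

variable {G : H → (K →L[ℝ] V)} {C δ : ℝ}

/-- Local Lipschitz estimate of the nonlinear term: the top order contribution of the difference
can be made as small as desired. -/
theorem exists_nonlin_lipschitz (hG : NoiseBound G C) (hδ : δ ∈ Icc (0 : ℝ) 1) {R η : ℝ}
    (hR : 0 ≤ R) (hη : 0 < η) :
    ∃ L, 0 ≤ L ∧ ∀ (a : DA) (κ : K) (y z : DA), gradSq (daToV a) ≤ R → gradSq (daToV z) ≤ R →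
      ‖nonlin G δ a κ y - nonlin G δ a κ z‖ ^ 2 ≤ η * ‖stokes (y - z)‖ ^ 2 +
        L * (1 + ‖κ‖ ^ 2 + ‖stokes y‖ ^ 2 + ‖stokes a‖ ^ 2) * gradSq (daToV (y - z)) := by
  have hA := agmonConst_nonneg
  have hC := hG.nonneg
  set A := agmonConst
  obtain ⟨ε, hε, hε'⟩ : ∃ ε : ℝ, 0 < ε ∧ 20 * A * R * ε ≤ η := by
    refine ⟨η / (20 * A * R + 1), by positivity, ?_⟩
    rw [mul_div_assoc', div_le_iff₀ (by positivity)]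
    nlinarith
  refine ⟨5 * C ^ 2 + 20 * A + 20 * A * R * ε⁻¹, by positivity, fun a κ y z ha hz => ?_⟩
  set e := y - z with he
  have hδ' : 1 - δ ∈ Icc (0 : ℝ) 1 := ⟨by linarith [hδ.2], by linarith [hδ.1]⟩
  set vy := δ • daToH a + (1 - δ) • daToH y
  set vz := δ • daToH a + (1 - δ) • daToH z
  have hy : y = z + e := by rw [he]; abel
  have e1 : bilin y y - bilin z z = bilin y e + bilin e z := by
    have h1 : bilin y y = bilin y z + bilin y e := by
      conv_lhs => rw [show bilin y y = bilin y (z + e) by rw [← hy]]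
      exact bilin_add_right _ _ _
    have h2 : bilin y z = bilin z z + bilin e z := by
      conv_lhs => rw [hy]
      exact bilin_add_left _ _ _
    rw [h1, h2]; abel
  have e2 : bilin a y - bilin a z = bilin a e := by
    rw [hy, bilin_add_right]; abel
  have e3 : bilin y a - bilin z a = bilin e a := by
    rw [hy, bilin_add_left]; abel
  have hsum : nonlin G δ a κ y - nonlin G δ a κ z = vToH ((G vy - G vz) κ) +
      -((1 - δ) • bilin y e) + -((1 - δ) • bilin e z) + -(δ • bilin a e) +
      -(δ • bilin e a) := by
    rw [← e2, ← e3, nonlin, nonlin]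
    have : (1 - δ) • bilin y e = (1 - δ) • (bilin y y - bilin z z) - (1 - δ) • bilin e z := by
      rw [e1, smul_add]; abel
    rw [this, sub_apply, map_sub, smul_sub, smul_sub, smul_sub]
    abel
  have hge := gradSq_nonneg (daToV e)
  have b1 : ‖vToH ((G vy - G vz) κ)‖ ^ 2 ≤ C ^ 2 * ‖κ‖ ^ 2 * gradSq (daToV e) := by
    have h1 : ‖vToH ((G vy - G vz) κ)‖ ≤ C * ‖daToH e‖ * ‖κ‖ := by
      refine (norm_vToH_le _).trans ((ContinuousLinearMap.le_opNorm _ _).trans ?_)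
      gcongr
      refine (hG.lipschitz _ _).trans ?_
      gcongr
      have : vy - vz = (1 - δ) • daToH e := by
        simp only [vy, vz, he, map_sub, smul_sub]; abel
      rw [this, norm_smul, Real.norm_of_nonneg hδ'.1]
      exact mul_le_of_le_one_left (norm_nonneg _) hδ'.2
    calc ‖vToH ((G vy - G vz) κ)‖ ^ 2 ≤ (C * ‖daToH e‖ * ‖κ‖) ^ 2 := by gcongr
      _ = C ^ 2 * ‖κ‖ ^ 2 * ‖daToH e‖ ^ 2 := by ring
      _ ≤ _ := by gcongr; exact daToH_norm_sq_le e
  have b2 := (norm_smul_sq_le hδ' (bilin y e)).trans (norm_bilin_sq_le_left y e)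
  have b4 := (norm_smul_sq_le hδ (bilin a e)).trans (norm_bilin_sq_le_left a e)
  have b3 : ∀ w : DA, gradSq (daToV w) ≤ R → ‖bilin e w‖ ^ 2 ≤
      2 * A * (ε * ‖stokes e‖ ^ 2 + ε⁻¹ * gradSq (daToV e)) * R := fun w hw => by
    refine (norm_bilin_sq_le e w hε).trans ?_
    gcongr
  have b3' := (norm_smul_sq_le hδ' (bilin e z)).trans (b3 z hz)
  have b5' := (norm_smul_sq_le hδ (bilin e a)).trans (b3 a ha)
  have h5 := sq_norm_sum_five_le (vToH ((G vy - G vz) κ)) (-((1 - δ) • bilin y e))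
    (-((1 - δ) • bilin e z)) (-(δ • bilin a e)) (-(δ • bilin e a))
  rw [← hsum] at h5
  simp only [norm_neg] at h5
  have s1 : 20 * A * R * ε * ‖stokes e‖ ^ 2 ≤ η * ‖stokes e‖ ^ 2 := by gcongr
  have hL : 5 * (C ^ 2 * ‖κ‖ ^ 2 * gradSq (daToV e)) + 20 * A * ‖stokes y‖ ^ 2 * gradSq (daToV e) +
      20 * A * ‖stokes a‖ ^ 2 * gradSq (daToV e) + 20 * A * R * ε⁻¹ * gradSq (daToV e) ≤
      (5 * C ^ 2 + 20 * A + 20 * A * R * ε⁻¹) * (1 + ‖κ‖ ^ 2 + ‖stokes y‖ ^ 2 + ‖stokes a‖ ^ 2) *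
        gradSq (daToV e) := by
    have : 0 ≤ (5 * C ^ 2 * (1 + ‖stokes y‖ ^ 2 + ‖stokes a‖ ^ 2) + 20 * A * (1 + ‖κ‖ ^ 2) +
      20 * A * R * ε⁻¹ * (‖κ‖ ^ 2 + ‖stokes y‖ ^ 2 + ‖stokes a‖ ^ 2)) * gradSq (daToV e) := by
      positivity
    linarith
  linarith

theorem norm_noise_sq_le (hG : NoiseBound G C) (hδ : δ ∈ Icc (0 : ℝ) 1) (a y : DA) (κ : K) :
    ‖G (δ • daToH a + (1 - δ) • daToH y) κ‖ ^ 2 ≤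
      2 * C ^ 2 * (1 + 2 * gradSq (daToV a) + 2 * gradSq (daToV y)) * ‖κ‖ ^ 2 := by
  have hδ' : 1 - δ ∈ Icc (0 : ℝ) 1 := ⟨by linarith [hδ.2], by linarith [hδ.1]⟩
  set v := δ • daToH a + (1 - δ) • daToH y
  have hC := hG.nonneg
  have h1 : ‖G v κ‖ ≤ C * (1 + ‖v‖) * ‖κ‖ :=
    (ContinuousLinearMap.le_opNorm _ _).trans (by gcongr; exact hG.growth v)
  have h2 : ‖v‖ ^ 2 ≤ 2 * gradSq (daToV a) + 2 * gradSq (daToV y) := by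
    have h3 : ‖v‖ ≤ ‖δ • daToH a‖ + ‖(1 - δ) • daToH y‖ := norm_add_le _ _
    have h4 : ‖v‖ ^ 2 ≤ (‖δ • daToH a‖ + ‖(1 - δ) • daToH y‖) ^ 2 := by gcongr
    have h5 := (norm_smul_sq_le hδ (daToH a)).trans (daToH_norm_sq_le a)
    have h6 := (norm_smul_sq_le hδ' (daToH y)).trans (daToH_norm_sq_le y)
    linarith [sq_nonneg (‖δ • daToH a‖ - ‖(1 - δ) • daToH y‖)]
  calc ‖G v κ‖ ^ 2 ≤ (C * (1 + ‖v‖) * ‖κ‖) ^ 2 := by gcongr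
    _ = C ^ 2 * (1 + ‖v‖) ^ 2 * ‖κ‖ ^ 2 := by ring
    _ ≤ C ^ 2 * (2 * (1 + ‖v‖ ^ 2)) * ‖κ‖ ^ 2 := by
      gcongr
      linarith [sq_nonneg (1 - ‖v‖)]
    _ = 2 * C ^ 2 * (1 + ‖v‖ ^ 2) * ‖κ‖ ^ 2 := by ring
    _ ≤ _ := mul_le_mul_of_nonneg_right
      (mul_le_mul_of_nonneg_left (by linarith) (by positivity)) (sq_nonneg _)

/-- Growth of the nonlinear term on bounded subsets of `𝐕`. -/
theorem exists_nonlin_growth (hG : NoiseBound G C) (hδ : δ ∈ Icc (0 : ℝ) 1) {R : ℝ} (hR : 0 ≤ R) :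
    ∃ L, 0 ≤ L ∧ ∀ (a : DA) (κ : K) (y : DA), gradSq (daToV a) ≤ R → gradSq (daToV y) ≤ R →
      ‖nonlin G δ a κ y‖ ^ 2 ≤ L * (1 + ‖κ‖ ^ 2 + ‖stokes y‖ ^ 2 + ‖stokes a‖ ^ 2) := by
  obtain ⟨L, hL, h⟩ := exists_nonlin_lipschitz hG hδ hR one_pos
  refine ⟨2 * (1 + L * R) + 4 * C ^ 2 * (1 + 2 * R), by positivity, fun a κ y ha hy => ?_⟩
  have z1 : gradSq (daToV 0) = 0 := by
    rw [map_zero]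
    simp [gradSq]
  have h1 := h a κ y 0 ha (by rw [z1]; exact hR)
  rw [sub_zero] at h1
  have h2 : ‖nonlin G δ a κ 0‖ ^ 2 ≤ 2 * C ^ 2 * (1 + 2 * R) * ‖κ‖ ^ 2 := by
    have e : nonlin G δ a κ 0 = vToH (G (δ • daToH a + (1 - δ) • daToH 0) κ) := by
      have b0 : bilin 0 0 = 0 := by rw [← bilinL_apply, map_zero]
      have b1 : bilin a 0 = 0 := by rw [← bilinL_apply, map_zero]
      have b2 : bilin 0 a = 0 := by
        rw [← bilinL_apply, map_zero, zero_apply]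
      rw [nonlin, b0, b1, b2]
      simp
    rw [e]
    have h3 := norm_noise_sq_le hG hδ a 0 κ
    rw [z1] at h3
    calc _ ≤ ‖G (δ • daToH a + (1 - δ) • daToH 0) κ‖ ^ 2 := by gcongr; exact norm_vToH_le _
      _ ≤ _ := h3
      _ ≤ _ := mul_le_mul_of_nonneg_right
        (mul_le_mul_of_nonneg_left (by linarith) (by positivity)) (sq_nonneg _)
  have h3 : ‖nonlin G δ a κ y‖ ^ 2 ≤
      2 * ‖nonlin G δ a κ y - nonlin G δ a κ 0‖ ^ 2 + 2 * ‖nonlin G δ a κ 0‖ ^ 2 := by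
    have h4 : ‖nonlin G δ a κ y‖ ≤ ‖nonlin G δ a κ y - nonlin G δ a κ 0‖ + ‖nonlin G δ a κ 0‖ :=
      norm_le_norm_sub_add _ _
    have h5 : ‖nonlin G δ a κ y‖ ^ 2 ≤
      (‖nonlin G δ a κ y - nonlin G δ a κ 0‖ + ‖nonlin G δ a κ 0‖) ^ 2 := by gcongr
    linarith [sq_nonneg (‖nonlin G δ a κ y - nonlin G δ a κ 0‖ - ‖nonlin G δ a κ 0‖)]
  set W := 1 + ‖κ‖ ^ 2 + ‖stokes y‖ ^ 2 + ‖stokes a‖ ^ 2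
  have w1 : ‖stokes y‖ ^ 2 ≤ W := by
    simp only [W]; linarith [sq_nonneg ‖κ‖, sq_nonneg ‖stokes a‖]
  have w2 : ‖κ‖ ^ 2 ≤ W := by
    simp only [W]; linarith [sq_nonneg ‖stokes y‖, sq_nonneg ‖stokes a‖]
  have w0 : 0 ≤ W := by positivity
  have w3 : L * W * gradSq (daToV y) ≤ L * W * R := by gcongr
  have w4 : 2 * C ^ 2 * (1 + 2 * R) * ‖κ‖ ^ 2 ≤ 2 * C ^ 2 * (1 + 2 * R) * W := by gcongr
  linarith

/-- The a priori estimate: the term `B(y, y)` is orthogonal to `A y`, and what remains grows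
linearly in `y`. -/
theorem exists_nonlin_apriori (hG : NoiseBound G C) (hδ : δ ∈ Icc (0 : ℝ) 1) {R : ℝ}
    (hR : 0 ≤ R) :
    ∃ L, 0 ≤ L ∧ ∀ (a : DA) (κ : K) (y : DA) (s : ℝ), s ∈ Icc (0 : ℝ) 1 → gradSq (daToV a) ≤ R →
      2 * inner ℝ (s • nonlin G δ a κ y) (stokes y) ≤ ‖stokes y‖ ^ 2 +
        L * (1 + ‖κ‖ ^ 2 + ‖stokes a‖ ^ 2) * gradSq (daToV y) + L * ‖κ‖ ^ 2 := by
  have hA := agmonConst_nonneg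
  have hC := hG.nonneg
  set A := agmonConst
  obtain ⟨ε, hε, hε'⟩ : ∃ ε : ℝ, 0 < ε ∧ 32 * A * R * ε ≤ 1 := by
    refine ⟨1 / (32 * A * R + 1), by positivity, ?_⟩
    rw [mul_div_assoc', div_le_iff₀ (by positivity)]
    linarith
  refine ⟨8 * C ^ 2 * (1 + 2 * R) + 16 * C ^ 2 + 16 * A + 8 * A * R * ε⁻¹, by positivity,
    fun a κ y s hs ha => ?_⟩
  have hgy := gradSq_nonneg (daToV y)
  set g := vToH (G (δ • daToH a + (1 - δ) • daToH y) κ)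
  -- each of the remaining three terms is absorbed by a quarter of `‖A y‖²`
  have young : ∀ (r : ℝ) (x : H), r ∈ Icc (0 : ℝ) 1 →
      2 * |inner ℝ (r • x) (stokes y)| ≤ 1 / 4 * ‖stokes y‖ ^ 2 + 4 * ‖x‖ ^ 2 := fun r x hr => by
    have h1 := abs_real_inner_le_norm (r • x) (stokes y)
    have h2 := norm_smul_sq_le hr x
    linarith [sq_nonneg (1 / 2 * ‖stokes y‖ - 2 * ‖r • x‖)]
  have e : inner ℝ (s • nonlin G δ a κ y) (stokes y) = inner ℝ (s • g) (stokes y) -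
      inner ℝ ((s * δ) • bilin a y) (stokes y) - inner ℝ ((s * δ) • bilin y a) (stokes y) := by
    have h0 : inner ℝ ((s * (1 - δ)) • bilin y y) (stokes y) = 0 := by
      rw [real_inner_smul_left, inner_bilin_stokes, mul_zero]
    rw [nonlin]
    simp only [smul_sub, inner_sub_left, smul_smul, h0, sub_zero]
    rfl
  have hsδ : s * δ ∈ Icc (0 : ℝ) 1 :=
    ⟨mul_nonneg hs.1 hδ.1, mul_le_one₀ hs.2 hδ.1 hδ.2⟩
  have y1 := young s g hs
  have y2 := young (s * δ) (bilin a y) hsδ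
  have y3 := young (s * δ) (bilin y a) hsδ
  have a1 := le_abs_self (inner ℝ (s • g) (stokes y))
  have a2 := neg_abs_le (inner ℝ ((s * δ) • bilin a y) (stokes y))
  have a3 := neg_abs_le (inner ℝ ((s * δ) • bilin y a) (stokes y))
  have b1 : ‖g‖ ^ 2 ≤ 2 * C ^ 2 * (1 + 2 * R + 2 * gradSq (daToV y)) * ‖κ‖ ^ 2 := by
    have h3 := norm_noise_sq_le hG hδ a y κ
    calc _ ≤ ‖G (δ • daToH a + (1 - δ) • daToH y) κ‖ ^ 2 := by gcongr; exact norm_vToH_le _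
      _ ≤ _ := h3
      _ ≤ _ := by gcongr
  have b2 := norm_bilin_sq_le_left a y
  have b3 : ‖bilin y a‖ ^ 2 ≤ 2 * A * (ε * ‖stokes y‖ ^ 2 + ε⁻¹ * gradSq (daToV y)) * R := by
    refine (norm_bilin_sq_le y a hε).trans ?_
    gcongr
  have s1 : 32 * A * R * ε * ‖stokes y‖ ^ 2 ≤ 1 * ‖stokes y‖ ^ 2 := by gcongr
  have hL : 0 ≤ (8 * C ^ 2 * (1 + 2 * R) * (1 + ‖κ‖ ^ 2 + ‖stokes a‖ ^ 2) +
      16 * C ^ 2 * (1 + ‖stokes a‖ ^ 2) + 16 * A * (1 + ‖κ‖ ^ 2) +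
      8 * A * R * ε⁻¹ * (‖κ‖ ^ 2 + ‖stokes a‖ ^ 2)) * gradSq (daToV y) +
      (16 * C ^ 2 + 16 * A + 8 * A * R * ε⁻¹) * ‖κ‖ ^ 2 := by positivity
  rw [e]
  linarith

theorem continuous_nonlin (hG : NoiseBound G C) :
    Continuous fun p : DA × K × DA => nonlin G δ p.1 p.2.1 p.2.2 := by
  have hGc := hG.continuous
  have hb : ∀ {f g : DA × K × DA → DA}, Continuous f → Continuous g →
      Continuous fun p => bilin (f p) (g p) := fun hf hg => by
    simp only [← bilinL_apply]
    exact (bilinL.continuous.comp hf).clm_apply hg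
  have c1 : Continuous fun p : DA × K × DA =>
      vToH (G (δ • daToH p.1 + (1 - δ) • daToH p.2.2) p.2.1) := by
    refine vToH.continuous.comp ((hGc.comp ?_).clm_apply (by fun_prop))
    fun_prop
  have f1 : Continuous fun p : DA × K × DA => p.1 := by fun_prop
  have f2 : Continuous fun p : DA × K × DA => p.2.2 := by fun_prop
  have d1 : Continuous fun p : DA × K × DA => (1 - δ) • bilin p.2.2 p.2.2 :=
    (hb f2 f2).const_smul (1 - δ)
  have d2 : Continuous fun p : DA × K × DA => δ • bilin p.1 p.2.2 := (hb f1 f2).const_smul δ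
  have d3 : Continuous fun p : DA × K × DA => δ • bilin p.2.2 p.1 := (hb f2 f1).const_smul δ
  unfold nonlin
  exact ((c1.sub d1).sub d2).sub d3

end Nonlinear

/-! ### The nonlinear term along paths -/

section Paths

variable {K : Type*} [NormedAddCommGroup K] {T : ℝ}

/-- The integrable function `1 + ‖h‖² + |A y|² + |A u|²` of time that governs the growth and the
Lipschitz constants of the nonlinear term. -/
def rate (u : StrongPath T) (h : L2Time T K) (y : StrongPath T) (s : ℝ) : ℝ :=
  1 + ‖h s‖ ^ 2 + ‖stokes (y.reg s)‖ ^ 2 + ‖stokes (u.reg s)‖ ^ 2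

theorem rate_nonneg (u : StrongPath T) (h : L2Time T K) (y : StrongPath T) (s : ℝ) :
    0 ≤ rate u h y s := by unfold rate; positivity

theorem integrable_rate (u : StrongPath T) (h : L2Time T K) (y : StrongPath T) :
    Integrable (rate u h y) (timeMeasure T) :=
  (((integrable_const 1).add (integrable_norm_sq h)).add y.integrable_stokes_sq).add
    u.integrable_stokes_sq

variable [InnerProductSpace ℝ K]

theorem integral_rate_le (hT : 0 ≤ T) (u : StrongPath T) (h : L2Time T K) (y : StrongPath T) :
    ∫ s, rate u h y s ∂(timeMeasure T) ≤ T + ‖h‖ ^ 2 + ‖y‖ ^ 2 + ‖u‖ ^ 2 := by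
  have i1 := integrable_const (μ := timeMeasure T) (1 : ℝ)
  have i2 := i1.add (integrable_norm_sq h)
  have i3 := i2.add y.integrable_stokes_sq
  have e : ∫ s, rate u h y s ∂(timeMeasure T) = T + ‖h‖ ^ 2 +
      (∫ s, ‖stokes (y.reg s)‖ ^ 2 ∂(timeMeasure T)) +
      ∫ s, ‖stokes (u.reg s)‖ ^ 2 ∂(timeMeasure T) := by
    rw [← integral_norm_sq h]
    have e1 := integral_add i3 u.integrable_stokes_sq
    have e2 := integral_add i2 y.integrable_stokes_sq
    have e3 := integral_add i1 (integrable_norm_sq h)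
    simp only [Pi.add_apply, integral_const, measureReal_time hT, smul_eq_mul, mul_one]
      at e1 e2 e3
    simp only [rate]
    rw [e1, e2, e3]
  rw [e]
  linarith [y.integral_stokes_sq_le, u.integral_stokes_sq_le]

variable {G : H → (K →L[ℝ] V)} {C δ : ℝ}

theorem memLp_two_of_sq_le {X : Type*} [NormedAddCommGroup X] {N : ℝ → X} {g : ℝ → ℝ}
    (hm : AEStronglyMeasurable N (timeMeasure T)) (hg : Integrable g (timeMeasure T))
    (h : ∀ᵐ s ∂(timeMeasure T), ‖N s‖ ^ 2 ≤ g s) : MemLp N 2 (timeMeasure T) := by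
  refine (memLp_two_iff_integrable_sq_norm hm).2 (hg.mono' (hm.norm.pow 2) ?_)
  filter_upwards [h] with s hs
  rwa [Real.norm_of_nonneg (by positivity)]

theorem aestronglyMeasurable_nonlin (hG : NoiseBound G C) (u : StrongPath T)
    (h : L2Time T K) (y : StrongPath T) :
    AEStronglyMeasurable (fun s => nonlin G δ (u.reg s) (h s) (y.reg s)) (timeMeasure T) := by
  have hp : AEStronglyMeasurable (fun s => (u.reg s, h s, y.reg s)) (timeMeasure T) :=
    u.aestronglyMeasurable_reg.prodMk
      ((Lp.aestronglyMeasurable h).prodMk y.aestronglyMeasurable_reg)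
  have := Continuous.comp_aestronglyMeasurable (continuous_nonlin (δ := δ) hG) hp
  exact this

theorem memLp_nonlin (hG : NoiseBound G C) (hδ : δ ∈ Icc (0 : ℝ) 1) (u : StrongPath T)
    (h : L2Time T K) (y : StrongPath T) :
    MemLp (fun s => nonlin G δ (u.reg s) (h s) (y.reg s)) 2 (timeMeasure T) := by
  obtain ⟨L, hL, hb⟩ := exists_nonlin_growth hG hδ (R := ‖u‖ ^ 2 + ‖y‖ ^ 2) (by positivity)
  refine memLp_two_of_sq_le (aestronglyMeasurable_nonlin hG u h y)
    ((integrable_rate u h y).const_mul L) ?_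
  filter_upwards [u.ae_gradSq_le, y.ae_gradSq_le] with s h1 h2
  exact hb _ _ _ (by linarith [sq_nonneg ‖y‖]) (by linarith [sq_nonneg ‖u‖])

open Classical in
/-- The nonlinear term along a path `y`, as an element of `L²(0, T; 𝐇)`. It belongs to this space
under the assumptions in force (`memLp_nonlin`); the value `0` is a placeholder. -/
def nonlinPath (G : H → (K →L[ℝ] V)) (δ : ℝ) (u : StrongPath T) (h : L2Time T K)
    (y : StrongPath T) : L2Time T H :=
  if hm : MemLp (fun s => nonlin G δ (u.reg s) (h s) (y.reg s)) 2 (timeMeasure T)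
  then hm.toLp else 0

theorem nonlinPath_ae (hG : NoiseBound G C) (hδ : δ ∈ Icc (0 : ℝ) 1) (u : StrongPath T)
    (h : L2Time T K) (y : StrongPath T) : ∀ᵐ s ∂(timeMeasure T),
    nonlinPath G δ u h y s = nonlin G δ (u.reg s) (h s) (y.reg s) := by
  have hm := memLp_nonlin hG hδ u h y
  rw [nonlinPath, dif_pos hm]
  exact hm.coeFn_toLp

/-- The nonlinear term is bounded in `L²(0, T; 𝐇)` on bounded sets of paths. -/
theorem exists_nonlinPath_bound (hT : 0 ≤ T) (hG : NoiseBound G C) (hδ : δ ∈ Icc (0 : ℝ) 1)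
    (u : StrongPath T) (h : L2Time T K) (ρ : ℝ) :
    ∃ B, ∀ y : StrongPath T, ‖y‖ ≤ ρ → ‖nonlinPath G δ u h y‖ ≤ B := by
  obtain ⟨L, hL, hb⟩ := exists_nonlin_growth hG hδ (R := ‖u‖ ^ 2 + ρ ^ 2) (by positivity)
  refine ⟨√(L * (T + ‖h‖ ^ 2 + ρ ^ 2 + ‖u‖ ^ 2)), fun y hy => Real.le_sqrt_of_sq_le ?_⟩
  have hyρ : ‖y‖ ^ 2 ≤ ρ ^ 2 := by gcongr
  rw [← integral_norm_sq]
  calc ∫ s, ‖nonlinPath G δ u h y s‖ ^ 2 ∂(timeMeasure T)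
      ≤ ∫ s, L * rate u h y s ∂(timeMeasure T) := by
        refine integral_mono_ae (integrable_norm_sq _) ((integrable_rate u h y).const_mul L) ?_
        filter_upwards [u.ae_gradSq_le, y.ae_gradSq_le, nonlinPath_ae hG hδ u h y] with s h1 h2 h3
        rw [h3]
        exact hb _ _ _ (by linarith [sq_nonneg ρ]) (by linarith [sq_nonneg ‖u‖])
    _ = L * ∫ s, rate u h y s ∂(timeMeasure T) := integral_const_mul _ _
    _ ≤ L * (T + ‖h‖ ^ 2 + ρ ^ 2 + ‖u‖ ^ 2) := by
        gcongr
        linarith [integral_rate_le hT u h y]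

end Paths

/-! ### A fixed point theorem in a weighted norm -/

/-- Banach's fixed point theorem on a ball around `0`, for a map that contracts the equivalent
norm `‖M ·‖`. -/
theorem exists_fixed_point {E : Type*} [NormedAddCommGroup E] [NormedSpace ℝ E] [CompleteSpace E]
    (M : E →L[ℝ] E) {c r q : ℝ} (hc0 : 0 ≤ c) (hc : ∀ f, ‖f‖ ≤ c * ‖M f‖) (hr : 0 ≤ r)
    (hq0 : 0 ≤ q) (hq1 : q < 1) (Ψ : E → E)
    (hΨ : ∀ f f', ‖M f‖ ≤ r → ‖M f'‖ ≤ r → ‖M (Ψ f - Ψ f')‖ ≤ q * ‖M (f - f')‖)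
    (h0 : ‖M (Ψ 0)‖ ≤ (1 - q) * r) : ∃ f, Ψ f = f := by
  have hball : ∀ f, ‖M f‖ ≤ r → ‖M (Ψ f)‖ ≤ r := by
    intro f hf
    have h1 := hΨ f 0 hf (by rw [map_zero, norm_zero]; exact hr)
    rw [sub_zero, map_sub] at h1
    have h2 := norm_le_norm_sub_add (M (Ψ f)) (M (Ψ 0))
    nlinarith
  let x : ℕ → E := fun n => Ψ^[n] 0
  have hx : ∀ n, x (n + 1) = Ψ (x n) := fun n => Function.iterate_succ_apply' Ψ n 0
  have hxr : ∀ n, ‖M (x n)‖ ≤ r := by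
    intro n
    induction n with
    | zero => simpa [x] using hr
    | succ n ih => rw [hx]; exact hball _ ih
  have hstep : ∀ n, ‖M (x (n + 1) - x n)‖ ≤ q ^ n * ‖M (Ψ 0)‖ := by
    intro n
    induction n with
    | zero => simp [x]
    | succ n ih =>
      have h1 := hΨ (x (n + 1)) (x n) (hxr _) (hxr _)
      rw [← hx, ← hx] at h1
      rw [pow_succ', mul_assoc]
      exact h1.trans (by gcongr)
  have hcau : CauchySeq x := by
    refine cauchySeq_of_le_geometric q (c * ‖M (Ψ 0)‖) hq1 fun n => ?_
    rw [dist_comm, dist_eq_norm]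
    calc ‖x (n + 1) - x n‖ ≤ c * ‖M (x (n + 1) - x n)‖ := hc _
      _ ≤ c * (q ^ n * ‖M (Ψ 0)‖) := by gcongr; exact hstep n
      _ = c * ‖M (Ψ 0)‖ * q ^ n := by ring
  obtain ⟨f, hf⟩ := cauchySeq_tendsto_of_complete hcau
  have hfr : ‖M f‖ ≤ r :=
    le_of_tendsto ((M.continuous.tendsto f).comp hf).norm (Eventually.of_forall hxr)
  refine ⟨f, ?_⟩
  have h1 : Tendsto (fun n => c * (q * ‖M (x n - f)‖)) atTop (𝓝 0) := by
    have h2 : Tendsto (fun n => x n - f) atTop (𝓝 0) := by simpa using hf.sub_const f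
    have h3 := ((M.continuous.tendsto _).comp h2).norm
    rw [map_zero, norm_zero] at h3
    simpa using (h3.const_mul q).const_mul c
  have h4 : Tendsto (fun n => x (n + 1) - Ψ f) atTop (𝓝 0) := by
    refine squeeze_zero_norm (fun n => ?_) h1
    rw [hx]
    exact (hc _).trans (by gcongr; exact hΨ _ _ (hxr n) hfr)
  have h5 : Tendsto (fun n => x (n + 1)) atTop (𝓝 (Ψ f)) := by
    simpa using h4.add_const (Ψ f)
  exact tendsto_nhds_unique h5 (hf.comp (tendsto_add_atTop_nat 1))

section Weight

variable {T : ℝ}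

/-- Multiplication by `e^{-Φ/2}`, where `Φ' = ψ`, `Φ(0) = 0`, as an operator of `L²(0, T; X)`. -/
theorem exists_weightOp {X : Type*} [NormedAddCommGroup X] [InnerProductSpace ℝ X] {ψ : ℝ → ℝ}
    (hψ : Integrable ψ (timeMeasure T)) (hψ0 : ∀ᵐ s ∂(timeMeasure T), 0 ≤ ψ s) :
    ∃ M : L2Time T X →L[ℝ] L2Time T X, (∀ f, ‖M f‖ ^ 2 =
      ∫ s, Real.exp (-∫ r in (0 : ℝ)..s, ψ r) * ‖f s‖ ^ 2 ∂(timeMeasure T)) ∧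
      (∀ f, ‖M f‖ ≤ ‖f‖) ∧
      ∀ f, ‖f‖ ^ 2 ≤ Real.exp (∫ s, ψ s ∂(timeMeasure T)) * ‖M f‖ ^ 2 := by
  let w : ℝ → ℝ := fun s => √(Real.exp (-∫ r in (0 : ℝ)..s, ψ r))
  have hw : ∀ s, w s ^ 2 = Real.exp (-∫ r in (0 : ℝ)..s, ψ r) := fun s =>
    Real.sq_sqrt (Real.exp_pos _).le
  have hwm : AEStronglyMeasurable w (timeMeasure T) :=
    Continuous.comp_aestronglyMeasurable Real.continuous_sqrt (aestronglyMeasurable_weight hψ)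
  have hsq : ∀ (f : L2Time T X) (s : ℝ), ‖w s • f s‖ ^ 2 =
      Real.exp (-∫ r in (0 : ℝ)..s, ψ r) * ‖f s‖ ^ 2 := fun f s => by
    rw [norm_smul, mul_pow, Real.norm_eq_abs, sq_abs, hw]
  have hle : ∀ f : L2Time T X, ∀ᵐ s ∂(timeMeasure T), ‖w s • f s‖ ^ 2 ≤ ‖f s‖ ^ 2 := fun f => by
    filter_upwards [ae_mem_time] with s hs
    rw [hsq]
    exact mul_le_of_le_one_left (sq_nonneg _) (exp_neg_primitive_le_one hψ0 hs)
  have hmem : ∀ f : L2Time T X, MemLp (fun s => w s • f s) 2 (timeMeasure T) := fun f =>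
    memLp_two_of_sq_le (hwm.smul (Lp.aestronglyMeasurable f)) (integrable_norm_sq f) (hle f)
  have hnorm : ∀ f : L2Time T X, ‖(hmem f).toLp‖ ^ 2 =
      ∫ s, Real.exp (-∫ r in (0 : ℝ)..s, ψ r) * ‖f s‖ ^ 2 ∂(timeMeasure T) := fun f => by
    rw [← integral_norm_sq]
    refine integral_congr_ae ?_
    filter_upwards [(hmem f).coeFn_toLp] with s hs
    rw [hs, hsq]
  let M : L2Time T X →ₗ[ℝ] L2Time T X :=
    { toFun := fun f => (hmem f).toLp
      map_add' := fun f g => by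
        rw [← MemLp.toLp_add]
        refine MemLp.toLp_congr _ _ ?_
        filter_upwards [Lp.coeFn_add f g] with s hs
        rw [hs, Pi.add_apply, Pi.add_apply, smul_add]
      map_smul' := fun a f => by
        rw [RingHom.id_apply, ← MemLp.toLp_const_smul]
        refine MemLp.toLp_congr _ _ ?_
        filter_upwards [Lp.coeFn_smul a f] with s hs
        rw [hs, Pi.smul_apply, Pi.smul_apply, smul_comm] }
  have hM1 : ∀ f, ‖M f‖ ≤ ‖f‖ := fun f => by
    refine abs_le_of_sq_le_sq' ?_ (norm_nonneg _) |>.2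
    change ‖(hmem f).toLp‖ ^ 2 ≤ _
    rw [hnorm, ← integral_norm_sq]
    refine integral_mono_ae (integrable_weight_mul hψ hψ0 (integrable_norm_sq f))
      (integrable_norm_sq f) ?_
    filter_upwards [hle f] with s hs
    rwa [hsq] at hs
  refine ⟨M.mkContinuous 1 fun f => by rw [one_mul]; exact hM1 f, hnorm, hM1, fun f => ?_⟩
  change _ ≤ _ * ‖(hmem f).toLp‖ ^ 2
  rw [← inv_mul_le_iff₀ (Real.exp_pos _), ← Real.exp_neg, ← integral_norm_sq,
    ← integral_const_mul, hnorm]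
  refine integral_mono_ae ((integrable_norm_sq f).const_mul _)
    (integrable_weight_mul hψ hψ0 (integrable_norm_sq f)) ?_
  filter_upwards [ae_mem_time] with s hs
  exact mul_le_mul_of_nonneg_right (exp_neg_integral_le hψ hψ0 hs) (sq_nonneg _)

theorem StrongPath.reg_add (y z : StrongPath T) : ∀ᵐ s ∂(timeMeasure T),
    (y + z).reg s = y.reg s + z.reg s := Lp.coeFn_add y.1.2 z.1.2

theorem StrongPath.reg_sub (y z : StrongPath T) : ∀ᵐ s ∂(timeMeasure T),
    (y - z).reg s = y.reg s - z.reg s := Lp.coeFn_sub y.1.2 z.1.2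

theorem StrongPath.reg_neg (y : StrongPath T) : ∀ᵐ s ∂(timeMeasure T),
    (-y).reg s = -y.reg s := Lp.coeFn_neg y.1.2

theorem gradSq_zero : gradSq 0 = 0 := by simp [gradSq]

theorem stokes_add (y z : DA) : stokes (y + z) = stokes y + stokes z := by
  simp only [← stokesL_apply, map_add]

/-- Weighted maximal regularity with zero initial value. -/
theorem IsLinSol.weighted_norm_bound (hT : 0 ≤ T) {f : L2Time T H} {y : StrongPath T}
    (h : IsLinSol 0 f y) {ψ : ℝ → ℝ} (hψ : Integrable ψ (timeMeasure T))
    (hψ0 : ∀ᵐ s ∂(timeMeasure T), 0 ≤ ψ s) {N : ℝ}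
    (hN : ∫ s, Real.exp (-∫ r in (0 : ℝ)..s, ψ r) * ‖f s‖ ^ 2 ∂(timeMeasure T) = N) :
    (∀ t, gradSq (y.1.1 t) ≤ Real.exp (∫ s, ψ s ∂(timeMeasure T)) * N) ∧
    ∫ s, Real.exp (-∫ r in (0 : ℝ)..s, ψ r) *
      (ψ s * gradSq (daToV (y.reg s)) + ‖stokes (y.reg s)‖ ^ 2) ∂(timeMeasure T) ≤ N := by
  have hγ : Integrable (fun s => ψ s * gradSq (daToV (y.reg s)) + ‖stokes (y.reg s)‖ ^ 2)
      (timeMeasure T) := (y.integrable_mul_gradSq hψ).add y.integrable_stokes_sq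
  have hγ0 : ∀ᵐ s ∂(timeMeasure T), 0 ≤ Real.exp (-∫ r in (0 : ℝ)..s, ψ r) *
      (ψ s * gradSq (daToV (y.reg s)) + ‖stokes (y.reg s)‖ ^ 2) := by
    filter_upwards [hψ0] with s hs
    have := gradSq_nonneg (daToV (y.reg s))
    positivity
  have key : ∀ t : Icc (0 : ℝ) T, Real.exp (-∫ r in (0 : ℝ)..t, ψ r) * gradSq (y.1.1 t) +
      ∫ s in (0 : ℝ)..t, Real.exp (-∫ r in (0 : ℝ)..s, ψ r) *
        (ψ s * gradSq (daToV (y.reg s)) + ‖stokes (y.reg s)‖ ^ 2) ≤ N := by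
    intro t
    have h1 := h.weighted_bound hψ hψ0 (integrable_norm_sq f) hγ (by
      refine Eventually.of_forall fun s => ?_
      have h2 := real_inner_le_norm (f s) (stokes (y.reg s))
      have h3 := sq_nonneg (‖f s‖ - ‖stokes (y.reg s)‖)
      linarith) t
    rw [gradSq_zero, zero_add] at h1
    refine h1.trans ((integral_le_integral_time
      (integrable_weight_mul hψ hψ0 (integrable_norm_sq f)) ?_ t.2).trans_eq hN)
    exact Eventually.of_forall fun s => by positivity
  constructor
  · intro t
    have h1 := key t
    have h2 := integral_nonneg_time hγ0 t.2
    have h3 := exp_neg_integral_le hψ hψ0 t.2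
    have h4 : Real.exp (-∫ r, ψ r ∂(timeMeasure T)) * gradSq (y.1.1 t) ≤ N :=
      (mul_le_mul_of_nonneg_right h3 (gradSq_nonneg _)).trans (by linarith)
    rwa [Real.exp_neg, inv_mul_le_iff₀ (Real.exp_pos _)] at h4
  · have h1 := key ⟨T, hT, le_rfl⟩
    rw [integral_time_eq hT]
    have := mul_nonneg (Real.exp_pos (-∫ r in (0 : ℝ)..T, ψ r)).le
      (gradSq_nonneg (y.1.1 ⟨T, hT, le_rfl⟩))
    linarith

theorem stokes_add_sq_le (y z : DA) :
    ‖stokes (y + z)‖ ^ 2 ≤ 2 * ‖stokes y‖ ^ 2 + 2 * ‖stokes z‖ ^ 2 := by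
  rw [stokes_add]
  have e2 : ‖stokes y + stokes z‖ ^ 2 ≤ (‖stokes y‖ + ‖stokes z‖) ^ 2 := by
    gcongr
    exact norm_add_le _ _
  linarith [sq_nonneg (‖stokes y‖ - ‖stokes z‖)]

/-- The weighted contraction estimate around a path `y`: with the weight `e^{-Φ}`, where `Φ'` is a
multiple of the Lipschitz constant at `y`, the increment of the nonlinear term between two paths
`p = y + d` and `p'` is small relative to that of the right-hand sides, if `d` is small. -/
theorem weighted_contraction {K : Type*} [NormedAddCommGroup K] (hT : 0 ≤ T)
    {u : StrongPath T} {h : L2Time T K} {y d e : StrongPath T} {f g φ : L2Time T H} {L m Nf Ng : ℝ}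
    (hL : 0 ≤ L) (hm : ∫ s, 8 * L * rate u h y s ∂(timeMeasure T) ≤ m)
    (hd : IsLinSol 0 f d) (he : IsLinSol 0 g e)
    (hφ : ∀ᵐ s ∂(timeMeasure T), ‖φ s‖ ^ 2 ≤ 1 / 4 * ‖stokes (e.reg s)‖ ^ 2 +
      L * rate u h (y + d) s * gradSq (daToV (e.reg s)))
    (hNf : ∫ s, Real.exp (-∫ r in (0 : ℝ)..s, 8 * L * rate u h y r) * ‖f s‖ ^ 2
      ∂(timeMeasure T) = Nf)
    (hNg : ∫ s, Real.exp (-∫ r in (0 : ℝ)..s, 8 * L * rate u h y r) * ‖g s‖ ^ 2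
      ∂(timeMeasure T) = Ng) :
    ∫ s, Real.exp (-∫ r in (0 : ℝ)..s, 8 * L * rate u h y r) * ‖φ s‖ ^ 2 ∂(timeMeasure T) ≤
      1 / 4 * Ng + 2 * L * (Real.exp m * Ng) * Nf := by
  have hψ : Integrable (fun s => 8 * L * rate u h y s) (timeMeasure T) :=
    (integrable_rate u h y).const_mul _
  have hψ0 : ∀ᵐ s ∂(timeMeasure T), 0 ≤ 8 * L * rate u h y s :=
    Eventually.of_forall fun s => mul_nonneg (by positivity) (rate_nonneg u h y s)
  have hNg0 : 0 ≤ Ng := by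
    rw [← hNg]
    exact integral_nonneg fun s => by positivity
  obtain ⟨b0, b1⟩ := he.weighted_norm_bound hT hψ hψ0 hNg
  obtain ⟨-, b2⟩ := hd.weighted_norm_bound hT hψ hψ0 hNf
  have hi1 := integrable_weight_mul hψ hψ0
    ((e.integrable_mul_gradSq hψ).add e.integrable_stokes_sq)
  have hi2 := integrable_weight_mul hψ hψ0
    ((d.integrable_mul_gradSq hψ).add d.integrable_stokes_sq)
  simp only [Pi.add_apply] at hi1 hi2
  set ψ : ℝ → ℝ := fun s => 8 * L * rate u h y s
  have hpt : ∀ᵐ s ∂(timeMeasure T), ‖φ s‖ ^ 2 ≤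
      1 / 4 * (ψ s * gradSq (daToV (e.reg s)) + ‖stokes (e.reg s)‖ ^ 2) +
      2 * L * (Real.exp m * Ng) * (ψ s * gradSq (daToV (d.reg s)) + ‖stokes (d.reg s)‖ ^ 2) := by
    filter_upwards [hφ, y.reg_add d, hψ0, e.ae_eq, ae_mem_time] with s h1 h2 h3 h4 hs
    have h5 : gradSq (daToV (e.reg s)) ≤ Real.exp m * Ng := by
      rw [h4 hs]
      exact (b0 _).trans (by gcongr)
    have h6 : rate u h (y + d) s ≤ 2 * rate u h y s + 2 * ‖stokes (d.reg s)‖ ^ 2 := by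
      have e1 := stokes_add_sq_le (y.reg s) (d.reg s)
      rw [← h2] at e1
      unfold rate
      linarith [sq_nonneg ‖h s‖, sq_nonneg ‖stokes (u.reg s)‖]
    have hg0 := gradSq_nonneg (daToV (e.reg s))
    have h7 : L * rate u h (y + d) s * gradSq (daToV (e.reg s)) ≤
        1 / 4 * (ψ s * gradSq (daToV (e.reg s))) +
        2 * L * (Real.exp m * Ng) * ‖stokes (d.reg s)‖ ^ 2 := by
      calc L * rate u h (y + d) s * gradSq (daToV (e.reg s))
          ≤ L * (2 * rate u h y s + 2 * ‖stokes (d.reg s)‖ ^ 2) * gradSq (daToV (e.reg s)) := by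
            gcongr
        _ = 1 / 4 * (ψ s * gradSq (daToV (e.reg s))) +
            2 * L * gradSq (daToV (e.reg s)) * ‖stokes (d.reg s)‖ ^ 2 := by
          simp only [ψ]; ring
        _ ≤ _ := by gcongr
    have h8 : 0 ≤ 2 * L * (Real.exp m * Ng) * (ψ s * gradSq (daToV (d.reg s))) :=
      mul_nonneg (by positivity) (mul_nonneg h3 (gradSq_nonneg _))
    linarith
  calc _ ≤ ∫ s, (1 / 4 * (Real.exp (-∫ r in (0 : ℝ)..s, ψ r) *
              (ψ s * gradSq (daToV (e.reg s)) + ‖stokes (e.reg s)‖ ^ 2)) +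
            2 * L * (Real.exp m * Ng) * (Real.exp (-∫ r in (0 : ℝ)..s, ψ r) *
              (ψ s * gradSq (daToV (d.reg s)) + ‖stokes (d.reg s)‖ ^ 2)))
              ∂(timeMeasure T) := by
        refine integral_mono_ae (integrable_weight_mul hψ hψ0 (integrable_norm_sq φ))
          ((hi1.const_mul _).add (hi2.const_mul _)) ?_
        filter_upwards [hpt] with s hs
        refine (mul_le_mul_of_nonneg_left hs
          (Real.exp_pos (-∫ r in (0 : ℝ)..s, ψ r)).le).trans_eq ?_
        ring
    _ = _ := integral_add (hi1.const_mul _) (hi2.const_mul _)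
    _ ≤ _ := by
        rw [integral_const_mul, integral_const_mul]
        gcongr

end Weight

/-! ### Unique solvability of the controlled equation -/

section Solve

variable {K : Type*} [NormedAddCommGroup K] [InnerProductSpace ℝ K] {T : ℝ}
  {G : H → (K →L[ℝ] V)} {C δ : ℝ}

/-- `y` solves `y' + A y = s F(y)`, `y(0) = ξ`, where `F` is the nonlinear term and `s` a
homotopy parameter. -/
def IsMildSol (G : H → (K →L[ℝ] V)) (δ : ℝ) (u : StrongPath T) (h : L2Time T K) (s : ℝ) (ξ : V)
    (y : StrongPath T) : Prop := IsLinSol ξ (s • nonlinPath G δ u h y) y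

/-- Local Lipschitz estimate of the nonlinear term along paths. -/
theorem exists_nonlinPath_lipschitz (hG : NoiseBound G C) (hδ : δ ∈ Icc (0 : ℝ) 1) {R η : ℝ}
    (hR : 0 ≤ R) (hη : 0 < η) :
    ∃ L, 0 ≤ L ∧ ∀ (u : StrongPath T) (h : L2Time T K) (y z : StrongPath T),
      ‖u‖ ^ 2 ≤ R → (∀ t, gradSq (z.1.1 t) ≤ R) → ∀ᵐ s ∂(timeMeasure T),
        ‖(nonlinPath G δ u h y - nonlinPath G δ u h z) s‖ ^ 2 ≤
          η * ‖stokes ((y - z).reg s)‖ ^ 2 +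
            L * rate u h y s * gradSq (daToV ((y - z).reg s)) := by
  obtain ⟨L, hL, hb⟩ := exists_nonlin_lipschitz hG hδ hR hη
  refine ⟨L, hL, fun u h y z hu hz => ?_⟩
  filter_upwards [Lp.coeFn_sub (nonlinPath G δ u h y) (nonlinPath G δ u h z),
    nonlinPath_ae hG hδ u h y, nonlinPath_ae hG hδ u h z, y.reg_sub z, u.ae_gradSq_le,
    z.ae_eq, ae_mem_time] with s h1 h2 h3 h4 h5 h6 hs
  rw [h1, Pi.sub_apply, h2, h3, h4]
  exact hb _ _ _ _ (h5.trans hu) (by rw [h6 hs]; exact hz _)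

/-- The a priori bound, uniform in the homotopy parameter and on bounded sets of controls. -/
theorem exists_apriori_bound (hT : 0 ≤ T) (hG : NoiseBound G C) (hδ : δ ∈ Icc (0 : ℝ) 1)
    (u : StrongPath T) (ξ : V) (m : ℝ) :
    ∃ ρ, 0 ≤ ρ ∧ ∀ (h : L2Time T K) (s : ℝ) (y : StrongPath T), ‖h‖ ^ 2 ≤ m →
      s ∈ Icc (0 : ℝ) 1 → IsMildSol G δ u h s ξ y → ‖y‖ ≤ ρ := by
  obtain ⟨L, hL, hb⟩ := exists_nonlin_apriori hG hδ (R := ‖u‖ ^ 2) (by positivity)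
  refine ⟨√(3 * (Real.exp (L * (T + m + ‖u‖ ^ 2)) * (gradSq ξ + L * m))), Real.sqrt_nonneg _,
    fun h s y hm hs hy => Real.le_sqrt_of_sq_le ?_⟩
  have i1 := integrable_const (μ := timeMeasure T) (1 : ℝ)
  have i2 := i1.add (integrable_norm_sq h)
  have i3 := i2.add u.integrable_stokes_sq
  have hψ : Integrable (fun s => L * (1 + ‖h s‖ ^ 2 + ‖stokes (u.reg s)‖ ^ 2)) (timeMeasure T) :=
    i3.const_mul L
  have hβ := (integrable_norm_sq h).const_mul L
  have h1 := IsLinSol.strong_bound hT hy hψ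
    (Eventually.of_forall fun s => by positivity) hβ (Eventually.of_forall fun s => by positivity)
    (by
      filter_upwards [Lp.coeFn_smul s (nonlinPath G δ u h y), nonlinPath_ae hG hδ u h y,
        u.ae_gradSq_le] with r h1 h2 h3
      rw [h1, Pi.smul_apply, h2]
      exact hb _ _ _ s hs h3)
  have e1 : ∫ s, L * (1 + ‖h s‖ ^ 2 + ‖stokes (u.reg s)‖ ^ 2) ∂(timeMeasure T) ≤
      L * (T + m + ‖u‖ ^ 2) := by
    have e2 := integral_add i2 u.integrable_stokes_sq
    have e3 := integral_add i1 (integrable_norm_sq h)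
    simp only [Pi.add_apply, integral_const, measureReal_time hT, smul_eq_mul, mul_one,
      integral_norm_sq] at e2 e3
    rw [integral_const_mul, e2, e3]
    gcongr
    exact u.integral_stokes_sq_le
  have e4 : ∫ s, L * ‖h s‖ ^ 2 ∂(timeMeasure T) ≤ L * m := by
    rw [integral_const_mul, integral_norm_sq]
    gcongr
  refine h1.trans ?_
  have := gradSq_nonneg ξ
  have : 0 ≤ m := (sq_nonneg _).trans hm
  gcongr

theorem IsLinSol.add {ξ ξ' : V} {f f' : L2Time T H} {y y' : StrongPath T} (h : IsLinSol ξ f y)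
    (h' : IsLinSol ξ' f' y') : IsLinSol (ξ + ξ') (f + f') (y + y') :=
  mem_linGraph.1 ((linGraph T).add_mem (mem_linGraph.2 h) (mem_linGraph.2 h'))

theorem IsMildSol.add_of_fixed {u : StrongPath T} {h : L2Time T K} {s s' : ℝ} {ξ : V}
    {y d : StrongPath T} {f : L2Time T H} (hy : IsMildSol G δ u h s ξ y) (hd : IsLinSol 0 f d)
    (hf : s' • nonlinPath G δ u h (y + d) - s • nonlinPath G δ u h y = f) :
    IsMildSol G δ u h s' ξ (y + d) := by
  have h1 := IsLinSol.add hy hd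
  rwa [add_zero, ← hf, add_sub_cancel] at h1

set_option maxHeartbeats 400000 in
/-- The continuation step: a solution for the homotopy parameter `s` yields one for each parameter
at distance at most `ε`, where `ε` depends on a bound of the former only. -/
theorem exists_continuation_step (hT : 0 ≤ T) (hG : NoiseBound G C) (hδ : δ ∈ Icc (0 : ℝ) 1)
    (u : StrongPath T) (h : L2Time T K) (ξ : V) {ρ : ℝ} :
    ∃ ε, 0 < ε ∧ ∀ (s s' : ℝ) (y : StrongPath T), s' ∈ Icc (0 : ℝ) 1 → |s' - s| ≤ ε → ‖y‖ ≤ ρ →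
      IsMildSol G δ u h s ξ y → ∃ y', IsMildSol G δ u h s' ξ y' := by
  obtain ⟨Λ, hΛ⟩ := exists_linSol hT
  obtain ⟨L, hL, hlip⟩ := exists_nonlinPath_lipschitz (T := T) hG hδ
    (R := 2 * ρ ^ 2 + 2 + ‖u‖ ^ 2) (η := 1 / 4) (by positivity) (by norm_num)
  obtain ⟨B, hB⟩ := exists_nonlinPath_bound hT hG hδ u h ρ
  set m := 8 * L * (T + ‖h‖ ^ 2 + ρ ^ 2 + ‖u‖ ^ 2)
  -- the radius `r` is such that `e^m r² ≤ 1` and `2 L e^m r² ≤ 1/4`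
  set r := √(Real.exp (-m) / (1 + 8 * L)) with hr
  have hr2 : r ^ 2 = Real.exp (-m) / (1 + 8 * L) := Real.sq_sqrt (by positivity)
  have hr0 : 0 < r := Real.sqrt_pos.2 (by positivity)
  have hmr : Real.exp m * r ^ 2 * (1 + 8 * L) = 1 := by
    rw [hr2, mul_assoc, div_mul_cancel₀ _ (by positivity), ← Real.exp_add, add_neg_cancel,
      Real.exp_zero]
  have hmr0 : 0 ≤ Real.exp m * r ^ 2 := by positivity
  have hmr1 : Real.exp m * r ^ 2 ≤ 1 := by nlinarith
  have hmr2 : 2 * L * (Real.exp m * r ^ 2) ≤ 1 / 4 := by nlinarith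
  refine ⟨r / (4 * (|B| + 1)), by positivity, fun s s' y hs' hss hy hsol => ?_⟩
  have hyρ : ‖y‖ ^ 2 ≤ ρ ^ 2 := by gcongr
  set F := nonlinPath G δ u h
  have hψ : Integrable (fun s => 8 * L * rate u h y s) (timeMeasure T) :=
    (integrable_rate u h y).const_mul _
  have hψ0 : ∀ᵐ s ∂(timeMeasure T), 0 ≤ 8 * L * rate u h y s :=
    Eventually.of_forall fun s => mul_nonneg (by positivity) (rate_nonneg u h y s)
  have hm : ∫ s, 8 * L * rate u h y s ∂(timeMeasure T) ≤ m := by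
    rw [integral_const_mul]
    refine mul_le_mul_of_nonneg_left ?_ (by positivity)
    linarith [integral_rate_le hT u h y]
  obtain ⟨M, hM, hMle, hleM⟩ := exists_weightOp (X := H) hψ hψ0
  let D : L2Time T H → StrongPath T := fun f => Λ (0, f)
  have hD : ∀ f, IsLinSol 0 f (D f) := fun f => (hΛ 0 f _).2 rfl
  have hDsub : ∀ f f', D (f - f') = D f - D f' := fun f f' => by
    simp only [D]
    rw [← map_sub, Prod.mk_sub_mk, sub_zero]
  have hbd := fun f => (hD f).weighted_norm_bound hT hψ hψ0 (hM f).symm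
  have hgrad : ∀ f t, gradSq ((D f).1.1 t) ≤ Real.exp m * ‖M f‖ ^ 2 := fun f t =>
    ((hbd f).1 t).trans (by gcongr)
  let Ψ : L2Time T H → L2Time T H := fun f => s' • F (y + D f) - s • F y
  have hcontr : ∀ f f', ‖M f‖ ≤ r → ‖M f'‖ ≤ r → ‖M (Ψ f - Ψ f')‖ ≤ 3 / 4 * ‖M (f - f')‖ := by
    intro f f' hf hf'
    set p := y + D f
    set p' := y + D f'
    have hpp : p - p' = D (f - f') := by rw [hDsub]; simp only [p, p']; abel
    have hΨ : Ψ f - Ψ f' = s' • (F p - F p') := by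
      simp only [Ψ, p, p', smul_sub]; abel
    have hp' : ∀ t, gradSq (p'.1.1 t) ≤ 2 * ρ ^ 2 + 2 + ‖u‖ ^ 2 := by
      intro t
      have h1 : gradSq (p'.1.1 t) ≤ 2 * gradSq (y.1.1 t) + 2 * gradSq ((D f').1.1 t) :=
        gradSq_add_le (y.1.1 t) ((D f').1.1 t)
      have h2 := (y.gradSq_le t).trans hyρ
      have h3 : gradSq ((D f').1.1 t) ≤ 1 :=
        ((hgrad f' t).trans (by gcongr)).trans hmr1
      linarith [sq_nonneg ‖u‖]
    have hlip' := hlip u h p p' (by linarith [sq_nonneg ρ]) hp'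
    rw [hpp] at hlip'
    set g := f - f'
    have key : ‖M (F p - F p')‖ ^ 2 ≤ 1 / 4 * ‖M g‖ ^ 2 +
        2 * L * (Real.exp m * ‖M g‖ ^ 2) * ‖M f‖ ^ 2 := by
      rw [hM (F p - F p')]
      exact weighted_contraction hT hL hm (hD f) (hD g) hlip' (hM f).symm (hM g).symm
    have hMf : ‖M f‖ ^ 2 ≤ r ^ 2 := by gcongr
    have k2 : 2 * L * (Real.exp m * ‖M g‖ ^ 2) * ‖M f‖ ^ 2 ≤ 1 / 4 * ‖M g‖ ^ 2 := by
      calc 2 * L * (Real.exp m * ‖M g‖ ^ 2) * ‖M f‖ ^ 2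
          ≤ 2 * L * (Real.exp m * ‖M g‖ ^ 2) * r ^ 2 := by gcongr
        _ = (2 * L * (Real.exp m * r ^ 2)) * ‖M g‖ ^ 2 := by ring
        _ ≤ _ := by gcongr
    rw [hΨ, map_smul]
    refine abs_le_of_sq_le_sq' ?_ (by positivity) |>.2
    refine (norm_smul_sq_le hs' _).trans ?_
    nlinarith [sq_nonneg ‖M g‖]
  have hleM' : ∀ f, ‖f‖ ≤ √(Real.exp m) * ‖M f‖ := fun f => by
    refine abs_le_of_sq_le_sq' ?_ (by positivity) |>.2
    rw [mul_pow, Real.sq_sqrt (Real.exp_pos m).le]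
    exact (hleM f).trans (by gcongr)
  have hD0 : D 0 = 0 := map_zero Λ
  have h0 : ‖M (Ψ 0)‖ ≤ (1 - 3 / 4) * r := by
    have e : Ψ 0 = (s' - s) • F y := by simp only [Ψ, hD0, add_zero, sub_smul]
    calc ‖M (Ψ 0)‖ ≤ ‖Ψ 0‖ := hMle _
      _ = |s' - s| * ‖F y‖ := by rw [e, norm_smul, Real.norm_eq_abs]
      _ ≤ r / (4 * (|B| + 1)) * (|B| + 1) := by
        gcongr
        linarith [hB y hy, le_abs_self B]
      _ = (1 - 3 / 4) * r := by field_simp; norm_num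
  obtain ⟨f, hf⟩ := exists_fixed_point M (Real.sqrt_nonneg _) hleM' hr0.le (by norm_num)
    (by norm_num) Ψ hcontr h0
  exact ⟨y + D f, hsol.add_of_fixed (hD f) hf⟩

/-- Existence for the controlled equation. The parameter `s` in front of the nonlinear term is
moved from `0`, where the equation is linear, to `1` in steps whose length depends only on the a
priori bound. -/
theorem exists_isMildSol (hT : 0 ≤ T) (hG : NoiseBound G C) (hδ : δ ∈ Icc (0 : ℝ) 1)
    (u : StrongPath T) (h : L2Time T K) (ξ : V) : ∃ y, IsMildSol G δ u h 1 ξ y := by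
  obtain ⟨ρ, -, hρ⟩ := exists_apriori_bound hT hG hδ u ξ (‖h‖ ^ 2)
  obtain ⟨ε, hε, hstep⟩ := exists_continuation_step hT hG hδ u h ξ (ρ := ρ)
  obtain ⟨n, hn⟩ := exists_nat_one_div_lt hε
  have hn0 : (0 : ℝ) < n + 1 := by positivity
  have key : ∀ k : ℕ, k ≤ n + 1 → ∃ y, IsMildSol G δ u h (k / (n + 1 : ℝ)) ξ y := by
    intro k
    induction k with
    | zero =>
      intro _
      obtain ⟨y, hy⟩ := exists_isLinSol hT ξ (0 : L2Time T H)
      refine ⟨y, ?_⟩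
      rw [IsMildSol, Nat.cast_zero, zero_div, zero_smul]
      exact hy
    | succ k ih =>
      intro hk
      obtain ⟨y, hy⟩ := ih (by omega)
      have hk' : (k : ℝ) + 1 ≤ n + 1 := by exact_mod_cast hk
      have hk0 : (0 : ℝ) ≤ k := k.cast_nonneg
      refine hstep (k / (n + 1 : ℝ)) _ y ⟨by positivity, ?_⟩ ?_
        (hρ h _ y le_rfl ⟨by positivity, ?_⟩ hy) hy
      · rw [div_le_one hn0]; push_cast; exact hk'
      · rw [← sub_div]
        push_cast
        rw [add_sub_cancel_left, abs_of_pos (by positivity)]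
        exact hn.le
      · rw [div_le_one hn0]; linarith
  obtain ⟨y, hy⟩ := key (n + 1) le_rfl
  refine ⟨y, ?_⟩
  rwa [Nat.cast_add, Nat.cast_one, div_self hn0.ne'] at hy

theorem IsLinSol.sub {ξ ξ' : V} {f f' : L2Time T H} {y y' : StrongPath T} (h : IsLinSol ξ f y)
    (h' : IsLinSol ξ' f' y') : IsLinSol (ξ - ξ') (f - f') (y - y') :=
  mem_linGraph.1 ((linGraph T).sub_mem (mem_linGraph.2 h) (mem_linGraph.2 h'))

theorem two_inner_le (f : L2Time T H) (y : StrongPath T) (s : ℝ) :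
    2 * inner ℝ (f s) (stokes (y.reg s)) ≤ 1 / 2 * ‖stokes (y.reg s)‖ ^ 2 + 2 * ‖f s‖ ^ 2 := by
  have h2 := real_inner_le_norm (f s) (stokes (y.reg s))
  linarith [sq_nonneg (‖stokes (y.reg s)‖ - 2 * ‖f s‖)]

theorem IsMildSol.isLinSol {u : StrongPath T} {h : L2Time T K} {ξ : V} {y : StrongPath T}
    (hy : IsMildSol G δ u h 1 ξ y) : IsLinSol ξ (nonlinPath G δ u h y) y := by
  rwa [IsMildSol, one_smul] at hy

/-- Uniqueness, from the local Lipschitz estimate and the energy bound for the difference with an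
integrating factor. -/
theorem IsMildSol.unique (hT : 0 ≤ T) (hG : NoiseBound G C) (hδ : δ ∈ Icc (0 : ℝ) 1)
    {u : StrongPath T} {h : L2Time T K} {ξ : V} {y z : StrongPath T}
    (hy : IsMildSol G δ u h 1 ξ y) (hz : IsMildSol G δ u h 1 ξ z) : y = z := by
  obtain ⟨L, hL, hlip⟩ := exists_nonlinPath_lipschitz (T := T) hG hδ
    (R := ‖u‖ ^ 2 + ‖z‖ ^ 2) (η := 1 / 4) (by positivity) (by norm_num)
  have hl := hlip u h y z (by linarith [sq_nonneg ‖z‖]) fun t => by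
    linarith [z.gradSq_le t, sq_nonneg ‖u‖]
  have hd := hy.isLinSol.sub hz.isLinSol
  rw [sub_self] at hd
  have h1 := hd.strong_bound hT (ψ := fun s => 2 * L * rate u h y s) (β := fun _ => 0)
    ((integrable_rate u h y).const_mul _)
    (Eventually.of_forall fun s => mul_nonneg (by positivity) (rate_nonneg u h y s))
    (integrable_zero _ _ _) (Eventually.of_forall fun _ => le_rfl) (by
      filter_upwards [hl] with s hs
      have h2 := two_inner_le (nonlinPath G δ u h y - nonlinPath G δ u h z) (y - z) s
      linarith)
  simp only [gradSq_zero, integral_zero, add_zero, mul_zero] at h1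
  have h2 : ‖y - z‖ = 0 := (pow_eq_zero_iff two_ne_zero).1 (le_antisymm h1 (sq_nonneg _))
  exact sub_eq_zero.1 (norm_eq_zero.1 h2)

end Solve

/-! ### The equations of the statement as mild equations -/

section Relation

variable {K : Type*} [NormedAddCommGroup K] [InnerProductSpace ℝ K] {T : ℝ}
  {G : H → (K →L[ℝ] V)} {C δ : ℝ}

theorem controlledField_eq (u y : StrongPath T) (h : L2Time T K) (s : ℝ) :
    controlledField G δ u y h s =
      nonlin G δ (u.reg s) (h s) (y.reg s) - stokes (y.reg s) := by
  rw [controlledField, nonlin]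
  abel

theorem isControlledSolution_iff (hG : NoiseBound G C) (hδ : δ ∈ Icc (0 : ℝ) 1) {ξ : V}
    {h : L2Time T K} {y : StrongPath T} : IsControlledSolution G δ ξ h y ↔
      IsMildSol G δ (nseSolution T ξ) h 1 ((1 - δ) • ξ) y := by
  have hae : ∀ᵐ s ∂(timeMeasure T), nonlinPath G δ (nseSolution T ξ) h y s - stokes (y.reg s) =
      controlledField G δ (nseSolution T ξ) y h s := by
    filter_upwards [nonlinPath_ae hG hδ (nseSolution T ξ) h y] with s hs
    rw [hs, controlledField_eq]
  have hi : Integrable (controlledField G δ (nseSolution T ξ) y h) (timeMeasure T) :=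
    (integrable_lin_rhs _ y).congr hae
  rw [IsControlledSolution, IsMildSol, one_smul, IsLinSol, and_iff_right hi]
  refine forall_congr' fun t => ?_
  rw [integral_congr_time hae t.2, map_smul]

/-- The Navier–Stokes equations are the controlled equation with `δ = 0` and control `0`. -/
theorem isNSESolution_iff (hG : NoiseBound G C) {ξ : V} {u : StrongPath T} :
    IsNSESolution ξ u ↔ IsMildSol G 0 0 (0 : L2Time T K) 1 ξ u := by
  have hδ : (0 : ℝ) ∈ Icc (0 : ℝ) 1 := ⟨le_rfl, zero_le_one⟩
  have hae : ∀ᵐ s ∂(timeMeasure T), nonlinPath G 0 0 (0 : L2Time T K) u s - stokes (u.reg s) =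
      - stokes (u.reg s) - bilin (u.reg s) (u.reg s) := by
    filter_upwards [nonlinPath_ae hG hδ 0 (0 : L2Time T K) u,
      Lp.coeFn_zero K 2 (timeMeasure T)] with s hs h0
    rw [hs, nonlin, h0, Pi.zero_apply, map_zero, map_zero]
    simp only [zero_smul, sub_zero, one_smul]
    abel
  have hi := (integrable_lin_rhs _ u).congr hae
  rw [IsNSESolution, IsMildSol, one_smul, IsLinSol, and_iff_right hi]
  refine forall_congr' fun t => ?_
  rw [integral_congr_time hae t.2]

theorem isNSESolution_iff_eq (hT : 0 ≤ T) (hG : NoiseBound G C) {ξ : V} (u : StrongPath T) :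
    IsNSESolution ξ u ↔ u = nseSolution T ξ := by
  have hδ : (0 : ℝ) ∈ Icc (0 : ℝ) 1 := ⟨le_rfl, zero_le_one⟩
  obtain ⟨v, hv⟩ := exists_isMildSol hT hG hδ 0 (0 : L2Time T K) ξ
  have hex : ∃ v : StrongPath T, IsNSESolution ξ v := ⟨v, (isNSESolution_iff hG).2 hv⟩
  have hsol : IsNSESolution ξ (nseSolution T ξ) := by
    rw [nseSolution, dif_pos hex]
    exact hex.choose_spec
  constructor
  · intro hu
    exact ((isNSESolution_iff hG).1 hu).unique hT hG hδ ((isNSESolution_iff hG).1 hsol)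
  · rintro rfl
    exact hsol

/-- A control is determined by its primitive: by Lebesgue differentiation it is the derivative of
the primitive almost everywhere. -/
theorem primitive_injective [CompleteSpace K] (hT : 0 ≤ T) :
    Function.Injective (primitive : L2Time T K → C(Icc (0 : ℝ) T, K)) := by
  intro h h' heq
  have hT' : T ∈ Icc 0 T := ⟨hT, le_rfl⟩
  have h1 := (intervalIntegrable_of_time (integrable_L2Time h) hT').ae_hasDerivAt_integral
  have h2 := (intervalIntegrable_of_time (integrable_L2Time h') hT').ae_hasDerivAt_integral
  refine Lp.ext ?_
  have h3 : ∀ᵐ s ∂(timeMeasure T), s ∈ Ioo 0 T := by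
    have : timeMeasure T = volume.restrict (Ioo 0 T) :=
      Measure.restrict_congr_set Ioo_ae_eq_Icc.symm
    rw [this]
    exact ae_restrict_mem measurableSet_Ioo
  filter_upwards [ae_restrict_of_ae h1, ae_restrict_of_ae h2, h3] with s d1 d2 hs
  have hs' : s ∈ uIcc 0 T := by
    rw [uIcc_of_le hT]
    exact Ioo_subset_Icc_self hs
  refine (d1 hs' 0 left_mem_uIcc).unique ((d2 hs' 0 left_mem_uIcc).congr_of_eventuallyEq ?_)
  filter_upwards [Ioo_mem_nhds hs.1 hs.2] with t ht
  exact congrArg (fun p : C(Icc (0 : ℝ) T, K) => p ⟨t, Ioo_subset_Icc_self ht⟩) heq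

/-- `Γ` sends the primitive of `h` to the solution of the controlled equation with control `h`. -/
theorem Gam_primitive [CompleteSpace K] (hT : 0 ≤ T) (hG : NoiseBound G C)
    (hδ : δ ∈ Icc (0 : ℝ) 1) {ξ : V} {h : L2Time T K} {y : StrongPath T}
    (hy : IsMildSol G δ (nseSolution T ξ) h 1 ((1 - δ) • ξ) y) :
    Gam G δ ξ (primitive h) = y.toEnergy := by
  have hx : ∃ z : StrongPath T, ∃ h' : L2Time T K, primitive h' = primitive h ∧
      IsControlledSolution G δ ξ h' z := ⟨y, h, rfl, (isControlledSolution_iff hG hδ).2 hy⟩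
  rw [Gam, dif_pos hx]
  obtain ⟨h', h1, h2⟩ := hx.choose_spec
  rw [primitive_injective hT h1] at h2
  rw [((isControlledSolution_iff hG hδ).1 h2).unique hT hG hδ hy]

theorem continuous_toEnergy : Continuous (StrongPath.toEnergy : StrongPath T → EnergyPath T) := by
  have c1 : Continuous fun y : StrongPath T =>
      (ContinuousMap.comp ⟨vToH, vToH.continuous⟩ y.1.1 : C(Icc (0 : ℝ) T, H)) :=
    (ContinuousMap.continuous_postcomp _).comp (continuous_fst.comp continuous_subtype_val)
  have c2 : Continuous fun y : StrongPath T => daToV.compLp y.1.2 :=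
    (daToV.compLpL 2 (timeMeasure T)).continuous.comp
      (continuous_snd.comp continuous_subtype_val)
  exact Continuous.subtype_mk (c1.prodMk c2) _

end Relation

/-! ### Stability of the controlled equation -/

section Stability

variable {K : Type*} [NormedAddCommGroup K] [InnerProductSpace ℝ K] {T : ℝ}
  {G : H → (K →L[ℝ] V)} {C δ : ℝ}

/-- The difference of two solutions with controls `h`, `h'` is governed by the solution `z` of the
linear equation with right-hand side the increment of the noise term along the first of them. -/
theorem exists_stability_bound (hT : 0 ≤ T) (hG : NoiseBound G C) (hδ : δ ∈ Icc (0 : ℝ) 1)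
    (u : StrongPath T) (ξ : V) (m : ℝ) (y : StrongPath T) :
    ∃ c, 0 ≤ c ∧ ∀ (h h' : L2Time T K) (y' z : StrongPath T), ‖h'‖ ^ 2 ≤ m →
      IsMildSol G δ u h 1 ξ y → IsMildSol G δ u h' 1 ξ y' →
      IsLinSol 0 (nonlinPath G δ u h' y - nonlinPath G δ u h y) z → ‖y' - y‖ ≤ c * ‖z‖ := by
  obtain ⟨ρ, -, hρ⟩ := exists_apriori_bound hT hG hδ u ξ m
  obtain ⟨L, hL, hlip⟩ := exists_nonlinPath_lipschitz (T := T) hG hδ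
    (R := ‖u‖ ^ 2 + ρ ^ 2) (η := 1 / 8) (by positivity) (by norm_num)
  set n := |T + m + ‖y‖ ^ 2 + ‖u‖ ^ 2|
  set c := 3 * (Real.exp (4 * L * n) * (1 / 2 + 4 * L * n))
  have hc : 0 ≤ c := by positivity
  refine ⟨√c + 1, by positivity, fun h h' y' z hm hy hy' hz => ?_⟩
  have hyρ : ‖y'‖ ^ 2 ≤ ρ ^ 2 := by
    gcongr
    exact hρ h' 1 y' hm ⟨zero_le_one, le_rfl⟩ hy'
  have hl := hlip u h' y y' (by linarith [sq_nonneg ρ]) fun t => by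
    linarith [y'.gradSq_le t, sq_nonneg ‖u‖]
  have hw := hy.isLinSol.sub hy'.isLinSol
  have hr := hw.add hz
  rw [sub_self, add_zero] at hr
  have ef : nonlinPath G δ u h y - nonlinPath G δ u h' y' +
      (nonlinPath G δ u h' y - nonlinPath G δ u h y) =
      nonlinPath G δ u h' y - nonlinPath G δ u h' y' := by abel
  rw [ef] at hr
  have hrate : ∫ s, rate u h' y s ∂(timeMeasure T) ≤ n :=
    (integral_rate_le hT u h' y).trans
      (le_trans (by linarith) (le_abs_self (T + m + ‖y‖ ^ 2 + ‖u‖ ^ 2)))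
  have hi1 := z.integrable_stokes_sq.const_mul (1 / 2)
  have hi2 := (integrable_rate u h' y).const_mul (4 * L * ‖z‖ ^ 2)
  have h1 := hr.strong_bound hT (ψ := fun s => 4 * L * rate u h' y s)
    (β := fun s => 1 / 2 * ‖stokes (z.reg s)‖ ^ 2 + 4 * L * ‖z‖ ^ 2 * rate u h' y s)
    ((integrable_rate u h' y).const_mul _)
    (Eventually.of_forall fun s => mul_nonneg (by positivity) (rate_nonneg u h' y s))
    (hi1.add hi2)
    (Eventually.of_forall fun s => add_nonneg (by positivity)
      (mul_nonneg (by positivity) (rate_nonneg u h' y s))) (by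
      filter_upwards [hl, (y - y').reg_add z, z.ae_gradSq_le,
        StrongPath.reg_add (y - y' + z) (-z), z.reg_neg] with s hs h2 h3 h4 h5
      have h6 := two_inner_le (nonlinPath G δ u h' y - nonlinPath G δ u h' y') (y - y' + z) s
      have e1 : (y - y').reg s = (y - y' + z).reg s + (-z).reg s := by
        rw [← h4, add_neg_cancel_right]
      have e2 : stokes ((-z).reg s) = - stokes (z.reg s) := by
        rw [h5, ← stokesL_apply, map_neg, stokesL_apply]
      have e3 : gradSq (daToV ((-z).reg s)) = gradSq (daToV (z.reg s)) := by
        rw [h5]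
        simp [gradSq]
      have h7 : ‖stokes ((y - y').reg s)‖ ^ 2 ≤
          2 * ‖stokes ((y - y' + z).reg s)‖ ^ 2 + 2 * ‖stokes (z.reg s)‖ ^ 2 := by
        rw [e1]
        refine (stokes_add_sq_le _ _).trans_eq ?_
        rw [e2, norm_neg]
      have h8 : gradSq (daToV ((y - y').reg s)) ≤
          2 * gradSq (daToV ((y - y' + z).reg s)) + 2 * ‖z‖ ^ 2 := by
        rw [e1, map_add]
        refine (gradSq_add_le _ _).trans ?_
        rw [e3]
        linarith
      have h9 : L * rate u h' y s * gradSq (daToV ((y - y').reg s)) ≤ L * rate u h' y s *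
          (2 * gradSq (daToV ((y - y' + z).reg s)) + 2 * ‖z‖ ^ 2) :=
        mul_le_mul_of_nonneg_left h8 (mul_nonneg hL (rate_nonneg u h' y s))
      linarith)
  have h2 : ∫ s, (1 / 2 * ‖stokes (z.reg s)‖ ^ 2 + 4 * L * ‖z‖ ^ 2 * rate u h' y s)
      ∂(timeMeasure T) ≤ (1 / 2 + 4 * L * n) * ‖z‖ ^ 2 := by
    rw [integral_add hi1 hi2, integral_const_mul, integral_const_mul]
    have := mul_le_mul_of_nonneg_left hrate (by positivity : 0 ≤ 4 * L * ‖z‖ ^ 2)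
    linarith [z.integral_stokes_sq_le]
  have h3 : ‖y - y' + z‖ ^ 2 ≤ c * ‖z‖ ^ 2 := by
    refine h1.trans ?_
    have h0 : 0 ≤ ∫ s, (1 / 2 * ‖stokes (z.reg s)‖ ^ 2 + 4 * L * ‖z‖ ^ 2 * rate u h' y s)
        ∂(timeMeasure T) := integral_nonneg fun s => add_nonneg (by positivity)
      (mul_nonneg (by positivity) (rate_nonneg u h' y s))
    rw [gradSq_zero, zero_add, integral_const_mul]
    calc 3 * (Real.exp (4 * L * ∫ s, rate u h' y s ∂(timeMeasure T)) * _)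
        ≤ 3 * (Real.exp (4 * L * n) * ((1 / 2 + 4 * L * n) * ‖z‖ ^ 2)) := by gcongr
      _ = c * ‖z‖ ^ 2 := by simp only [c]; ring
  have h4 : ‖y - y' + z‖ ≤ √c * ‖z‖ := by
    refine abs_le_of_sq_le_sq' ?_ (by positivity) |>.2
    rwa [mul_pow, Real.sq_sqrt hc]
  calc ‖y' - y‖ = ‖(y - y' + z) - z‖ := by
        rw [add_sub_cancel_right]
        exact norm_sub_rev _ _
    _ ≤ ‖y - y' + z‖ + ‖z‖ := norm_sub_le _ _
    _ ≤ (√c + 1) * ‖z‖ := by linarith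

/-- The noise term along a path depends on the control through a bounded operator from
`L²(0, T; K)` to `L²(0, T; 𝐕)`. -/
theorem exists_noiseOp (hG : NoiseBound G C) (hδ : δ ∈ Icc (0 : ℝ) 1) (u y : StrongPath T) :
    ∃ N : L2Time T K →L[ℝ] L2Time T V, ∀ h h' : L2Time T K,
      nonlinPath G δ u h y - nonlinPath G δ u h' y = vToH.compLp (N (h - h')) := by
  let v : ℝ → H := fun s => δ • daToH (u.reg s) + (1 - δ) • daToH (y.reg s)
  have hv : AEStronglyMeasurable v (timeMeasure T) := by
    have m1 := Continuous.comp_aestronglyMeasurable daToH.continuous u.aestronglyMeasurable_reg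
    have m2 := Continuous.comp_aestronglyMeasurable daToH.continuous y.aestronglyMeasurable_reg
    exact (m1.const_smul δ).add (m2.const_smul (1 - δ))
  set B := 2 * C ^ 2 * (1 + 2 * ‖u‖ ^ 2 + 2 * ‖y‖ ^ 2) with hB
  have hC := hG.nonneg
  have hbd : ∀ h : L2Time T K, ∀ᵐ s ∂(timeMeasure T), ‖G (v s) (h s)‖ ^ 2 ≤ B * ‖h s‖ ^ 2 := by
    intro h
    filter_upwards [u.ae_gradSq_le, y.ae_gradSq_le] with s h1 h2
    refine (norm_noise_sq_le hG hδ (u.reg s) (y.reg s) (h s)).trans ?_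
    rw [hB]
    gcongr
  have hmeas : ∀ h : L2Time T K, AEStronglyMeasurable (fun s => G (v s) (h s)) (timeMeasure T) := by
    intro h
    have hc : Continuous fun p : H × K => G p.1 p.2 :=
      (hG.continuous.comp continuous_fst).clm_apply continuous_snd
    have hp : AEStronglyMeasurable (fun s => (v s, h s)) (timeMeasure T) :=
      hv.prodMk (Lp.aestronglyMeasurable h)
    have := Continuous.comp_aestronglyMeasurable hc hp
    exact this
  have hmem : ∀ h : L2Time T K, MemLp (fun s => G (v s) (h s)) 2 (timeMeasure T) := fun h =>
    memLp_two_of_sq_le (hmeas h) ((integrable_norm_sq h).const_mul B) (hbd h)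
  let N : L2Time T K →ₗ[ℝ] L2Time T V :=
    { toFun := fun h => (hmem h).toLp
      map_add' := fun f g => by
        rw [← MemLp.toLp_add]
        refine MemLp.toLp_congr _ _ ?_
        filter_upwards [Lp.coeFn_add f g] with s hs
        rw [hs, Pi.add_apply, Pi.add_apply, map_add]
      map_smul' := fun a f => by
        rw [RingHom.id_apply, ← MemLp.toLp_const_smul]
        refine MemLp.toLp_congr _ _ ?_
        filter_upwards [Lp.coeFn_smul a f] with s hs
        rw [hs, Pi.smul_apply, Pi.smul_apply, map_smul] }
  refine ⟨N.mkContinuous (√B) fun h => ?_, fun h h' => ?_⟩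
  · refine abs_le_of_sq_le_sq' ?_ (by positivity) |>.2
    rw [mul_pow, Real.sq_sqrt (by positivity), ← integral_norm_sq, ← integral_norm_sq,
      ← integral_const_mul]
    refine integral_mono_ae (integrable_norm_sq _) ((integrable_norm_sq h).const_mul B) ?_
    filter_upwards [(hmem h).coeFn_toLp, hbd h] with s h1 h2
    change ‖((hmem h).toLp : L2Time T V) s‖ ^ 2 ≤ _
    rwa [h1]
  · refine Lp.ext ?_
    filter_upwards [Lp.coeFn_sub (nonlinPath G δ u h y) (nonlinPath G δ u h' y),
      nonlinPath_ae hG hδ u h y, nonlinPath_ae hG hδ u h' y, vToH.coeFn_compLp (N (h - h')),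
      (hmem (h - h')).coeFn_toLp, Lp.coeFn_sub h h'] with s h1 h2 h3 h4 h5 h6
    have e : vToH.compLp (N (h - h')) s = vToH (G (v s) (h s - h' s)) := by
      rw [h4]
      change vToH (((hmem (h - h')).toLp : L2Time T V) s) = _
      rw [h5, h6, Pi.sub_apply]
    change _ = vToH.compLp (N (h - h')) s
    rw [e, h1, Pi.sub_apply, h2, h3, nonlin, nonlin, map_sub, map_sub]
    simp only [v]
    abel

end Stability

/-! ### Compactness of the Stokes evolution -/

/-- The compactness of the embedding `𝐕 ⊂ 𝐇`, in terms of Fourier coefficients. -/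
theorem tendsto_vToH_of_coef {v : ℕ → V} {B : ℝ} (hB : ∀ n, gradSq (v n) ≤ B)
    (hc : ∀ k, Tendsto (fun n => coef k (vToH (v n))) atTop (𝓝 0)) :
    Tendsto (fun n => ‖vToH (v n)‖ ^ 2) atTop (𝓝 0) := by
  have hB0 : 0 ≤ B := (gradSq_nonneg _).trans (hB 0)
  have hlam : Tendsto (fun k => (lam k * √(lam k))⁻¹) cofinite (𝓝 0) :=
    summable_agmon.tendsto_cofinite_zero
  rw [Metric.tendsto_atTop]
  intro ε hε
  -- only finitely many frequencies satisfy `lam k < 1 / η`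
  obtain ⟨η, hη, hηB⟩ : ∃ η : ℝ, 0 < η ∧ η * B < ε / 2 := by
    refine ⟨ε / (2 * (B + 1)), by positivity, ?_⟩
    rw [div_mul_eq_mul_div, div_lt_div_iff₀ (by positivity) (by positivity)]
    nlinarith
  have hfin : {k : Freq | η * lam k < 1}.Finite := by
    have h1 := hlam.eventually_lt_const (show 0 < η * √η by positivity)
    refine (eventually_cofinite.1 h1).subset fun k hk => ?_
    have hk' : η * lam k < 1 := hk
    change ¬ (lam k * √(lam k))⁻¹ < η * √η
    rw [not_lt, le_inv_comm₀ (by positivity) (mul_pos (lam_pos k) (Real.sqrt_pos.2 (lam_pos k))),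
      le_inv_comm₀ (mul_pos (lam_pos k) (Real.sqrt_pos.2 (lam_pos k))) (by positivity),
      ← one_div, le_div_iff₀ (mul_pos (lam_pos k) (Real.sqrt_pos.2 (lam_pos k)))]
    have h2 : √η * √(lam k) ≤ 1 := by
      rw [← Real.sqrt_mul hη.le]
      exact Real.sqrt_le_one.2 hk'.le
    have h3 : 0 ≤ √η * √(lam k) := by positivity
    calc η * √η * (lam k * √(lam k)) = (η * lam k) * (√η * √(lam k)) := by ring
      _ ≤ 1 * 1 := by gcongr
      _ = 1 := one_mul 1
  set s := hfin.toFinset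
  have hbound : ∀ n, ‖vToH (v n)‖ ^ 2 ≤ ∑ k ∈ s, coef k (vToH (v n)) ^ 2 + η * B := by
    intro n
    have h1 := hasSum_coef_sq (vToH (v n))
    have h2 := (hasSum_gradSq (v n)).mul_left η
    have h3 : HasSum (fun k => if k ∈ s then coef k (vToH (v n)) ^ 2 else 0)
        (∑ k ∈ s, coef k (vToH (v n)) ^ 2) := by
      have := hasSum_sum_of_ne_finset_zero (L := SummationFilter.unconditional Freq) (s := s)
        (f := fun k => if k ∈ s then coef k (vToH (v n)) ^ 2 else 0) fun k hk => if_neg hk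
      rwa [Finset.sum_congr rfl fun k hk => if_pos hk] at this
    have h4 := hasSum_le (fun k => ?_) h1 (h3.add h2)
    · have h5 : η * gradSq (v n) ≤ η * B := by gcongr; exact hB n
      linarith
    · by_cases hk : k ∈ s
      · rw [if_pos hk]
        have := lam_pos k
        have : 0 ≤ η * (lam k * coef k (vToH (v n)) ^ 2) := by positivity
        linarith
      · rw [if_neg hk, zero_add, ← mul_assoc]
        refine le_mul_of_one_le_left (sq_nonneg _) ?_
        by_contra hlt
        exact hk (hfin.mem_toFinset.2 (not_le.1 hlt))
  have hsum : Tendsto (fun n => ∑ k ∈ s, coef k (vToH (v n)) ^ 2) atTop (𝓝 0) := by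
    have := tendsto_finsetSum s fun k _ => (hc k).pow 2
    simpa using this
  obtain ⟨n₀, hn₀⟩ := eventually_atTop.1 (hsum.eventually_lt_const (half_pos hε))
  refine ⟨n₀, fun n hn => ?_⟩
  rw [Real.dist_eq, sub_zero, abs_of_nonneg (sq_nonneg _)]
  linarith [hbound n, hn₀ n hn]

/-- Young's inequality for the pairing of `A y` with an element of `𝐕`. -/
theorem two_inner_stokes_le (v : V) (y : DA) {c : ℝ} (hc : 0 < c) :
    2 * inner ℝ (vToH v) (stokes y) ≤ c * gradSq v + c⁻¹ * gradSq (daToV y) := by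
  refine hasSum_le (fun k => ?_) ((coef_hasSum_inner (vToH v) (stokes y)).mul_left 2)
    (((hasSum_gradSq v).mul_left c).add ((hasSum_gradSq (daToV y)).mul_left c⁻¹))
  have h1 := lam_pos k
  rw [coef_stokes]
  change 2 * (coef k (vToH v) * (lam k * coef k (vToH (daToV y)))) ≤ _
  set a := coef k (vToH v)
  set b := coef k (vToH (daToV y))
  have h2 : 0 ≤ lam k * c⁻¹ * (c * a - b) ^ 2 := by positivity
  have h3 : lam k * c⁻¹ * (c * a - b) ^ 2 =
      c * (lam k * a ^ 2) + c⁻¹ * (lam k * b ^ 2) - 2 * (a * (lam k * b)) := by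
    field_simp
    ring
  linarith

/-- Interpolation of `𝐕` between `𝐇` and `D(A)`. -/
theorem gradSq_le_interpolation (y : DA) {c : ℝ} (hc : 0 < c) :
    gradSq (daToV y) ≤ c * ‖stokes y‖ ^ 2 + c⁻¹ * ‖daToH y‖ ^ 2 := by
  refine hasSum_le (fun k => ?_) (hasSum_gradSq (daToV y))
    (((hasSum_stokes y).mul_left c).add ((hasSum_coef_sq (daToH y)).mul_left c⁻¹))
  change lam k * coef k (daToH y) ^ 2 ≤ _
  have h2 : 0 ≤ c⁻¹ * (c * lam k - 1 / 2) ^ 2 * coef k (daToH y) ^ 2 := by positivity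
  have h3 : c⁻¹ * (c * lam k - 1 / 2) ^ 2 * coef k (daToH y) ^ 2 =
      c * (lam k ^ 2 * coef k (daToH y) ^ 2) + c⁻¹ / 4 * coef k (daToH y) ^ 2 -
        lam k * coef k (daToH y) ^ 2 := by
    field_simp
    ring
  have h4 : 0 ≤ c⁻¹ * coef k (daToH y) ^ 2 := by positivity
  linarith

section Weak

variable {T : ℝ}

/-- If the right-hand side is the inclusion of `g ∈ L²(0, T; 𝐕)`, the solution with zero initial
value is controlled by its norm in `L²(0, T; 𝐇)`, up to an arbitrarily small multiple of `‖g‖`. -/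
theorem IsLinSol.norm_sq_le_of_compLp (hT : 0 ≤ T) {g : L2Time T V} {z : StrongPath T}
    (h : IsLinSol 0 (vToH.compLp g) z) {c : ℝ} (hc : 0 < c) :
    ‖z‖ ^ 2 ≤ 3 * (c * ‖g‖ ^ 2 + c⁻¹ * c⁻¹ * ∫ s, ‖daToH (z.reg s)‖ ^ 2 ∂(timeMeasure T)) := by
  have hz : MemLp (fun s => daToH (z.reg s)) 2 (timeMeasure T) := daToH.comp_memLp' z.memLp_reg
  have hz2 : Integrable (fun s => ‖daToH (z.reg s)‖ ^ 2) (timeMeasure T) :=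
    hz.norm.integrable_sq
  have hi := ((integrable_norm_sq g).const_mul c).add (hz2.const_mul (c⁻¹ * c⁻¹))
  have h1 := h.strong_bound hT (ψ := fun _ => 0)
    (β := fun s => c * ‖g s‖ ^ 2 + c⁻¹ * c⁻¹ * ‖daToH (z.reg s)‖ ^ 2)
    (integrable_zero _ _ _) (Eventually.of_forall fun _ => le_rfl) hi
    (Eventually.of_forall fun s => by positivity) (by
      filter_upwards [vToH.coeFn_compLp g] with s hs
      rw [hs]
      have e1 := two_inner_stokes_le (g s) (z.reg s) hc
      have e2 := mul_le_mul_of_nonneg_left (gradSq_le_interpolation (z.reg s) hc)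
        (inv_pos.2 hc).le
      have e3 : c * gradSq (g s) ≤ c * ‖g s‖ ^ 2 := by gcongr; exact gradSq_le_norm_sq _
      have e4 : c⁻¹ * (c * ‖stokes (z.reg s)‖ ^ 2 + c⁻¹ * ‖daToH (z.reg s)‖ ^ 2) =
          ‖stokes (z.reg s)‖ ^ 2 + c⁻¹ * c⁻¹ * ‖daToH (z.reg s)‖ ^ 2 := by
        field_simp
      rw [e4] at e2
      linarith)
  rw [gradSq_zero, zero_add, integral_zero, Real.exp_zero, one_mul,
    integral_add ((integrable_norm_sq g).const_mul c) (hz2.const_mul (c⁻¹ * c⁻¹)),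
    integral_const_mul, integral_const_mul, integral_norm_sq] at h1
  exact h1

section Compact

variable {X : Type*} [NormedAddCommGroup X] [InnerProductSpace ℝ X] [CompleteSpace X]
  {N : X →L[ℝ] L2Time T V} {w : ℕ → X} {D : ℝ} {z : ℕ → StrongPath T}

/-- Let `z_n` solve the linear equation with right-hand side `N w_n`, where `w_n ⇀ 0`. Then
`z_n(t) ⇀ 0` weakly in `𝐕`, hence strongly in `𝐇`, as `𝐕 ⊂ 𝐇` is compact. -/
theorem tendsto_val_linSol_of_weak (hT : 0 ≤ T) (hzD : ∀ n, ‖z n‖ ≤ D)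
    (hw : ∀ x, Tendsto (fun n => inner ℝ (w n) x) atTop (𝓝 0))
    (hz : ∀ n, IsLinSol 0 (vToH.compLp (N (w n))) (z n)) (t : Icc (0 : ℝ) T) :
    Tendsto (fun n => ‖vToH ((z n).1.1 t)‖ ^ 2) atTop (𝓝 0) := by
  obtain ⟨Λ, hΛ⟩ := exists_linSol hT
  let Z : X →L[ℝ] StrongPath T := Λ.comp ((ContinuousLinearMap.inr ℝ V (L2Time T H)).comp
    ((vToH.compLpL 2 (timeMeasure T)).comp N))
  have hZ : ∀ n, z n = Z (w n) := fun n => (hΛ _ _ _).1 (hz n)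
  refine tendsto_vToH_of_coef (B := D ^ 2) (fun n => ?_) fun k => ?_
  · exact ((z n).gradSq_le t).trans (pow_le_pow_left₀ (norm_nonneg _) (hzD n) 2)
  · let ℓ : X →L[ℝ] ℝ := (coef k).comp (vToH.comp ((ContinuousMap.evalCLM ℝ t).comp
      ((ContinuousLinearMap.fst ℝ _ _).comp ((pathSpace T daToV).subtypeL.comp Z))))
    have e : ∀ n, inner ℝ (w n) ((InnerProductSpace.toDual ℝ X).symm ℓ) =
        coef k (vToH ((z n).1.1 t)) := fun n => by
      rw [real_inner_comm, InnerProductSpace.toDual_symm_apply, hZ]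
      rfl
    exact (hw ((InnerProductSpace.toDual ℝ X).symm ℓ)).congr e

/-- Pointwise convergence in `𝐇` and dominated convergence give convergence in `L²(0, T; 𝐇)`. -/
theorem tendsto_integral_linSol_of_weak (hT : 0 ≤ T) (hzD : ∀ n, ‖z n‖ ≤ D)
    (hw : ∀ x, Tendsto (fun n => inner ℝ (w n) x) atTop (𝓝 0))
    (hz : ∀ n, IsLinSol 0 (vToH.compLp (N (w n))) (z n)) :
    Tendsto (fun n => ∫ s, ‖daToH ((z n).reg s)‖ ^ 2 ∂(timeMeasure T)) atTop (𝓝 0) := by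
  have hval : ∀ n, ∀ᵐ s ∂(timeMeasure T), ∀ hs : s ∈ Icc 0 T,
      ‖daToH ((z n).reg s)‖ ^ 2 = ‖vToH ((z n).1.1 ⟨s, hs⟩)‖ ^ 2 := fun n => by
    filter_upwards [(z n).ae_eq] with s h1 hs
    rw [← h1 hs]
    rfl
  have h1 := tendsto_integral_of_dominated_convergence (μ := timeMeasure T)
    (F := fun n s => ‖daToH ((z n).reg s)‖ ^ 2) (f := fun _ => 0)
    (fun _ => D ^ 2) (fun n => ?_) (integrable_const _) (fun n => ?_) ?_
  · simpa using h1
  · have := Continuous.comp_aestronglyMeasurable daToH.continuous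
      (z n).aestronglyMeasurable_reg
    exact this.norm.pow 2
  · filter_upwards [hval n, ae_mem_time] with s h1 hs
    rw [Real.norm_of_nonneg (by positivity), h1 hs]
    have h2 := (norm_vToH_le _).trans (((z n).norm_apply_le ⟨s, hs⟩).trans (hzD n))
    gcongr
  · filter_upwards [ae_all_iff.2 hval, ae_mem_time] with s h1 hs
    exact (tendsto_val_linSol_of_weak hT hzD hw hz ⟨s, hs⟩).congr fun n => (h1 n hs).symm

/-- Weak convergence of `w n` to `0` implies strong convergence to `0` of the solutions of
`z' + A z = N w`, `z(0) = 0`, for a bounded operator `N` with values in `L²(0, T; 𝐕)`. -/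
theorem tendsto_linSol_of_weak (hT : 0 ≤ T) (hD : ∀ n, ‖w n‖ ≤ D)
    (hw : ∀ x, Tendsto (fun n => inner ℝ (w n) x) atTop (𝓝 0))
    (hz : ∀ n, IsLinSol 0 (vToH.compLp (N (w n))) (z n)) :
    Tendsto (fun n => ‖z n‖) atTop (𝓝 0) := by
  have hD0 : 0 ≤ D := (norm_nonneg _).trans (hD 0)
  have hND : ∀ n, ‖N (w n)‖ ≤ ‖N‖ * D := fun n =>
    (N.le_opNorm _).trans (by gcongr; exact hD n)
  have hzD : ∀ n, ‖z n‖ ≤ √3 * (‖vToH‖ * (‖N‖ * D)) := fun n => by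
    have h1 := (hz n).norm_sq_le hT
    rw [gradSq_zero, zero_add] at h1
    have h2 : ‖vToH.compLp (N (w n))‖ ≤ ‖vToH‖ * (‖N‖ * D) :=
      (vToH.norm_compLp_le _).trans (by gcongr; exact hND n)
    refine abs_le_of_sq_le_sq' ?_ (by positivity) |>.2
    rw [mul_pow, Real.sq_sqrt (by norm_num)]
    exact h1.trans (by gcongr)
  have hint := tendsto_integral_linSol_of_weak hT hzD hw hz
  have hsq : Tendsto (fun n => ‖z n‖ ^ 2) atTop (𝓝 0) := by
    rw [Metric.tendsto_atTop]
    intro ε hε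
    set B := (‖N‖ * D) ^ 2
    obtain ⟨c, hc, hcB⟩ : ∃ c : ℝ, 0 < c ∧ 3 * (c * B) < ε / 2 := by
      refine ⟨ε / (6 * (B + 1)), by positivity, ?_⟩
      have : 3 * (ε / (6 * (B + 1)) * B) = ε / 2 * (B / (B + 1)) := by
        field_simp
        ring
      rw [this]
      refine mul_lt_of_lt_one_right (by positivity) ?_
      rw [div_lt_one (by positivity)]
      linarith
    have h1 := (hint.const_mul (3 * (c⁻¹ * c⁻¹)))
    rw [mul_zero] at h1
    obtain ⟨n₀, hn₀⟩ := eventually_atTop.1 (h1.eventually_lt_const (half_pos hε))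
    refine ⟨n₀, fun n hn => ?_⟩
    rw [Real.dist_eq, sub_zero, abs_of_nonneg (sq_nonneg _)]
    have h2 := (hz n).norm_sq_le_of_compLp hT hc
    have h3 : ‖N (w n)‖ ^ 2 ≤ B := pow_le_pow_left₀ (norm_nonneg _) (hND n) 2
    have h4 : c * ‖N (w n)‖ ^ 2 ≤ c * B := by gcongr
    linarith [hn₀ n hn]
  have h5 := hsq.sqrt
  simpa [Real.sqrt_sq] using h5

end Compact

end Weak

/-! ### Weak continuity and compactness -/

section Main

variable {K : Type*} [NormedAddCommGroup K] [InnerProductSpace ℝ K] {T : ℝ}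
  {G : H → (K →L[ℝ] V)} {C δ : ℝ}

/-- Solutions depend continuously, in the norm of `C([0, T]; 𝐕) ∩ L²(0, T; D(A))`, on the control
with the weak topology of bounded sets: the difference of two solutions is dominated by the linear
response to the difference of the controls, which tends to zero by compactness. -/
theorem tendsto_isMildSol_of_weak [CompleteSpace K] (hT : 0 ≤ T) (hG : NoiseBound G C)
    (hδ : δ ∈ Icc (0 : ℝ) 1) {u : StrongPath T} {ξ : V} {m : ℝ} {h : ℕ → L2Time T K}
    {k : L2Time T K} (hm : ∀ n, ‖h n‖ ^ 2 ≤ m) {y : ℕ → StrongPath T} {x : StrongPath T}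
    (hy : ∀ n, IsMildSol G δ u (h n) 1 ξ (y n)) (hx : IsMildSol G δ u k 1 ξ x)
    (hw : ∀ g, Tendsto (fun n => inner ℝ (h n) g) atTop (𝓝 (inner ℝ k g))) :
    Tendsto y atTop (𝓝 x) := by
  obtain ⟨c, -, hc⟩ := exists_stability_bound hT hG hδ u ξ m x
  obtain ⟨N, hN⟩ := exists_noiseOp hG hδ u x
  choose z hz using fun n => exists_isLinSol hT 0 (vToH.compLp (N (h n - k)))
  have h1 : Tendsto (fun n => ‖z n‖) atTop (𝓝 0) := by
    refine tendsto_linSol_of_weak hT (w := fun n => h n - k) (D := √m + ‖k‖) (fun n => ?_)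
      (fun g => ?_) hz
    · exact (norm_sub_le _ _).trans (add_le_add (Real.le_sqrt_of_sq_le (hm n)) le_rfl)
    · have := (hw g).sub_const (inner ℝ k g)
      rw [sub_self] at this
      exact this.congr fun n => (inner_sub_left _ _ _).symm
  rw [tendsto_iff_norm_sub_tendsto_zero]
  have h2 := h1.const_mul c
  rw [mul_zero] at h2
  refine squeeze_zero (fun n => norm_nonneg _) (fun n => ?_) h2
  refine hc k (h n) (y n) (z n) (hm n) hx (hy n) ?_
  rw [hN]
  exact hz n

theorem mem_controls_iff {M : ℝ} {h : L2Time T K} : h ∈ controls T K M ↔ ‖h‖ ^ 2 ≤ M := by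
  rw [← integral_norm_sq]
  rfl

/-- Weak sequential compactness of `𝒜_M`. -/
theorem exists_weak_subseq_controls [CompleteSpace K] [TopologicalSpace.SeparableSpace K] {M : ℝ}
    (hM : 0 ≤ M) {h : ℕ → L2Time T K} (hh : ∀ n, h n ∈ controls T K M) :
    ∃ k ∈ controls T K M, ∃ φ : ℕ → ℕ, StrictMono φ ∧
      ∀ g, Tendsto (fun n => inner ℝ (h (φ n)) g) atTop (𝓝 (inner ℝ k g)) := by
  have : SecondCountableTopology K := UniformSpace.secondCountable_of_separable K
  have : Fact ((2 : ℝ≥0∞) ≠ ⊤) := ⟨by norm_num⟩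
  have : IsSeparable (timeMeasure T) := by
    unfold timeMeasure
    infer_instance
  let E := L2Time T K
  have hsep : TopologicalSpace.SeparableSpace E := inferInstance
  have hmem : ∀ n, StrongDual.toWeakDual (InnerProductSpace.toDual ℝ E (h n)) ∈
      WeakDual.toStrongDual ⁻¹' Metric.closedBall (0 : StrongDual ℝ E) √M := fun n => by
    change InnerProductSpace.toDual ℝ E (h n) ∈ Metric.closedBall (0 : StrongDual ℝ E) √M
    rw [mem_closedBall_zero_iff, LinearIsometryEquiv.norm_map]
    exact Real.le_sqrt_of_sq_le (mem_controls_iff.1 (hh n))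
  obtain ⟨ℓ, hℓ, φ, hφ, hlim⟩ := WeakDual.isSeqCompact_closedBall ℝ E 0 √M hmem
  refine ⟨(InnerProductSpace.toDual ℝ E).symm (WeakDual.toStrongDual ℓ), ?_, φ, hφ, fun g => ?_⟩
  · rw [mem_controls_iff, LinearIsometryEquiv.norm_map]
    have h1 : WeakDual.toStrongDual ℓ ∈ Metric.closedBall (0 : StrongDual ℝ E) √M := hℓ
    rw [mem_closedBall_zero_iff] at h1
    calc _ ≤ √M ^ 2 := by gcongr
      _ = M := Real.sq_sqrt hM
  · rw [InnerProductSpace.toDual_symm_apply]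
    exact ((WeakDual.eval_continuous g).tendsto ℓ).comp hlim

end Main

end TorusNSE

end

open TorusNSE in
theorem mainTheorem6 {ι K : Type*} [NormedAddCommGroup K] [InnerProductSpace ℝ K]
    [CompleteSpace K] [TopologicalSpace.SeparableSpace K] (e : HilbertBasis ι ℝ K)
    (G : H → (K →L[ℝ] V)) (hG : NoiseAssumption e G)
    (T : ℝ) (hT : 0 < T) (δ : ℝ) (hδ : δ = 0 ∨ δ = 1) (ξ : V) :
    -- the Navier-Stokes equations are uniquely solvable
    (∀ u : StrongPath T, IsNSESolution ξ u ↔ u = nseSolution T ξ) ∧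
    -- for every control, `Gam` picks the unique solution of the controlled equation
    (∀ h : L2Time T K, ∃ y : StrongPath T,
      (∀ z : StrongPath T, IsControlledSolution G δ ξ h z ↔ z = y) ∧
      Gam G δ ξ (primitive h) = y.toEnergy) ∧
    ∀ M : ℝ, 0 < M →
      -- compactness of the set of solutions
      IsCompact ((fun h : L2Time T K => Gam G δ ξ (primitive h)) '' controls T K M) ∧
      -- weak convergence of controls implies strong convergence of solutions
      ∀ (h : ℕ → L2Time T K) (k : L2Time T K), (∀ n, h n ∈ controls T K M) →
        k ∈ controls T K M →
        (∀ g : L2Time T K, Tendsto (fun n => inner ℝ (h n) g) atTop (𝓝 (inner ℝ k g))) →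
        Tendsto (fun n => Gam G δ ξ (primitive (h n))) atTop (𝓝 (Gam G δ ξ (primitive k))) := by
  obtain ⟨C, hC⟩ := hG.exists_noiseBound
  have hδ' : δ ∈ Icc (0 : ℝ) 1 := by
    rcases hδ with rfl | rfl
    · exact ⟨le_rfl, zero_le_one⟩
    · exact ⟨zero_le_one, le_rfl⟩
  choose Y hY using fun h : L2Time T K =>
    exists_isMildSol hT.le hC hδ' (nseSolution T ξ) h ((1 - δ) • ξ)
  have hGam : ∀ h : L2Time T K, Gam G δ ξ (primitive h) = (Y h).toEnergy := fun h =>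
    Gam_primitive hT.le hC hδ' (hY h)
  have hweak : ∀ M : ℝ, ∀ (h : ℕ → L2Time T K) (k : L2Time T K), (∀ n, h n ∈ controls T K M) →
      (∀ g : L2Time T K, Tendsto (fun n => inner ℝ (h n) g) atTop (𝓝 (inner ℝ k g))) →
      Tendsto (fun n => Gam G δ ξ (primitive (h n))) atTop (𝓝 (Gam G δ ξ (primitive k))) := by
    intro M h k hh hw
    simp only [hGam]
    exact (continuous_toEnergy.tendsto _).comp (tendsto_isMildSol_of_weak hT.le hC hδ'
      (fun n => mem_controls_iff.1 (hh n)) (fun n => hY (h n)) (hY k) hw)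
  refine ⟨fun u => isNSESolution_iff_eq hT.le hC u, fun h => ⟨Y h, fun z => ?_, hGam h⟩,
    fun M hM => ⟨?_, fun h k hh _ hw => hweak M h k hh hw⟩⟩
  · rw [isControlledSolution_iff hC hδ']
    constructor
    · exact fun hz => hz.unique hT.le hC hδ' (hY h)
    · rintro rfl
      exact hY h
  · refine IsSeqCompact.isCompact fun x hx => ?_
    choose h hh hx using hx
    obtain ⟨k, hk, φ, hφ, hw⟩ := exists_weak_subseq_controls hM.le hh
    refine ⟨_, mem_image_of_mem _ hk, φ, hφ, ?_⟩
    refine (hweak M (fun n => h (φ n)) k (fun n => hh _) hw).congr fun n => ?_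
    exact hx (φ n)
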